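/- **Definitions.** Let $H\le \mathrm{GL}(d,\mathbb R)$ be a closed subgroup, $dh$ a left Haar measure on $H$, and let $G=\mathbb R^d\rtimes H$, with left Haar measure $|\det h|^{-1}\,dx\,dh$, act on $L^2(\mathbb R^d)$ by the quasi-regular representation $[\pi(x,h)f](y)=|\det h|^{-1/2}f(h^{-1}(y-x))$. $H$ is called an *admissible dilation group* if $\pi$ is irreducible (no closed invariant subspaces other than $0$ and $L^2(\mathbb R^d)$) and square-integrable (there is $\psi\neq0$ with $(x,h)\mapsto\langle\psi,\pi(x,h)\psi\rangle$ in $L^2(G)$). An *open dual orbit* of $H$ is an open set of the form $\mathcal O=\{h^T\xi: h\in H\}$ with $\xi \in \mathbb R^d$. With $|\cdot|$ the Euclidean norm, $\|\cdot\|$ the corresponding operator norm and $\mathrm{dist}$ the Euclidean distance, put $$A(\xi)=\min\left(\frac{\mathrm{dist}(\xi,\mathcal O^c)}{1+\sqrt{|\xi|^2-\mathrm{dist}(\xi,\mathcal O^c)^2}},\ \frac1{1+|\xi|}\right)\qquad(\xi\in\mathcal O).$$ Let $w:H\to(0,\infty)$ be continuous, $s\ge0$ and $1\le q<\infty$. $\mathcal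 O$ is *$(s,q,w)$-temperately embedded with index $\ell\in\mathbb N$* if for every $\xi_0\in\mathcal O$ 1. $h\mapsto|\det h|^{1/2-1/q}(1+\|h\|)^{s+d+1}\,w(h)\,A(h^T\xi_0)^\ell$ belongs to $L^q(H)$, and 2. $h\mapsto|\det h|^{-1/2-1/q}(1+\|h\|)^{s+d+1}\,w(h)\,A(h^{-T}\xi_0)^\ell$ belongs to $L^1(H)$. $\mathcal O$ is *$w$-temperately embedded* if for all $s\ge0$ and $1\le q<\infty$ there is an $\ell$ (which may depend on $s$ and $q$) such that $\mathcal O$ is $(s,q,w)$-temperately embedded with index $\ell$. **Theorem.** Let $d=2$. Below, weights $w$ are continuous positive functions on the group (submultiplicativity is not needed). (a) Every admissible dilation group $H\le\mathrm{GL}(2,\mathbb R)$ has exactly one open dual orbit $\mathcal O$, and $\mathcal O$ is $w$-temperately embedded for every weight $w$ on $H$ of polynomial growth, i.e. such that $w(h)\le C(1+\|h\|+\|h^{-1}\|)^u$ for all $h \in H$, with some $C,u\in\mathbb R$. (b) (Similitude group.) $H=\left\{\begin{pmatrix}a&b\\-b&a\end{pmatrix}:a^2+b^2>0\right\}$ has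 $\mathbb R^2\setminus\{0\}$ as its only open dual orbit, and this orbit is $w$-temperately embedded whenever $w(h)\le(a^2+b^2)^u+(a^2+b^2)^{-u}$ for some $u\in\mathbb R$. (c) (Diagonal group.) $H=\left\{\begin{pmatrix}a&0\\0&b\end{pmatrix}:ab\ne0\right\}$ has $\{\xi:\xi_1\neq0,\ \xi_2\ne0\}$ as its only open dual orbit, and this orbit is $w$-temperately embedded whenever $w(h)\le(|a|+|a|^{-1})^t(|b|+|b|^{-1})^u$ for some $t,u\in\mathbb R$. (d) (Shearlet-type groups.) For every $c\in\mathbb R$, $H_c=\left\{\begin{pmatrix}a&b\\0&a^c\end{pmatrix}:a,b\in\mathbb R,\ a\neq0\right\}$, where $a^c:=\mathrm{sign}(a)|a|^c$, has $\{\xi:\xi_1\neq0\}$ as its only open dual orbit, and this orbit is $w$-temperately embedded whenever $w(h)\le(|a|+|a|^{-1}+|b|)^u$ for some $u\in\mathbb R$. (e) In particular, for the shearlet group $H_{1/2}$ and all $r_1,r_2\in\mathbb R$, the orbit $\{\xi:\xi_1\ne0\}$ is $w$-temperately embedded for $w(h)=|a|^{r_1}\bigl(|a|+|a|^{-1}+|a|^{-1/2}|b|\bigr)^{r_2}$.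 -/

import Mathlib

open MeasureTheory
open scoped ENNReal

/-- Euclidean space `ℝ^d`. -/
abbrev Rd (d : ℕ) : Type := EuclideanSpace ℝ (Fin d)

/-- The Borel σ-algebra on `GL(d, ℝ)`; subgroups carry the induced one. -/
instance instMeasurableSpaceGL (d : ℕ) : MeasurableSpace (GL (Fin d) ℝ) :=
  borel (GL (Fin d) ℝ)

instance instBorelSpaceGL (d : ℕ) : BorelSpace (GL (Fin d) ℝ) := ⟨rfl⟩

/-- The linear action of a matrix on `ℝ^d`. -/
noncomputable def matAct {d : ℕ} (M : Matrix (Fin d) (Fin d) ℝ) (x : Rd d) : Rd d :=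
  WithLp.toLp 2 (M.mulVec (WithLp.ofLp x))

/-- The operator norm of a matrix with respect to the Euclidean norm. -/
noncomputable def matNorm {d : ℕ} (M : Matrix (Fin d) (Fin d) ℝ) : ℝ :=
  ‖Matrix.toEuclideanCLM (n := Fin d) (𝕜 := ℝ) M‖

/-- `|det h|`. -/
noncomputable def absDet {d : ℕ} (h : GL (Fin d) ℝ) : ℝ :=
  |Matrix.det (h : Matrix (Fin d) (Fin d) ℝ)|

section QuasiRegular

/-- The quasi-regular representation on functions:
`[π(x,h) f](y) = |det h|^(-1/2) f(h⁻¹ (y - x))`. -/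
noncomputable def quasiRegularFun {d : ℕ} (x : Rd d) (h : GL (Fin d) ℝ) (f : Rd d → ℂ) :
    Rd d → ℂ :=
  fun y => ((absDet h ^ (-(1 / 2) : ℝ) : ℝ) : ℂ) *
    f (matAct ((h⁻¹ : GL (Fin d) ℝ) : Matrix (Fin d) (Fin d) ℝ) (y - x))

theorem memLp_quasiRegularFun {d : ℕ} (x : Rd d) (h : GL (Fin d) ℝ) {f : Rd d → ℂ}
    (hf : MemLp f 2 (volume : Measure (Rd d))) :
    MemLp (quasiRegularFun x h f) 2 (volume : Measure (Rd d)) := by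
  set M : Matrix (Fin d) (Fin d) ℝ := ((h⁻¹ : GL (Fin d) ℝ) : Matrix (Fin d) (Fin d) ℝ) with hM
  let T : Rd d →ₗ[ℝ] Rd d := Matrix.toLpLin 2 2 M
  have hT : ∀ y, T y = matAct M y := fun y => rfl
  have hdet : LinearMap.det T ≠ 0 := by
    have h1 : LinearMap.det T = M.det := by
      simp only [T, Matrix.toLpLin_eq_toLin, LinearMap.det_toLin]
    rw [h1, hM]
    exact ((Matrix.isUnit_iff_isUnit_det _).1 (Units.isUnit h⁻¹)).ne_zero
  have hcont : Continuous T := LinearMap.continuous_of_finiteDimensional T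
  have hmap : Measure.map (fun y => T (y - x)) (volume : Measure (Rd d))
      = ENNReal.ofReal |(LinearMap.det T)⁻¹| • (volume : Measure (Rd d)) := by
    have h1 : (fun y => T (y - x)) = T ∘ (fun y => y - x) := rfl
    rw [h1, ← Measure.map_map hcont.measurable (measurable_sub_const x),
      (measurePreserving_sub_right (volume : Measure (Rd d)) x).map_eq,
      Measure.map_linearMap_addHaar_eq_smul_addHaar _ hdet]
  have hf' : MemLp f 2 (Measure.map (fun y => T (y - x)) (volume : Measure (Rd d))) := by
    rw [hmap]
    exact hf.smul_measure ENNReal.ofReal_ne_top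
  have h2 := (memLp_map_measure_iff hf'.1
    (hcont.measurable.comp (measurable_sub_const x)).aemeasurable).1 hf'
  have h3 := h2.const_mul (((absDet h ^ (-(1 / 2) : ℝ) : ℝ) : ℂ))
  refine (congrArg (fun g => MemLp g 2 (volume : Measure (Rd d))) ?_).mp h3
  funext y
  simp [quasiRegularFun, hT, hM]

/-- The operator `π(x,h)` on `L²(ℝ^d)`. -/
noncomputable def quasiRegular {d : ℕ} (x : Rd d) (h : GL (Fin d) ℝ)
    (f : Lp ℂ 2 (volume : Measure (Rd d))) : Lp ℂ 2 (volume : Measure (Rd d)) :=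
  (memLp_quasiRegularFun x h (Lp.memLp f)).toLp (quasiRegularFun x h f)

/-- The quasi-regular representation of `ℝ^d ⋊ H` is irreducible: the only closed invariant
subspaces of `L²(ℝ^d)` are `0` and `L²(ℝ^d)`. -/
def IsIrreducibleQuasiRegular {d : ℕ} (H : Subgroup (GL (Fin d) ℝ)) : Prop :=
  ∀ V : Submodule ℂ (Lp ℂ 2 (volume : Measure (Rd d))),
    IsClosed (V : Set (Lp ℂ 2 (volume : Measure (Rd d)))) →
    (∀ (x : Rd d) (h : H), ∀ f ∈ V, quasiRegular x (h : GL (Fin d) ℝ) f ∈ V) →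
    V = ⊥ ∨ V = ⊤

/-- The quasi-regular representation of `G = ℝ^d ⋊ H` is square-integrable: for some `ψ ≠ 0`
the matrix coefficient `(x,h) ↦ ⟨ψ, π(x,h) ψ⟩` is in `L²(G)`, where the left Haar measure of `G`
is `|det h|⁻¹ dx dh` with `dh` a left Haar measure of `H`. -/
def IsSquareIntegrableQuasiRegular {d : ℕ} (H : Subgroup (GL (Fin d) ℝ)) : Prop :=
  ∃ ψ : Lp ℂ 2 (volume : Measure (Rd d)), ψ ≠ 0 ∧
    ∀ μ : Measure H, μ.IsHaarMeasure →
      ∫⁻ h : H, (∫⁻ x : Rd d, ‖inner ℂ ψ (quasiRegular x (h : GL (Fin d) ℝ) ψ)‖ₑ ^ 2) *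
        ENNReal.ofReal (absDet (h : GL (Fin d) ℝ))⁻¹ ∂μ < ∞

/-- Admissible dilation groups: closed matrix groups whose quasi-regular representation is
irreducible and square-integrable. -/
structure IsAdmissible {d : ℕ} (H : Subgroup (GL (Fin d) ℝ)) : Prop where
  isClosed : IsClosed (H : Set (GL (Fin d) ℝ))
  irreducible : IsIrreducibleQuasiRegular H
  squareIntegrable : IsSquareIntegrableQuasiRegular H

end QuasiRegular

section DualOrbits

/-- The dual action `(ξ, h) ↦ hᵀ ξ`. -/
noncomputable def dualAct {d : ℕ} (h : GL (Fin d) ℝ) (ξ : Rd d) : Rd d :=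
  matAct (Matrix.transpose (h : Matrix (Fin d) (Fin d) ℝ)) ξ

/-- `O` is an open orbit of the dual action of `H`. -/
def IsOpenDualOrbit {d : ℕ} (H : Subgroup (GL (Fin d) ℝ)) (O : Set (Rd d)) : Prop :=
  IsOpen O ∧ ∃ ξ : Rd d, O = {η | ∃ h ∈ H, η = dualAct h ξ}

/-- The auxiliary function
`A(ξ) = min (dist(ξ,Oᶜ) / (1 + √(|ξ|² - dist(ξ,Oᶜ)²)), 1 / (1 + |ξ|))`. -/
noncomputable def auxA {d : ℕ} (O : Set (Rd d)) (ξ : Rd d) : ℝ :=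
  min (Metric.infDist ξ Oᶜ / (1 + Real.sqrt (‖ξ‖ ^ 2 - Metric.infDist ξ Oᶜ ^ 2)))
    (1 / (1 + ‖ξ‖))

/-- `O` is `(s,q,w)`-temperately embedded with index `ℓ`. Both integrability conditions are
required for every base point `ξ₀ ∈ O` and every left Haar measure `μ` of `H`. -/
def IsTemperatelyEmbeddedWithIndex {d : ℕ} (H : Subgroup (GL (Fin d) ℝ)) (O : Set (Rd d))
    (s q : ℝ) (w : H → ℝ) (ℓ : ℕ) : Prop :=
  ∀ ξ₀ ∈ O, ∀ μ : Measure H, μ.IsHaarMeasure →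
    MemLp (fun h : H => absDet (h : GL (Fin d) ℝ) ^ (1 / 2 - 1 / q) *
      (1 + matNorm ((h : GL (Fin d) ℝ) : Matrix (Fin d) (Fin d) ℝ)) ^ (s + d + 1) * w h *
      auxA O (dualAct (h : GL (Fin d) ℝ) ξ₀) ^ ℓ) (ENNReal.ofReal q) μ ∧
    MemLp (fun h : H => absDet (h : GL (Fin d) ℝ) ^ (-(1 / 2) - 1 / q) *
      (1 + matNorm ((h : GL (Fin d) ℝ) : Matrix (Fin d) (Fin d) ℝ)) ^ (s + d + 1) * w h *
      auxA O (dualAct (h : GL (Fin d) ℝ)⁻¹ ξ₀) ^ ℓ) 1 μ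

/-- `O` is `w`-temperately embedded: for all `1 ≤ q < ∞` and `s ≥ 0` it is
`(s,q,w)`-temperately embedded with some index, which may depend on `s` and `q`. -/
def IsTemperatelyEmbedded {d : ℕ} (H : Subgroup (GL (Fin d) ℝ)) (O : Set (Rd d))
    (w : H → ℝ) : Prop :=
  ∀ s q : ℝ, 0 ≤ s → 1 ≤ q → ∃ ℓ : ℕ, IsTemperatelyEmbeddedWithIndex H O s q w ℓ

end DualOrbits

section Examples

/-- The similitude group in dimension two: all matrices `(a b; -b a)` with `a² + b² > 0`. -/
def similitudeGroup : Subgroup (GL (Fin 2) ℝ) where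
  carrier := {h | ∃ a b : ℝ, 0 < a ^ 2 + b ^ 2 ∧
    (h : Matrix (Fin 2) (Fin 2) ℝ) = !![a, b; -b, a]}
  one_mem' := ⟨1, 0, by norm_num, by simp [Matrix.one_fin_two]⟩
  mul_mem' := by
    rintro g h ⟨a, b, hab, hg⟩ ⟨a', b', hab', hh⟩
    refine ⟨a * a' - b * b', a * b' + b * a', ?_, ?_⟩
    · have := mul_pos hab hab'
      nlinarith
    · rw [Units.val_mul, hg, hh]
      ext i j
      fin_cases i <;> fin_cases j <;> simp [Matrix.mul_apply, Fin.sum_univ_two] <;> ring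
  inv_mem' := by
    rintro h ⟨a, b, hab, hh⟩
    have hne : a ^ 2 + b ^ 2 ≠ 0 := hab.ne'
    refine ⟨a / (a ^ 2 + b ^ 2), -b / (a ^ 2 + b ^ 2), ?_, ?_⟩
    · have : (a / (a ^ 2 + b ^ 2)) ^ 2 + (-b / (a ^ 2 + b ^ 2)) ^ 2 = 1 / (a ^ 2 + b ^ 2) := by
        field_simp
      rw [this]
      positivity
    · refine Units.inv_eq_of_mul_eq_one_right ?_
      rw [hh]
      ext i j
      fin_cases i <;> fin_cases j <;> simp [Matrix.mul_apply, Fin.sum_univ_two] <;> field_simp <;>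
        ring

/-- The diagonal group in dimension two: all matrices `(a 0; 0 b)` with `a b ≠ 0`. -/
def diagonalGroup : Subgroup (GL (Fin 2) ℝ) where
  carrier := {h | ∃ a b : ℝ, a * b ≠ 0 ∧ (h : Matrix (Fin 2) (Fin 2) ℝ) = !![a, 0; 0, b]}
  one_mem' := ⟨1, 1, by norm_num, by simp [Matrix.one_fin_two]⟩
  mul_mem' := by
    rintro g h ⟨a, b, hab, hg⟩ ⟨a', b', hab', hh⟩
    refine ⟨a * a', b * b', ?_, ?_⟩
    · have := mul_ne_zero hab hab'
      intro h0
      apply this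
      linarith
    · rw [Units.val_mul, hg, hh]
      ext i j
      fin_cases i <;> fin_cases j <;> simp [Matrix.mul_apply, Fin.sum_univ_two]
  inv_mem' := by
    rintro h ⟨a, b, hab, hh⟩
    have ha : a ≠ 0 := left_ne_zero_of_mul hab
    have hb : b ≠ 0 := right_ne_zero_of_mul hab
    refine ⟨a⁻¹, b⁻¹, mul_ne_zero (inv_ne_zero ha) (inv_ne_zero hb), ?_⟩
    refine Units.inv_eq_of_mul_eq_one_right ?_
    rw [hh]
    ext i j
    fin_cases i <;> fin_cases j <;> simp [Matrix.mul_apply, Fin.sum_univ_two, ha, hb]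

/-- The signed power `a^c = sign(a) |a|^c`. -/
noncomputable def signedPow (a c : ℝ) : ℝ := Real.sign a * |a| ^ c

theorem signedPow_mul (a b c : ℝ) : signedPow (a * b) c = signedPow a c * signedPow b c := by
  have hs : Real.sign (a * b) = Real.sign a * Real.sign b := by
    rcases lt_trichotomy a 0 with ha | ha | ha <;> rcases lt_trichotomy b 0 with hb | hb | hb
    · simp [Real.sign_of_neg, Real.sign_of_pos, ha, hb, mul_pos_of_neg_of_neg]
    · simp [hb]
    · simp [Real.sign_of_neg, Real.sign_of_pos, ha, hb, mul_neg_of_neg_of_pos]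
    · simp [ha]
    · simp [ha]
    · simp [ha]
    · simp [Real.sign_of_neg, Real.sign_of_pos, ha, hb, mul_neg_of_pos_of_neg]
    · simp [hb]
    · simp [Real.sign_of_pos, ha, hb]
  unfold signedPow
  rw [hs, abs_mul, Real.mul_rpow (abs_nonneg a) (abs_nonneg b)]
  ring

theorem signedPow_one (c : ℝ) : signedPow 1 c = 1 := by simp [signedPow]

/-- The shearlet-type group `H_c` in dimension two: all matrices `(a b; 0 a^c)` with `a ≠ 0`,
where `a^c = sign(a) |a|^c`. The shearlet group is `H_{1/2}`. -/
noncomputable def shearletGroup (c : ℝ) : Subgroup (GL (Fin 2) ℝ) where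
  carrier := {h | ∃ a b : ℝ, a ≠ 0 ∧
    (h : Matrix (Fin 2) (Fin 2) ℝ) = !![a, b; 0, signedPow a c]}
  one_mem' := ⟨1, 0, one_ne_zero, by simp [Matrix.one_fin_two, signedPow_one]⟩
  mul_mem' := by
    rintro g h ⟨a, b, ha, hg⟩ ⟨a', b', ha', hh⟩
    refine ⟨a * a', a * b' + b * signedPow a' c, mul_ne_zero ha ha', ?_⟩
    rw [Units.val_mul, hg, hh]
    ext i j
    fin_cases i <;> fin_cases j <;> simp [Matrix.mul_apply, Fin.sum_univ_two, signedPow_mul]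
  inv_mem' := by
    rintro h ⟨a, b, ha, hh⟩
    have h1 : signedPow a c * signedPow a⁻¹ c = 1 := by
      rw [← signedPow_mul, mul_inv_cancel₀ ha, signedPow_one]
    refine ⟨a⁻¹, -(a⁻¹ * b * signedPow a⁻¹ c), inv_ne_zero ha, ?_⟩
    refine Units.inv_eq_of_mul_eq_one_right ?_
    rw [hh]
    ext i j
    fin_cases i <;> fin_cases j <;>
      simp [Matrix.mul_apply, Fin.sum_univ_two, ha, h1, mul_assoc]

/-- The entries of an element of a matrix group. -/
def entry {H : Subgroup (GL (Fin 2) ℝ)} (h : H) (i j : Fin 2) : ℝ :=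
  ((h : GL (Fin 2) ℝ) : Matrix (Fin 2) (Fin 2) ℝ) i j

end Examples

/-! Put N(h) = 1 + ‖h‖ + ‖h⁻¹‖ (`groupSize`). All temperate embedding claims reduce to one pointwise
estimate, `IsSizeControlled`: for each ξ in the orbit, A(hᵀξ)^k N(h) is bounded over the group, with
k independent of ξ. This suffices for two reasons. First, some power N^(-m) is integrable for every
Haar measure of a closed matrix group (`exists_lintegral_groupSize_lt_top`, a Fubini argument
comparing H with Lebesgue measure on matrices). Second, determinants, norms and weights of
polynomial growth are bounded by powers of N, so a high power of A beats them all and leaves N^(-m).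
As N(h⁻¹) = N(h), the condition on h⁻ᵀξ₀ is covered by the same estimate.

For the similitude, diagonal and shearlet-type groups the control is read off from the explicit
orbit: A is at most the distance to the complement and at most 1/(1+|ξ|), so it bounds the entries
of h from above and |det h| from below.

For a general admissible group the orbit must first be found. On the Fourier side π(x,h) is
translation along the dual action times a character and a constant. Irreducibility therefore makes
the dual action ergodic (`IsIrreducibleQuasiRegular.null_or_conull`), and square-integrability gives
a density P = |ψ̂|² whose orbit integrals are almost everywhere one positive finite constant.
Pushing P(hᵀξ) dh forward to the plane gives measures that agree for almost all ξ while each lives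
on a single orbit; so one orbit is conull (`exists_conull_dualOrbit`). Finiteness of the orbit
integral also makes stabilizers bounded. A blow-up at a density point of this orbit shows that the
Lie algebra moves some orbit point in all directions (`exists_infAct_surjective`), and the inverse
function theorem makes the orbit open. Being conull it is dense, hence the only open orbit.

Finally the Lie algebra is isomorphic to ℝ² through its action on a base point of the orbit. It
either contains the identity together with an invertible traceless matrix
(`isSizeControlled_of_one_mem`), or an E fixing the base point and a nilpotent N with a common
eigenvector (`isSizeControlled_of_nilpotent`). The first case is controlled by an invariant
quadratic form, the second by explicit coordinates exp(sN) exp(tE). -/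

section

open scoped Matrix.Norms.L2Operator Topology
open Filter

/-! ### Matrices acting on Euclidean space and the right dual action -/

section MatrixAction

variable {d : ℕ}

theorem matAct_eq_toEuclideanCLM (M : Matrix (Fin d) (Fin d) ℝ) (x : Rd d) :
    matAct M x = Matrix.toEuclideanCLM (n := Fin d) (𝕜 := ℝ) M x := rfl

theorem matAct_mul (M N : Matrix (Fin d) (Fin d) ℝ) (x : Rd d) :
    matAct (M * N) x = matAct M (matAct N x) := by
  simp [matAct]

@[simp] theorem matAct_one (x : Rd d) : matAct (1 : Matrix (Fin d) (Fin d) ℝ) x = x := by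
  simp [matAct]

theorem matAct_add_left (M N : Matrix (Fin d) (Fin d) ℝ) (x : Rd d) :
    matAct (M + N) x = matAct M x + matAct N x := by
  simp [matAct_eq_toEuclideanCLM]

theorem matAct_smul_left (c : ℝ) (M : Matrix (Fin d) (Fin d) ℝ) (x : Rd d) :
    matAct (c • M) x = c • matAct M x := by
  simp [matAct_eq_toEuclideanCLM]

theorem matAct_add (M : Matrix (Fin d) (Fin d) ℝ) (x y : Rd d) :
    matAct M (x + y) = matAct M x + matAct M y := by
  simp [matAct_eq_toEuclideanCLM]

theorem matAct_smul (M : Matrix (Fin d) (Fin d) ℝ) (c : ℝ) (x : Rd d) :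
    matAct M (c • x) = c • matAct M x := by
  simp [matAct_eq_toEuclideanCLM]

@[simp] theorem matAct_zero (M : Matrix (Fin d) (Fin d) ℝ) : matAct M 0 = 0 := by
  simp [matAct_eq_toEuclideanCLM]

theorem norm_matAct_le (M : Matrix (Fin d) (Fin d) ℝ) (x : Rd d) :
    ‖matAct M x‖ ≤ ‖M‖ * ‖x‖ :=
  Matrix.l2_opNorm_mulVec M x

theorem norm_transpose (M : Matrix (Fin d) (Fin d) ℝ) : ‖M.transpose‖ = ‖M‖ := by
  rw [← Matrix.l2_opNorm_conjTranspose M, Matrix.conjTranspose_eq_transpose_of_trivial]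

/-- The scoped L² operator norm is defined through the same continuous linear map, so its API
applies to `matNorm`. -/
theorem matNorm_eq_norm (M : Matrix (Fin d) (Fin d) ℝ) : matNorm M = ‖M‖ := rfl

theorem continuous_matAct :
    Continuous fun p : Matrix (Fin d) (Fin d) ℝ × Rd d => matAct p.1 p.2 := by
  have h : Continuous fun M : Matrix (Fin d) (Fin d) ℝ =>
      Matrix.toEuclideanCLM (n := Fin d) (𝕜 := ℝ) M :=
    LinearMap.continuous_of_finiteDimensional
      ((Matrix.toEuclideanCLM (n := Fin d) (𝕜 := ℝ)).toAlgEquiv.toLinearMap)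
  exact (h.comp continuous_fst).clm_apply continuous_snd

theorem abs_entry_le_norm (M : Matrix (Fin d) (Fin d) ℝ) (i j : Fin d) : |M i j| ≤ ‖M‖ := by
  have h1 : M i j = matAct M (EuclideanSpace.single j 1) i := by
    simp [matAct]
  have h2 := norm_matAct_le M (EuclideanSpace.single j (1 : ℝ))
  rw [h1, ← Real.norm_eq_abs]
  refine (PiLp.norm_apply_le _ _).trans (h2.trans ?_)
  simp

/-- Transposition reverses products: the dual action is a right action. Left Haar measure is thus
the right one for integrals along orbits. -/
theorem dualAct_mul (g h : GL (Fin d) ℝ) (ξ : Rd d) :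
    dualAct (g * h) ξ = dualAct h (dualAct g ξ) := by
  simp [dualAct, Matrix.transpose_mul, matAct_mul]

@[simp] theorem dualAct_one (ξ : Rd d) : dualAct (1 : GL (Fin d) ℝ) ξ = ξ := by
  simp [dualAct]

@[simp] theorem dualAct_inv_dualAct (h : GL (Fin d) ℝ) (ξ : Rd d) :
    dualAct h⁻¹ (dualAct h ξ) = ξ := by
  rw [← dualAct_mul, mul_inv_cancel, dualAct_one]

theorem continuous_dualAct : Continuous fun p : GL (Fin d) ℝ × Rd d => dualAct p.1 p.2 :=
  continuous_matAct.comp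
    (((Units.continuous_val.comp continuous_fst).matrix_transpose).prodMk continuous_snd)

theorem absDet_pos (h : GL (Fin d) ℝ) : 0 < absDet h :=
  abs_pos.2 ((Matrix.isUnit_iff_isUnit_det _).1 (Units.isUnit h)).ne_zero

theorem absDet_inv (h : GL (Fin d) ℝ) : absDet h⁻¹ = (absDet h)⁻¹ := by
  have : absDet h⁻¹ * absDet h = 1 := by
    rw [absDet, absDet, ← abs_mul, ← Matrix.det_mul, ← Units.val_mul]
    simp
  exact eq_inv_of_mul_eq_one_left this

theorem continuous_absDet : Continuous (absDet : GL (Fin d) ℝ → ℝ) :=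
  (Units.continuous_val.matrix_det).abs

end MatrixAction

/-! ### The size function on the group and its compact sublevel sets -/

section GroupSize

variable {d : ℕ}

/-- The size `1 + ‖h‖ + ‖h⁻¹‖` of an invertible matrix. -/
noncomputable def groupSize (h : GL (Fin d) ℝ) : ℝ :=
  1 + matNorm (h : Matrix (Fin d) (Fin d) ℝ) +
    matNorm ((h⁻¹ : GL (Fin d) ℝ) : Matrix (Fin d) (Fin d) ℝ)

theorem one_le_groupSize (h : GL (Fin d) ℝ) : 1 ≤ groupSize h := by
  unfold groupSize
  rw [matNorm_eq_norm, matNorm_eq_norm]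
  have := norm_nonneg (h : Matrix (Fin d) (Fin d) ℝ)
  have := norm_nonneg ((h⁻¹ : GL (Fin d) ℝ) : Matrix (Fin d) (Fin d) ℝ)
  linarith

theorem groupSize_pos (h : GL (Fin d) ℝ) : 0 < groupSize h :=
  one_pos.trans_le (one_le_groupSize h)

theorem norm_le_groupSize (h : GL (Fin d) ℝ) :
    1 + ‖(h : Matrix (Fin d) (Fin d) ℝ)‖ ≤ groupSize h := by
  unfold groupSize
  rw [matNorm_eq_norm, matNorm_eq_norm]
  have := norm_nonneg ((h⁻¹ : GL (Fin d) ℝ) : Matrix (Fin d) (Fin d) ℝ)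
  linarith

theorem groupSize_inv (h : GL (Fin d) ℝ) : groupSize h⁻¹ = groupSize h := by
  unfold groupSize
  rw [inv_inv]
  ring

theorem norm_inv_le_groupSize (h : GL (Fin d) ℝ) :
    1 + ‖((h⁻¹ : GL (Fin d) ℝ) : Matrix (Fin d) (Fin d) ℝ)‖ ≤ groupSize h := by
  rw [← groupSize_inv]
  exact norm_le_groupSize _

theorem groupSize_mul_le (g h : GL (Fin d) ℝ) :
    groupSize (g * h) ≤ groupSize g * groupSize h := by
  unfold groupSize
  simp only [matNorm_eq_norm, mul_inv_rev, Units.val_mul]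
  have h1 := norm_mul_le (g : Matrix (Fin d) (Fin d) ℝ) (h : Matrix (Fin d) (Fin d) ℝ)
  have h2 := norm_mul_le ((h⁻¹ : GL (Fin d) ℝ) : Matrix (Fin d) (Fin d) ℝ)
    ((g⁻¹ : GL (Fin d) ℝ) : Matrix (Fin d) (Fin d) ℝ)
  have e1 := norm_nonneg (g : Matrix (Fin d) (Fin d) ℝ)
  have e2 := norm_nonneg (h : Matrix (Fin d) (Fin d) ℝ)
  have e3 := norm_nonneg ((h⁻¹ : GL (Fin d) ℝ) : Matrix (Fin d) (Fin d) ℝ)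
  have e4 := norm_nonneg ((g⁻¹ : GL (Fin d) ℝ) : Matrix (Fin d) (Fin d) ℝ)
  nlinarith [mul_nonneg e1 e3, mul_nonneg e4 e2]

theorem continuous_groupSize : Continuous (groupSize : GL (Fin d) ℝ → ℝ) :=
  (continuous_const.add Units.continuous_val.norm).add
    (Units.continuous_val.comp continuous_inv).norm

/-- The map h ↦ (h, h⁻¹) embeds the general linear group as a closed subset of a product of two
matrix spaces, and the size bounds both components. -/
theorem isCompact_groupSize_le (R : ℝ) : IsCompact {h : GL (Fin d) ℝ | groupSize h ≤ R} := by
  have hK : IsCompact ((Metric.closedBall (0 : Matrix (Fin d) (Fin d) ℝ) R) ×ˢ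
      (MulOpposite.unop ⁻¹' Metric.closedBall (0 : Matrix (Fin d) (Fin d) ℝ) R)) := by
    refine (isCompact_closedBall _ _).prod ?_
    exact MulOpposite.opHomeomorph.symm.isCompact_preimage.2 (isCompact_closedBall _ _)
  have h2 := Units.isClosedEmbedding_embedProduct.isCompact_preimage hK
  refine h2.of_isClosed_subset (isClosed_le continuous_groupSize continuous_const) ?_
  intro h hh
  have h3 := norm_le_groupSize h
  have h4 := norm_inv_le_groupSize h
  have hh' : groupSize h ≤ R := hh
  refine ⟨?_, ?_⟩
  · simp only [Units.embedProduct_apply, Metric.mem_closedBall, dist_zero_right]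
    linarith
  · simp only [Units.embedProduct_apply, Set.mem_preimage, Metric.mem_closedBall,
      dist_zero_right, MulOpposite.unop_op]
    linarith

theorem isCompact_subgroup_groupSize_le {H : Subgroup (GL (Fin d) ℝ)}
    (hH : IsClosed (H : Set (GL (Fin d) ℝ))) (R : ℝ) :
    IsCompact {h : H | groupSize (h : GL (Fin d) ℝ) ≤ R} :=
  hH.isClosedEmbedding_subtypeVal.isCompact_preimage (isCompact_groupSize_le R)

instance secondCountableTopologyGL : SecondCountableTopology (GL (Fin d) ℝ) :=
  haveI : SecondCountableTopology (Matrix (Fin d) (Fin d) ℝ) := secondCountable_of_proper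
  (Units.isOpenEmbedding_val (R := Matrix (Fin d) (Fin d) ℝ)).isEmbedding.secondCountableTopology

instance secondCountableTopologySubgroup (H : Subgroup (GL (Fin d) ℝ)) :
    SecondCountableTopology H :=
  TopologicalSpace.Subtype.secondCountableTopology (H : Set (GL (Fin d) ℝ))

theorem locallyCompactSpace_of_isClosed {H : Subgroup (GL (Fin d) ℝ)}
    (hH : IsClosed (H : Set (GL (Fin d) ℝ))) : LocallyCompactSpace H :=
  hH.isClosedEmbedding_subtypeVal.locallyCompactSpace

theorem dualAct_le_groupSize (h : GL (Fin d) ℝ) (ξ : Rd d) :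
    ‖dualAct h ξ‖ ≤ groupSize h * ‖ξ‖ := by
  refine (norm_matAct_le _ _).trans ?_
  rw [norm_transpose]
  have := norm_le_groupSize h
  gcongr
  linarith

end GroupSize

/-! ### Polynomial growth of Haar measure -/

section HaarGrowth

variable {d : ℕ}

theorem norm_one_matrix_le : ‖(1 : Matrix (Fin d) (Fin d) ℝ)‖ ≤ 1 := by
  rw [← Matrix.diagonal_one, Matrix.l2_opNorm_diagonal]
  exact (pi_norm_le_iff_of_nonneg zero_le_one).2 (by simp)

/-- With x = h₀⁻¹h one has x = 1 + h₀⁻¹(g - h₀) - x h⁻¹(g - h), whence ‖x‖ ≤ 1 + 1/4 + ‖x‖/4. So two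
group elements that are both relatively close to one matrix g differ by a bounded factor. -/
theorem groupSize_mul_le_of_near {g : Matrix (Fin d) (Fin d) ℝ} {h₀ h : GL (Fin d) ℝ}
    (hg₀ : ‖g - h₀‖ * ‖((h₀⁻¹ : GL (Fin d) ℝ) : Matrix (Fin d) (Fin d) ℝ)‖ < 1 / 4)
    (hg : ‖g - h‖ * ‖((h⁻¹ : GL (Fin d) ℝ) : Matrix (Fin d) (Fin d) ℝ)‖ < 1 / 4) :
    ‖((h₀⁻¹ * h : GL (Fin d) ℝ) : Matrix (Fin d) (Fin d) ℝ)‖ ≤ 2 := by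
  set x : Matrix (Fin d) (Fin d) ℝ := ((h₀⁻¹ * h : GL (Fin d) ℝ) : Matrix (Fin d) (Fin d) ℝ)
    with hx
  set i₀ : Matrix (Fin d) (Fin d) ℝ := ((h₀⁻¹ : GL (Fin d) ℝ) : Matrix (Fin d) (Fin d) ℝ)
  set i : Matrix (Fin d) (Fin d) ℝ := ((h⁻¹ : GL (Fin d) ℝ) : Matrix (Fin d) (Fin d) ℝ)
  have e0 : i₀ * (h₀ : Matrix (Fin d) (Fin d) ℝ) = 1 := by
    rw [← Units.val_mul, inv_mul_cancel, Units.val_one]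
  have e1 : i * (h : Matrix (Fin d) (Fin d) ℝ) = 1 := by
    rw [← Units.val_mul, inv_mul_cancel, Units.val_one]
  have e2 : (h : Matrix (Fin d) (Fin d) ℝ) * i = 1 := by
    rw [← Units.val_mul, mul_inv_cancel, Units.val_one]
  have hxe : x = i₀ * h := by rw [hx, Units.val_mul]
  have key : x = 1 + i₀ * (g - h₀) - x * (i * (g - h)) := by
    rw [hxe, mul_sub, mul_sub, mul_sub, e0, e1,
      show i₀ * (h : Matrix (Fin d) (Fin d) ℝ) * (i * g) = i₀ * (h * i) * g by
        simp only [mul_assoc], e2]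
    simp
  have h1 : ‖x‖ ≤ ‖(1 : Matrix (Fin d) (Fin d) ℝ)‖ + ‖i₀ * (g - h₀)‖ + ‖x * (i * (g - h))‖ := by
    conv_lhs => rw [key]
    exact (norm_sub_le _ _).trans (add_le_add_left (norm_add_le _ _) _)
  have h2 : ‖i₀ * (g - h₀)‖ ≤ 1 / 4 := by
    refine (norm_mul_le _ _).trans ?_
    rw [mul_comm]
    exact hg₀.le
  have hone := norm_one_matrix_le (d := d)
  have h3 : ‖x * (i * (g - h))‖ ≤ ‖x‖ * (1 / 4) := by
    refine (norm_mul_le _ _).trans ?_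
    gcongr
    refine (norm_mul_le _ _).trans ?_
    rw [mul_comm]
    exact hg.le
  linarith

/-- Haar measures of closed matrix groups have polynomial growth. -/
theorem exists_lintegral_groupSize_lt_top {H : Subgroup (GL (Fin d) ℝ)}
    (hH : IsClosed (H : Set (GL (Fin d) ℝ))) :
    ∃ m : ℕ, ∀ μ : Measure H, μ.IsHaarMeasure →
      ∫⁻ h : H, ENNReal.ofReal ((groupSize (h : GL (Fin d) ℝ) ^ m)⁻¹) ∂μ < ∞ := by
  let E := Matrix (Fin d) (Fin d) ℝ
  let n := Module.finrank ℝ E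
  -- The exponent is n for the volume of a ball of radius comparable to 1/N, plus n + 1 for the
  -- decay of the integrable weight `W`.
  refine ⟨2 * n + 1, fun μ hμ => ?_⟩
  let _ : MeasurableSpace E := borel E
  have : BorelSpace E := ⟨rfl⟩
  have : SecondCountableTopology E := secondCountable_of_proper
  have : LocallyCompactSpace H := locallyCompactSpace_of_isClosed hH
  let ν : Measure E := Measure.addHaar
  let W : E → ℝ≥0∞ := fun g => ENNReal.ofReal ((1 + ‖g‖) ^ (-((n : ℝ) + 1)))
  have hW : ∫⁻ g, W g ∂ν < ∞ :=
    finite_integral_one_add_norm (by simp [n, E])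
  have hWm : Measurable W := by
    refine ENNReal.measurable_ofReal.comp ?_
    exact ((measurable_const.add measurable_norm).pow_const _)
  -- Fubini on this incidence set: for fixed g the slice in H has bounded Haar measure, while for
  -- fixed h the slice contains a ball of radius 1/(4N).
  let S : Set (H × E) := {p | ‖p.2 - ((p.1 : GL (Fin d) ℝ) : E)‖ *
    ‖(((p.1 : GL (Fin d) ℝ)⁻¹ : GL (Fin d) ℝ) : E)‖ < 1 / 4}
  have hSo : IsOpen S := by
    have c1 : Continuous fun p : H × E => ((p.1 : GL (Fin d) ℝ) : E) :=
      Units.continuous_val.comp (continuous_subtype_val.comp continuous_fst)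
    have c2 : Continuous fun p : H × E => (((p.1 : GL (Fin d) ℝ)⁻¹ : GL (Fin d) ℝ) : E) :=
      Units.continuous_val.comp ((continuous_subtype_val.comp continuous_fst).inv)
    exact isOpen_lt ((continuous_snd.sub c1).norm.mul c2.norm) continuous_const
  have hSm : MeasurableSet S := hSo.measurableSet
  let F : H → E → ℝ≥0∞ := fun h g => S.indicator (fun p => W p.2) (h, g)
  have hFm : Measurable (Function.uncurry F) :=
    (hWm.comp measurable_snd).indicator hSm
  -- If h₀ and h lie in one slice, both h₀⁻¹h and its inverse have norm at most 2, so 5 = 1 + 2 + 2.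
  -- The slice then lies in h₀Q, whose measure is that of Q by left invariance.
  let Q : Set H := {h | groupSize (h : GL (Fin d) ℝ) ≤ 5}
  have hQ : IsCompact Q := isCompact_subgroup_groupSize_le hH 5
  have hslice : ∀ g : E, ∫⁻ h, F h g ∂μ ≤ W g * μ Q := by
    intro g
    by_cases hne : ∃ h₀ : H, (h₀, g) ∈ S
    · obtain ⟨h₀, hh₀⟩ := hne
      have hsub : {h : H | (h, g) ∈ S} ⊆ (fun x => h₀⁻¹ * x) ⁻¹' Q := by
        intro h hh
        have h1 := groupSize_mul_le_of_near hh₀ hh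
        have h2 := groupSize_mul_le_of_near hh hh₀
        change groupSize _ ≤ 5
        unfold groupSize
        rw [matNorm_eq_norm, matNorm_eq_norm]
        have e : (((h₀⁻¹ * h : H) : GL (Fin d) ℝ))⁻¹ =
          (h : GL (Fin d) ℝ)⁻¹ * (h₀ : GL (Fin d) ℝ) := by simp
        rw [e]
        have e' : ((h₀⁻¹ * h : H) : GL (Fin d) ℝ) =
          (h₀ : GL (Fin d) ℝ)⁻¹ * (h : GL (Fin d) ℝ) := by simp
        rw [e']
        linarith
      have hm : MeasurableSet {h : H | (h, g) ∈ S} := measurable_prodMk_right hSm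
      calc ∫⁻ h, F h g ∂μ = ∫⁻ h, {h : H | (h, g) ∈ S}.indicator (fun _ => W g) h ∂μ := rfl
        _ = W g * μ {h : H | (h, g) ∈ S} := by
          rw [lintegral_indicator_const hm]
        _ ≤ W g * μ ((fun x => h₀⁻¹ * x) ⁻¹' Q) := by gcongr
        _ = W g * μ Q := by rw [measure_preimage_mul]
    · have : ∀ h, F h g = 0 := fun h => Set.indicator_of_notMem (fun hh => hne ⟨h, hh⟩) _
      simp [this]
  have hfin : ∫⁻ h, ∫⁻ g, F h g ∂ν ∂μ < ∞ := by
    rw [lintegral_lintegral_swap hFm.aemeasurable]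
    calc ∫⁻ g, ∫⁻ h, F h g ∂μ ∂ν ≤ ∫⁻ g, W g * μ Q ∂ν := lintegral_mono hslice
      _ = (∫⁻ g, W g ∂ν) * μ Q := lintegral_mul_const _ hWm
      _ < ∞ := ENNReal.mul_lt_top hW hQ.measure_lt_top
  -- The constant of (2N)^(-(n+1)) (1/(4N))^n, a lower bound for the integral of `W` over the ball,
  -- up to the volume of the unit ball.
  let c : ℝ := ((2 : ℝ) ^ (n + 1) * 4 ^ n)⁻¹
  have hc : 0 < c := by positivity
  have hlow : ∀ h : H, ENNReal.ofReal c * ν (Metric.ball 0 1) *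
      ENNReal.ofReal ((groupSize (h : GL (Fin d) ℝ) ^ (2 * n + 1))⁻¹) ≤ ∫⁻ g, F h g ∂ν := by
    intro h
    set N := groupSize (h : GL (Fin d) ℝ) with hN
    have hN1 : 1 ≤ N := one_le_groupSize _
    have hN0 : 0 < N := groupSize_pos _
    have hn1 := norm_le_groupSize (h : GL (Fin d) ℝ)
    have hn2 := norm_inv_le_groupSize (h : GL (Fin d) ℝ)
    set r : ℝ := 1 / (4 * N) with hr
    have hr0 : 0 < r := by positivity
    have hr1 : r ≤ 1 := by
      rw [hr, div_le_one (by positivity)]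
      linarith
    have hpt : ∀ g ∈ Metric.ball ((h : GL (Fin d) ℝ) : E) r,
        ENNReal.ofReal (((2 * N) ^ (n + 1))⁻¹) ≤ F h g := by
      intro g hg
      rw [Metric.mem_ball, dist_eq_norm] at hg
      have hgS : (h, g) ∈ S := by
        change ‖g - ((h : GL (Fin d) ℝ) : E)‖ *
          ‖(((h : GL (Fin d) ℝ)⁻¹ : GL (Fin d) ℝ) : E)‖ < 1 / 4
        calc _ ≤ ‖g - ((h : GL (Fin d) ℝ) : E)‖ * N := by gcongr; linarith
          _ < r * N := by gcongr
          _ = 1 / 4 := by rw [hr]; field_simp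
      have : F h g = W g := Set.indicator_of_mem hgS _
      rw [this]
      apply ENNReal.ofReal_le_ofReal
      have hg2 : ‖g‖ ≤ ‖g - ((h : GL (Fin d) ℝ) : E)‖ + ‖((h : GL (Fin d) ℝ) : E)‖ := by
        simpa using norm_add_le (g - ((h : GL (Fin d) ℝ) : E)) ((h : GL (Fin d) ℝ) : E)
      rw [Real.rpow_neg (by positivity), show ((n : ℝ) + 1) = ((n + 1 : ℕ) : ℝ) by push_cast; rfl,
        Real.rpow_natCast]
      gcongr
      have h4 : ‖((h : GL (Fin d) ℝ) : Matrix (Fin d) (Fin d) ℝ)‖ = ‖((h : GL (Fin d) ℝ) : E)‖ :=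
        rfl
      linarith
    have hball : ν (Metric.ball ((h : GL (Fin d) ℝ) : E) r) =
        ENNReal.ofReal (r ^ n) * ν (Metric.ball 0 1) := Measure.addHaar_ball_of_pos ν _ hr0
    calc ENNReal.ofReal c * ν (Metric.ball 0 1) * ENNReal.ofReal ((N ^ (2 * n + 1))⁻¹)
        = ENNReal.ofReal (((2 * N) ^ (n + 1))⁻¹) *
          ν (Metric.ball ((h : GL (Fin d) ℝ) : E) r) := by
          rw [hball, mul_right_comm, ← ENNReal.ofReal_mul hc.le, ← mul_assoc,
            ← ENNReal.ofReal_mul (by positivity)]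
          congr 2
          simp only [c]
          rw [hr, one_div, inv_pow, ← mul_inv, ← mul_inv]
          congr 1
          ring
      _ = ∫⁻ g in Metric.ball ((h : GL (Fin d) ℝ) : E) r,
            ENNReal.ofReal (((2 * N) ^ (n + 1))⁻¹) ∂ν := by simp
      _ ≤ ∫⁻ g in Metric.ball ((h : GL (Fin d) ℝ) : E) r, F h g ∂ν :=
          setLIntegral_mono' measurableSet_ball hpt
      _ ≤ ∫⁻ g, F h g ∂ν := setLIntegral_le_lintegral _ _
  have hk0 : ENNReal.ofReal c * ν (Metric.ball 0 1) ≠ 0 :=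
    mul_ne_zero (by simpa using hc) (Metric.measure_ball_pos _ _ one_pos).ne'
  have hkt : ENNReal.ofReal c * ν (Metric.ball 0 1) ≠ ∞ :=
    ENNReal.mul_ne_top ENNReal.ofReal_ne_top measure_ball_lt_top.ne
  have h5 := (lintegral_mono (μ := μ) hlow).trans_lt hfin
  rw [lintegral_const_mul' _ _ hkt] at h5
  exact (ENNReal.mul_lt_top_iff.1 h5).elim (fun h => h.2) fun h => h.elim
    (fun h => absurd h hk0) fun h => h ▸ ENNReal.zero_lt_top

end HaarGrowth

/-! ### From size control to temperate embedding -/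

section Control

variable {d : ℕ}

/-- The size of `h` is controlled by a power of `auxA O (hᵀ ξ)⁻¹`, with an exponent that does not
depend on the base point. -/
def IsSizeControlled (H : Subgroup (GL (Fin d) ℝ)) (O : Set (Rd d)) : Prop :=
  ∃ k : ℕ, ∀ ξ ∈ O, ∃ C : ℝ, ∀ h ∈ H, auxA O (dualAct h ξ) ^ k * groupSize h ≤ C

theorem auxA_nonneg (O : Set (Rd d)) (ξ : Rd d) : 0 ≤ auxA O ξ := by
  unfold auxA
  have := Metric.infDist_nonneg (x := ξ) (s := Oᶜ)
  positivity

theorem auxA_le_infDist (O : Set (Rd d)) (ξ : Rd d) : auxA O ξ ≤ Metric.infDist ξ Oᶜ := by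
  refine (min_le_left _ _).trans (div_le_self Metric.infDist_nonneg ?_)
  have := Real.sqrt_nonneg (‖ξ‖ ^ 2 - Metric.infDist ξ Oᶜ ^ 2)
  linarith

theorem auxA_mul_le_one (O : Set (Rd d)) (ξ : Rd d) : auxA O ξ * (1 + ‖ξ‖) ≤ 1 := by
  have h0 : 0 < 1 + ‖ξ‖ := by positivity
  have : auxA O ξ ≤ 1 / (1 + ‖ξ‖) := min_le_right _ _
  rwa [le_div_iff₀ h0] at this

theorem auxA_le_one (O : Set (Rd d)) (ξ : Rd d) : auxA O ξ ≤ 1 := by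
  refine (min_le_right _ _).trans ?_
  rw [div_le_one (by positivity)]
  have := norm_nonneg ξ
  linarith

theorem continuous_auxA (O : Set (Rd d)) : Continuous (auxA O) := by
  have h1 : Continuous fun ξ : Rd d => Metric.infDist ξ Oᶜ := Metric.continuous_infDist_pt _
  refine Continuous.min (h1.div ?_ ?_) (continuous_const.div (by fun_prop) ?_)
  · exact continuous_const.add ((continuous_norm.pow 2).sub (h1.pow 2)).sqrt
  · intro ξ
    positivity
  · intro ξ
    positivity

theorem absDet_le_groupSize (h : GL (Fin d) ℝ) :
    absDet h ≤ d.factorial * groupSize h ^ d := by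
  have h1 := Matrix.det_le (A := (h : Matrix (Fin d) (Fin d) ℝ)) (abv := AbsoluteValue.abs)
    (x := groupSize h) fun i j => (abs_entry_le_norm _ i j).trans (by
      have := norm_le_groupSize h
      linarith)
  simpa [absDet, AbsoluteValue.abs] using h1

/-- For negative exponents, pass to h⁻¹, which has the same size. -/
theorem absDet_rpow_le (h : GL (Fin d) ℝ) (α : ℝ) :
    absDet h ^ α ≤ (d.factorial * groupSize h ^ d) ^ |α| := by
  rcases le_total 0 α with hα | hα
  · rw [abs_of_nonneg hα]
    exact Real.rpow_le_rpow (absDet_pos h).le (absDet_le_groupSize h) hα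
  · rw [abs_of_nonpos hα, ← groupSize_inv]
    have := Real.rpow_le_rpow (absDet_pos h⁻¹).le (absDet_le_groupSize h⁻¹) (neg_nonneg.2 hα)
    rwa [absDet_inv, Real.inv_rpow (absDet_pos h).le, ← Real.rpow_neg (absDet_pos h).le,
      neg_neg] at this

/-- Since N^(-m) ≤ 1, its q-th power is at most itself, so a single integrable power of N serves all
q ≥ 1. -/
theorem memLp_of_le_groupSize {H : Subgroup (GL (Fin d) ℝ)} {μ : Measure H} {m : ℕ}
    (hm : ∫⁻ h : H, ENNReal.ofReal ((groupSize (h : GL (Fin d) ℝ) ^ m)⁻¹) ∂μ < ∞)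
    {f : H → ℝ} (hf : Continuous f) {C : ℝ}
    (hC : ∀ h, |f h| ≤ C * (groupSize (h : GL (Fin d) ℝ) ^ m)⁻¹) {q : ℝ} (hq : 1 ≤ q) :
    MemLp f (ENNReal.ofReal q) μ := by
  let g : H → ℝ := fun h => (groupSize (h : GL (Fin d) ℝ) ^ m)⁻¹
  have hg0 : ∀ h, 0 ≤ g h := fun h => inv_nonneg.2 (pow_nonneg (groupSize_pos _).le _)
  have hg1 : ∀ h, g h ≤ 1 := fun h => inv_le_one_of_one_le₀ (one_le_pow₀ (one_le_groupSize _))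
  have hgc : Continuous g :=
    ((continuous_groupSize.comp continuous_subtype_val).pow m).inv₀
      fun h => (pow_pos (groupSize_pos _) _).ne'
  have hgm : MemLp g (ENNReal.ofReal q) μ := by
    refine ⟨hgc.aestronglyMeasurable, ?_⟩
    have hq0 : 0 < q := one_pos.trans_le hq
    rw [eLpNorm_lt_top_iff_lintegral_rpow_enorm_lt_top (by simpa using hq0)
      ENNReal.ofReal_ne_top, ENNReal.toReal_ofReal hq0.le]
    refine lt_of_le_of_lt (lintegral_mono fun h => ?_) hm
    change ‖g h‖ₑ ^ q ≤ ENNReal.ofReal (g h)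
    rw [Real.enorm_eq_ofReal (hg0 h), ENNReal.ofReal_rpow_of_nonneg (hg0 h) hq0.le]
    apply ENNReal.ofReal_le_ofReal
    have := Real.rpow_le_rpow_of_exponent_ge' (hg0 h) (hg1 h) zero_le_one hq
    simpa using this
  refine hgm.of_le_mul (c := C) hf.aestronglyMeasurable (Eventually.of_forall fun h => ?_)
  rw [Real.norm_eq_abs, Real.norm_of_nonneg (hg0 h)]
  exact hC h

/-- Raising A^k ≤ K/N to the power j gives N^(-j), which pays for the powers of N bounding the other
factors and leaves N^(-m). Here D, T and N stand for |det h|, 1 + ‖h‖ and the size of h. -/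
theorem abs_integrand_le {N D w A C₀ K α τ u : ℝ} {k j m : ℕ}
    (hN : 1 ≤ N) (hA : 0 ≤ A) (hAK : A ^ k * N ≤ K) (hD0 : 0 < D)
    (hD : D ^ α ≤ (d.factorial * N ^ d) ^ |α|) {T : ℝ} (hT0 : 0 < T) (hT : T ≤ N) (hτ : 0 ≤ τ)
    (hw0 : 0 < w) (hw : w ≤ C₀ * N ^ u) (hj : d * |α| + τ + |u| + m ≤ j) :
    |D ^ α * T ^ τ * w * A ^ (k * j)| ≤
      (d.factorial : ℝ) ^ |α| * |C₀| * K ^ j * (N ^ m)⁻¹ := by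
  have hN0 : 0 < N := one_pos.trans_le hN
  have hfac : (0 : ℝ) ≤ d.factorial := by positivity
  rw [abs_of_nonneg (by positivity)]
  have h1 : D ^ α ≤ (d.factorial : ℝ) ^ |α| * N ^ (d * |α|) := by
    refine hD.trans (le_of_eq ?_)
    rw [Real.mul_rpow hfac (by positivity), ← Real.rpow_natCast N d, ← Real.rpow_mul hN0.le]
  have h2 : T ^ τ ≤ N ^ τ := Real.rpow_le_rpow hT0.le hT hτ
  have h3 : w ≤ |C₀| * N ^ |u| := by
    refine hw.trans ?_
    refine mul_le_mul (le_abs_self _) ?_ (by positivity) (abs_nonneg _)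
    exact Real.rpow_le_rpow_of_exponent_le hN (le_abs_self _)
  have h4 : A ^ (k * j) ≤ K ^ j * N ^ (-(j : ℝ)) := by
    rw [pow_mul, Real.rpow_neg hN0.le, Real.rpow_natCast, ← inv_pow, ← mul_pow]
    refine pow_le_pow_left₀ (by positivity) ?_ j
    rwa [← div_eq_mul_inv, le_div_iff₀ hN0]
  have hK : 0 ≤ K := le_trans (by positivity) hAK
  calc D ^ α * T ^ τ * w * A ^ (k * j)
      ≤ ((d.factorial : ℝ) ^ |α| * N ^ (d * |α|)) * N ^ τ * (|C₀| * N ^ |u|) *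
        (K ^ j * N ^ (-(j : ℝ))) := by gcongr
    _ = (d.factorial : ℝ) ^ |α| * |C₀| * K ^ j *
        (N ^ (d * |α|) * N ^ τ * N ^ |u| * N ^ (-(j : ℝ))) := by ring
    _ = (d.factorial : ℝ) ^ |α| * |C₀| * K ^ j * N ^ (d * |α| + τ + |u| + -(j : ℝ)) := by
        rw [Real.rpow_add hN0, Real.rpow_add hN0, Real.rpow_add hN0]
    _ ≤ (d.factorial : ℝ) ^ |α| * |C₀| * K ^ j * N ^ (-(m : ℝ)) := by
        refine mul_le_mul_of_nonneg_left ?_ (by positivity)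
        exact Real.rpow_le_rpow_of_exponent_le hN (by linarith)
    _ = _ := by rw [Real.rpow_neg hN0.le, Real.rpow_natCast]

/-- For a closed group whose size is controlled along the orbit, the orbit is `w`-temperately
embedded for every weight `w` of polynomial growth. -/
theorem IsSizeControlled.isTemperatelyEmbedded {H : Subgroup (GL (Fin d) ℝ)}
    (hH : IsClosed (H : Set (GL (Fin d) ℝ))) {O : Set (Rd d)} (hO : IsSizeControlled H O)
    {w : H → ℝ} (hwc : Continuous w) (hw0 : ∀ h, 0 < w h) {C u : ℝ}
    (hw : ∀ h : H, w h ≤ C * groupSize (h : GL (Fin d) ℝ) ^ u) :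
    IsTemperatelyEmbedded H O w := by
  intro s q hs hq
  obtain ⟨m, hm⟩ := exists_lintegral_groupSize_lt_top hH
  obtain ⟨k, hk⟩ := hO
  set α₁ : ℝ := 1 / 2 - 1 / q
  set α₂ : ℝ := -(1 / 2) - 1 / q
  set τ : ℝ := s + d + 1
  have hτ : 0 ≤ τ := by positivity
  -- One j, chosen before the base point, serves both integrability conditions.
  obtain ⟨j, hj⟩ := exists_nat_ge (d * |α₁| + d * |α₂| + τ + |u| + m)
  have hj1 : d * |α₁| + τ + |u| + m ≤ j := by
    have : 0 ≤ d * |α₂| := by positivity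
    linarith
  have hj2 : d * |α₂| + τ + |u| + m ≤ j := by
    have : 0 ≤ d * |α₁| := by positivity
    linarith
  refine ⟨k * j, fun ξ hξ μ hμ => ?_⟩
  obtain ⟨K, hK⟩ := hk ξ hξ
  have hcoe : Continuous fun h : H => (h : GL (Fin d) ℝ) := continuous_subtype_val
  have hcd : ∀ α : ℝ, Continuous fun h : H => absDet (h : GL (Fin d) ℝ) ^ α := fun α =>
    (continuous_absDet.comp hcoe).rpow_const fun h => Or.inl (absDet_pos _).ne'
  have hpos : ∀ h : GL (Fin d) ℝ, 0 < 1 + matNorm (h : Matrix (Fin d) (Fin d) ℝ) := fun h => by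
    rw [matNorm_eq_norm]
    positivity
  have hcn : Continuous fun h : H =>
      (1 + matNorm ((h : GL (Fin d) ℝ) : Matrix (Fin d) (Fin d) ℝ)) ^ τ :=
    (continuous_const.add (Units.continuous_val.comp hcoe).norm).rpow_const
      fun h => Or.inl (hpos h).ne'
  have hca : Continuous fun h : H => auxA O (dualAct (h : GL (Fin d) ℝ) ξ) :=
    (continuous_auxA O).comp (continuous_dualAct.comp (hcoe.prodMk continuous_const))
  have hca' : Continuous fun h : H => auxA O (dualAct (h : GL (Fin d) ℝ)⁻¹ ξ) :=
    (continuous_auxA O).comp (continuous_dualAct.comp (hcoe.inv.prodMk continuous_const))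
  constructor
  · refine memLp_of_le_groupSize (hm μ hμ) ((((hcd _).mul hcn).mul hwc).mul (hca.pow _))
      (C := (d.factorial : ℝ) ^ |α₁| * |C| * K ^ j) (fun h => ?_) hq
    exact abs_integrand_le (one_le_groupSize _) (auxA_nonneg _ _) (hK h h.2) (absDet_pos _)
      (absDet_rpow_le _ _) (hpos h) (norm_le_groupSize _) hτ (hw0 h) (hw h) hj1
  · rw [← ENNReal.ofReal_one]
    refine memLp_of_le_groupSize (hm μ hμ) ((((hcd _).mul hcn).mul hwc).mul (hca'.pow _))
      (C := (d.factorial : ℝ) ^ |α₂| * |C| * K ^ j) (fun h => ?_) le_rfl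
    refine abs_integrand_le (one_le_groupSize _) (auxA_nonneg _ _) ?_ (absDet_pos _)
      (absDet_rpow_le _ _) (hpos h) (norm_le_groupSize _) hτ (hw0 h) (hw h) hj2
    -- The second condition evaluates A at h⁻ᵀξ, so the size control is applied to h⁻¹, whose size
    -- equals that of h.
    rw [← groupSize_inv]
    exact hK _ (H.inv_mem h.2)

end Control

/-! ### Dimension two: entries, determinants and uniqueness of open orbits -/

section PlaneBounds

theorem norm_le_sum_abs_entries (M : Matrix (Fin 2) (Fin 2) ℝ) :
    ‖M‖ ≤ |M 0 0| + |M 0 1| + |M 1 0| + |M 1 1| := by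
  refine ContinuousLinearMap.opNorm_le_bound _ (by positivity) fun x => ?_
  change ‖matAct M x‖ ≤ _
  have hx0 : |x 0| ≤ ‖x‖ := PiLp.norm_apply_le x 0
  have hx1 : |x 1| ≤ ‖x‖ := PiLp.norm_apply_le x 1
  have hdec : ∀ y : Rd 2, ‖y‖ ≤ |y 0| + |y 1| := by
    intro y
    rw [EuclideanSpace.norm_eq, Fin.sum_univ_two, Real.norm_eq_abs, Real.norm_eq_abs]
    refine Real.sqrt_le_iff.2 ⟨by positivity, ?_⟩
    nlinarith [mul_nonneg (abs_nonneg (y 0)) (abs_nonneg (y 1))]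
  refine (hdec _).trans ?_
  have e : ∀ i, matAct M x i = M i 0 * x 0 + M i 1 * x 1 := by
    intro i
    fin_cases i <;> simp [matAct]
  rw [e, e]
  have b : ∀ i, |M i 0 * x 0 + M i 1 * x 1| ≤ |M i 0| * ‖x‖ + |M i 1| * ‖x‖ := by
    intro i
    refine (abs_add_le _ _).trans ?_
    rw [abs_mul, abs_mul]
    gcongr
  have := b 0
  have := b 1
  linarith

/-- Cramer's rule: the adjugate has the same four entries up to sign and order. -/
theorem norm_inv_le_absDet (h : GL (Fin 2) ℝ) :
    ‖((h⁻¹ : GL (Fin 2) ℝ) : Matrix (Fin 2) (Fin 2) ℝ)‖ ≤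
      (absDet h)⁻¹ * (4 * ‖(h : Matrix (Fin 2) (Fin 2) ℝ)‖) := by
  rw [Matrix.coe_units_inv, Matrix.inv_def, norm_smul, Ring.inverse_eq_inv', norm_inv,
    Real.norm_eq_abs]
  change (absDet h)⁻¹ * _ ≤ _
  have := absDet_pos h
  gcongr
  refine (norm_le_sum_abs_entries _).trans ?_
  rw [Matrix.adjugate_fin_two]
  have h0 := abs_entry_le_norm (h : Matrix (Fin 2) (Fin 2) ℝ)
  simp only [Matrix.of_apply, Matrix.cons_val', Matrix.cons_val_zero, Matrix.cons_val_one,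
    Matrix.cons_val_fin_one, abs_neg]
  linarith [h0 0 0, h0 0 1, h0 1 0, h0 1 1]

/-- The inverse costs one factor ‖h‖ and one factor |det h|⁻¹, each absorbed by its own A^k; hence
the exponent 2k. -/
theorem IsSizeControlled.of_bounds {H : Subgroup (GL (Fin 2) ℝ)} {O : Set (Rd 2)} (k : ℕ)
    (hb : ∀ ξ ∈ O, ∃ C : ℝ, ∀ h ∈ H,
      auxA O (dualAct h ξ) ^ k * ‖(h : Matrix (Fin 2) (Fin 2) ℝ)‖ ≤ C ∧
      auxA O (dualAct h ξ) ^ k * (absDet h)⁻¹ ≤ C) : IsSizeControlled H O := by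
  refine ⟨k + k, fun ξ hξ => ?_⟩
  obtain ⟨C, hC⟩ := hb ξ hξ
  refine ⟨1 + C + 4 * (C * C), fun h hh => ?_⟩
  obtain ⟨h1, h2⟩ := hC h hh
  set A := auxA O (dualAct h ξ) with hA
  have hA0 : 0 ≤ A := auxA_nonneg _ _
  have hA1 : A ≤ 1 := auxA_le_one _ _
  have hp0 : 0 ≤ A ^ k := by positivity
  have hp1 : A ^ k ≤ 1 := pow_le_one₀ hA0 hA1
  have hinv := norm_inv_le_absDet h
  have hd : 0 ≤ (absDet h)⁻¹ := inv_nonneg.2 (absDet_pos h).le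
  unfold groupSize
  rw [matNorm_eq_norm, matNorm_eq_norm, pow_add]
  set n := ‖(h : Matrix (Fin 2) (Fin 2) ℝ)‖
  have hn : 0 ≤ n := norm_nonneg _
  have hC0 : 0 ≤ C := le_trans (by positivity) h1
  have b1 : A ^ k * A ^ k * 1 ≤ 1 := by nlinarith
  have b2 : A ^ k * A ^ k * n ≤ C := by
    rw [mul_assoc]
    nlinarith [mul_nonneg hp0 hn]
  have b3 : A ^ k * A ^ k * ‖((h⁻¹ : GL (Fin 2) ℝ) : Matrix (Fin 2) (Fin 2) ℝ)‖
      ≤ 4 * (C * C) := by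
    calc _ ≤ A ^ k * A ^ k * ((absDet h)⁻¹ * (4 * n)) := by gcongr
      _ = 4 * ((A ^ k * (absDet h)⁻¹) * (A ^ k * n)) := by ring
      _ ≤ 4 * (C * C) := by gcongr
  linarith

/-- An open orbit is nonempty, so it meets the dense one, and orbits with a common point coincide.
-/
theorem IsOpenDualOrbit.eq_of_dense {d : ℕ} {H : Subgroup (GL (Fin d) ℝ)} {O₀ O : Set (Rd d)}
    (h₀ : IsOpenDualOrbit H O₀) (hd : Dense O₀) (h : IsOpenDualOrbit H O) : O = O₀ := by
  obtain ⟨-, ξ₀, rfl⟩ := h₀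
  obtain ⟨ho, ξ, rfl⟩ := h
  obtain ⟨η, ⟨g, hg, e1⟩, ⟨g₀, hg₀, e2⟩⟩ := hd.inter_open_nonempty _ ho
    ⟨ξ, 1, H.one_mem, (dualAct_one ξ).symm⟩
  have e3 : ξ = dualAct (g₀ * g⁻¹) ξ₀ := by
    rw [dualAct_mul, ← e2, e1, dualAct_inv_dualAct]
  have e4 : ξ₀ = dualAct (g * g₀⁻¹) ξ := by
    rw [dualAct_mul, ← e1, e2, dualAct_inv_dualAct]
  ext ζ
  constructor
  · rintro ⟨x, hx, rfl⟩
    exact ⟨g₀ * g⁻¹ * x, H.mul_mem (H.mul_mem hg₀ (H.inv_mem hg)) hx, by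
      rw [dualAct_mul, ← e3]⟩
  · rintro ⟨x, hx, rfl⟩
    exact ⟨g * g₀⁻¹ * x, H.mul_mem (H.mul_mem hg (H.inv_mem hg₀)) hx, by
      rw [dualAct_mul, ← e4]⟩

theorem IsOpenDualOrbit.iff_of_dense {d : ℕ} {H : Subgroup (GL (Fin d) ℝ)} {O₀ : Set (Rd d)}
    (h₀ : IsOpenDualOrbit H O₀) (hd : Dense O₀) (O : Set (Rd d)) :
    IsOpenDualOrbit H O ↔ O = O₀ :=
  ⟨h₀.eq_of_dense hd, fun h => h ▸ h₀⟩

theorem dualAct_apply_fin_two (h : GL (Fin 2) ℝ) (ξ : Rd 2) (i : Fin 2) :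
    dualAct h ξ i = (h : Matrix (Fin 2) (Fin 2) ℝ) 0 i * ξ 0 +
      (h : Matrix (Fin 2) (Fin 2) ℝ) 1 i * ξ 1 := by
  fin_cases i <;> simp [dualAct, matAct]

theorem exists_GL_of_det_ne_zero {M : Matrix (Fin 2) (Fin 2) ℝ} (hM : M.det ≠ 0) :
    ∃ h : GL (Fin 2) ℝ, (h : Matrix (Fin 2) (Fin 2) ℝ) = M :=
  ⟨Matrix.GeneralLinearGroup.mkOfDetNeZero M hM, rfl⟩

theorem dense_coord_ne_zero (i : Fin 2) : Dense {ξ : Rd 2 | ξ i ≠ 0} := by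
  have h1 : IsOpenMap (EuclideanSpace.proj i : Rd 2 →L[ℝ] ℝ) :=
    (EuclideanSpace.proj i : Rd 2 →L[ℝ] ℝ).isOpenMap fun y => ⟨EuclideanSpace.single i y, by simp⟩
  exact (dense_compl_singleton (0 : ℝ)).preimage h1

theorem isOpen_coord_ne_zero (i : Fin 2) : IsOpen {ξ : Rd 2 | ξ i ≠ 0} :=
  isOpen_ne_fun (EuclideanSpace.proj i : Rd 2 →L[ℝ] ℝ).continuous continuous_const

/-- Setting the i-th coordinate to zero leads out of O, over a distance |ξ i|. -/
theorem auxA_le_abs_coord {O : Set (Rd 2)} (i : Fin 2) (hO : O ⊆ {ξ | ξ i ≠ 0}) (ξ : Rd 2) :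
    auxA O ξ ≤ |ξ i| := by
  have hmem : ξ - EuclideanSpace.single i (ξ i) ∈ Oᶜ := fun h => hO h (by simp)
  refine (auxA_le_infDist O ξ).trans ((Metric.infDist_le_dist_of_mem hmem).trans ?_)
  rw [dist_eq_norm, sub_sub_cancel]
  simp

theorem abs_coord_mul_auxA_le (O : Set (Rd 2)) (ξ : Rd 2) (i : Fin 2) :
    auxA O ξ * |ξ i| ≤ 1 := by
  have h1 : |ξ i| ≤ ‖ξ‖ := PiLp.norm_apply_le ξ i
  have h2 := auxA_mul_le_one O ξ
  have h3 := auxA_nonneg O ξ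
  nlinarith

theorem rpow_le_rpow_abs {x M : ℝ} (hM : 0 < M) (h1 : M⁻¹ ≤ x) (h2 : x ≤ M) (t : ℝ) :
    x ^ t ≤ M ^ |t| := by
  have hx : 0 < x := (inv_pos.2 hM).trans_le h1
  rcases le_total 0 t with ht | ht
  · rw [abs_of_nonneg ht]
    exact Real.rpow_le_rpow hx.le h2 ht
  · rw [abs_of_nonpos ht, ← neg_neg t, Real.rpow_neg_eq_inv_rpow, neg_neg]
    exact Real.rpow_le_rpow (inv_nonneg.2 hx.le) (inv_le_of_inv_le₀ hM h1) (neg_nonneg.2 ht)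

end PlaneBounds

/-! ### The similitude group -/

section SimilitudeGroup

theorem mem_similitudeGroup {h : GL (Fin 2) ℝ} : h ∈ similitudeGroup ↔
    (h : Matrix (Fin 2) (Fin 2) ℝ) 1 1 = (h : Matrix (Fin 2) (Fin 2) ℝ) 0 0 ∧
    (h : Matrix (Fin 2) (Fin 2) ℝ) 1 0 = -(h : Matrix (Fin 2) (Fin 2) ℝ) 0 1 := by
  constructor
  · rintro ⟨a, b, -, hh⟩
    simp [hh]
  · rintro ⟨h1, h2⟩
    have hd := absDet_pos h
    rw [absDet, Matrix.det_fin_two, h1, h2, abs_pos] at hd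
    refine ⟨(h : Matrix (Fin 2) (Fin 2) ℝ) 0 0, (h : Matrix (Fin 2) (Fin 2) ℝ) 0 1, ?_, ?_⟩
    · refine lt_of_le_of_ne (by positivity) fun h0 => hd ?_
      rw [show (0 : ℝ) = _ from h0]
      ring
    · rw [Matrix.eta_fin_two (h : Matrix (Fin 2) (Fin 2) ℝ), h1, h2]
      simp

theorem continuous_GL_entry (i j : Fin 2) :
    Continuous fun h : GL (Fin 2) ℝ => (h : Matrix (Fin 2) (Fin 2) ℝ) i j :=
  Units.continuous_val.matrix_elem i j

theorem isClosed_similitudeGroup : IsClosed (similitudeGroup : Set (GL (Fin 2) ℝ)) := by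
  have : (similitudeGroup : Set (GL (Fin 2) ℝ)) =
      {h : GL (Fin 2) ℝ | (h : Matrix (Fin 2) (Fin 2) ℝ) 1 1 = (h : Matrix (Fin 2) (Fin 2) ℝ) 0 0} ∩
      {h : GL (Fin 2) ℝ | (h : Matrix (Fin 2) (Fin 2) ℝ) 1 0 = -(h : Matrix (Fin 2) (Fin 2) ℝ) 0 1} := by
    ext h
    exact mem_similitudeGroup
  rw [this]
  exact (isClosed_eq (continuous_GL_entry 1 1) (continuous_GL_entry 0 0)).inter
    (isClosed_eq (continuous_GL_entry 1 0) (continuous_GL_entry 0 1).neg)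

theorem absDet_similitudeGroup {h : GL (Fin 2) ℝ} (hh : h ∈ similitudeGroup) :
    absDet h = (h : Matrix (Fin 2) (Fin 2) ℝ) 0 0 ^ 2 +
      (h : Matrix (Fin 2) (Fin 2) ℝ) 0 1 ^ 2 := by
  obtain ⟨h1, h2⟩ := mem_similitudeGroup.1 hh
  rw [absDet, Matrix.det_fin_two, h1, h2]
  set a := (h : Matrix (Fin 2) (Fin 2) ℝ) 0 0
  set b := (h : Matrix (Fin 2) (Fin 2) ℝ) 0 1
  rw [show a * a - b * -b = a ^ 2 + b ^ 2 by ring, abs_of_nonneg (by positivity)]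

theorem sq_norm_fin_two (ξ : Rd 2) : ‖ξ‖ ^ 2 = ξ 0 ^ 2 + ξ 1 ^ 2 := by
  simp [EuclideanSpace.norm_sq_eq, Fin.sum_univ_two]

theorem sq_norm_dualAct_similitudeGroup {h : GL (Fin 2) ℝ} (hh : h ∈ similitudeGroup)
    (ξ : Rd 2) : ‖dualAct h ξ‖ ^ 2 = absDet h * ‖ξ‖ ^ 2 := by
  obtain ⟨h1, h2⟩ := mem_similitudeGroup.1 hh
  rw [absDet_similitudeGroup hh, sq_norm_fin_two, sq_norm_fin_two, dualAct_apply_fin_two,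
    dualAct_apply_fin_two, h1, h2]
  ring

/-- The base point e₁ is sent by hᵀ to the first row of h, so it is enough to prescribe that row.
The same base point serves the shearlet-type groups. -/
theorem isOpenDualOrbit_similitudeGroup :
    IsOpenDualOrbit similitudeGroup {ξ : Rd 2 | ξ ≠ 0} := by
  refine ⟨isOpen_ne, EuclideanSpace.single 0 1, ?_⟩
  ext ξ
  constructor
  · intro hξ
    have hpos : 0 < ξ 0 ^ 2 + ξ 1 ^ 2 := by
      rw [← sq_norm_fin_two]
      have : 0 < ‖ξ‖ := norm_pos_iff.2 hξ
      positivity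
    obtain ⟨h, hh⟩ := exists_GL_of_det_ne_zero (M := !![ξ 0, ξ 1; -ξ 1, ξ 0]) (by
      rw [Matrix.det_fin_two_of]
      nlinarith)
    refine ⟨h, ⟨ξ 0, ξ 1, hpos, hh⟩, ?_⟩
    ext i
    rw [dualAct_apply_fin_two, hh]
    fin_cases i <;> simp
  · rintro ⟨h, hh, rfl⟩ h0
    have := congrArg (dualAct h⁻¹) h0
    rw [dualAct_inv_dualAct] at this
    have := congrArg (fun η : Rd 2 => η 0) this
    simp [dualAct] at this

/-- The action is conformal: ‖hᵀξ‖² = |det h| ‖ξ‖². As 0 is outside the orbit, A ≤ ‖hᵀξ‖, while also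
A‖hᵀξ‖ ≤ 1. -/
theorem isSizeControlled_similitudeGroup :
    IsSizeControlled similitudeGroup {ξ : Rd 2 | ξ ≠ 0} := by
  refine .of_bounds 2 fun ξ hξ => ?_
  have hn : 0 < ‖ξ‖ := norm_pos_iff.2 hξ
  -- The 4 counts the entries, each of modulus at most ‖hᵀξ‖/‖ξ‖; the square comes from A² ≤ |det h|
  -- ‖ξ‖².
  refine ⟨max (4 / ‖ξ‖) (‖ξ‖ ^ 2), fun h hh => ?_⟩
  set A := auxA {ξ : Rd 2 | ξ ≠ 0} (dualAct h ξ)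
  have hA0 : 0 ≤ A := auxA_nonneg _ _
  have hA1 : A ≤ 1 := auxA_le_one _ _
  have hsq := sq_norm_dualAct_similitudeGroup hh ξ
  have hA2 := auxA_mul_le_one {ξ : Rd 2 | ξ ≠ 0} (dualAct h ξ)
  have hA3 : A ≤ ‖dualAct h ξ‖ := by
    refine (auxA_le_infDist _ _).trans ((Metric.infDist_le_dist_of_mem (y := 0) ?_).trans ?_)
    · simp
    · simp
  have hD := absDet_pos h
  constructor
  · refine le_trans ?_ (le_max_left _ _)
    have hle : ‖(h : Matrix (Fin 2) (Fin 2) ℝ)‖ * ‖ξ‖ ≤ 4 * ‖dualAct h ξ‖ := by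
      obtain ⟨h1, h2⟩ := mem_similitudeGroup.1 hh
      have b := norm_le_sum_abs_entries (h : Matrix (Fin 2) (Fin 2) ℝ)
      rw [h1, h2, abs_neg] at b
      have hd := absDet_similitudeGroup hh
      set a := (h : Matrix (Fin 2) (Fin 2) ℝ) 0 0
      set c := (h : Matrix (Fin 2) (Fin 2) ℝ) 0 1
      have ha : |a| * ‖ξ‖ ≤ ‖dualAct h ξ‖ := by
        refine abs_le_of_sq_le_sq' ?_ (norm_nonneg _) |>.2
        rw [hsq, hd, mul_pow, sq_abs]
        nlinarith [mul_nonneg (sq_nonneg c) (sq_nonneg ‖ξ‖)]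
      have hc : |c| * ‖ξ‖ ≤ ‖dualAct h ξ‖ := by
        refine abs_le_of_sq_le_sq' ?_ (norm_nonneg _) |>.2
        rw [hsq, hd, mul_pow, sq_abs]
        nlinarith [mul_nonneg (sq_nonneg a) (sq_nonneg ‖ξ‖)]
      nlinarith
    rw [le_div_iff₀ hn, mul_assoc]
    have h3 : A ^ 2 ≤ A := by nlinarith
    have h4 : A * ‖dualAct h ξ‖ ≤ 1 := by
      change A * (1 + ‖dualAct h ξ‖) ≤ 1 at hA2
      nlinarith
    calc _ ≤ A * (4 * ‖dualAct h ξ‖) := by gcongr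
      _ ≤ 4 := by linarith
  · refine le_trans ?_ (le_max_right _ _)
    rw [← div_eq_mul_inv, div_le_iff₀ hD, mul_comm (‖ξ‖ ^ 2), ← hsq]
    gcongr

end SimilitudeGroup

/-! ### The diagonal group -/

section DiagonalGroup

theorem mem_diagonalGroup {h : GL (Fin 2) ℝ} : h ∈ diagonalGroup ↔
    (h : Matrix (Fin 2) (Fin 2) ℝ) 0 1 = 0 ∧ (h : Matrix (Fin 2) (Fin 2) ℝ) 1 0 = 0 := by
  constructor
  · rintro ⟨a, b, -, hh⟩
    simp [hh]
  · rintro ⟨h1, h2⟩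
    have hd := absDet_pos h
    rw [absDet, Matrix.det_fin_two, h1, h2, abs_pos, zero_mul, sub_zero] at hd
    refine ⟨(h : Matrix (Fin 2) (Fin 2) ℝ) 0 0, (h : Matrix (Fin 2) (Fin 2) ℝ) 1 1, hd, ?_⟩
    rw [Matrix.eta_fin_two (h : Matrix (Fin 2) (Fin 2) ℝ), h1, h2]
    simp

theorem isClosed_diagonalGroup : IsClosed (diagonalGroup : Set (GL (Fin 2) ℝ)) := by
  have : (diagonalGroup : Set (GL (Fin 2) ℝ)) =
      {h : GL (Fin 2) ℝ | (h : Matrix (Fin 2) (Fin 2) ℝ) 0 1 = 0} ∩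
      {h : GL (Fin 2) ℝ | (h : Matrix (Fin 2) (Fin 2) ℝ) 1 0 = 0} := by
    ext h
    exact mem_diagonalGroup
  rw [this]
  exact (isClosed_eq (continuous_GL_entry 0 1) continuous_const).inter
    (isClosed_eq (continuous_GL_entry 1 0) continuous_const)

theorem absDet_diagonalGroup {h : GL (Fin 2) ℝ} (hh : h ∈ diagonalGroup) :
    absDet h = |(h : Matrix (Fin 2) (Fin 2) ℝ) 0 0| * |(h : Matrix (Fin 2) (Fin 2) ℝ) 1 1| := by
  obtain ⟨h1, h2⟩ := mem_diagonalGroup.1 hh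
  rw [absDet, Matrix.det_fin_two, h1, h2, zero_mul, sub_zero, abs_mul]

theorem dualAct_diagonalGroup {h : GL (Fin 2) ℝ} (hh : h ∈ diagonalGroup) (ξ : Rd 2) :
    dualAct h ξ 0 = (h : Matrix (Fin 2) (Fin 2) ℝ) 0 0 * ξ 0 ∧
    dualAct h ξ 1 = (h : Matrix (Fin 2) (Fin 2) ℝ) 1 1 * ξ 1 := by
  obtain ⟨h1, h2⟩ := mem_diagonalGroup.1 hh
  rw [dualAct_apply_fin_two, dualAct_apply_fin_two, h1, h2]
  simp

theorem isOpenDualOrbit_diagonalGroup :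
    IsOpenDualOrbit diagonalGroup {ξ : Rd 2 | ξ 0 ≠ 0 ∧ ξ 1 ≠ 0} := by
  refine ⟨(isOpen_coord_ne_zero 0).inter (isOpen_coord_ne_zero 1), !₂[1, 1], ?_⟩
  ext ξ
  constructor
  · rintro ⟨h0, h1⟩
    obtain ⟨h, hh⟩ := exists_GL_of_det_ne_zero (M := !![ξ 0, 0; 0, ξ 1]) (by simp [h0, h1])
    refine ⟨h, ⟨ξ 0, ξ 1, mul_ne_zero h0 h1, hh⟩, ?_⟩
    ext i
    rw [dualAct_apply_fin_two, hh]
    fin_cases i <;> simp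
  · rintro ⟨h, hh, rfl⟩
    have hd := absDet_pos h
    rw [absDet_diagonalGroup hh] at hd
    obtain ⟨h1, h2⟩ := dualAct_diagonalGroup hh !₂[1, 1]
    change dualAct h !₂[1, 1] 0 ≠ 0 ∧ dualAct h !₂[1, 1] 1 ≠ 0
    rw [h1, h2]
    have := left_ne_zero_of_mul hd.ne'
    have := right_ne_zero_of_mul hd.ne'
    simp_all

theorem dense_two_coord_ne_zero : Dense {ξ : Rd 2 | ξ 0 ≠ 0 ∧ ξ 1 ≠ 0} :=
  (dense_coord_ne_zero 0).inter_of_isOpen_left (dense_coord_ne_zero 1) (isOpen_coord_ne_zero 0)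

/-- Both coordinates of hᵀξ lie between A and 1/A in modulus; up to constants they are the diagonal
entries, and their product is the determinant. -/
theorem isSizeControlled_diagonalGroup :
    IsSizeControlled diagonalGroup {ξ : Rd 2 | ξ 0 ≠ 0 ∧ ξ 1 ≠ 0} := by
  refine .of_bounds 2 fun ξ hξ => ?_
  have hx : 0 < |ξ 0| := abs_pos.2 hξ.1
  have hy : 0 < |ξ 1| := abs_pos.2 hξ.2
  refine ⟨max (1 / |ξ 0| + 1 / |ξ 1|) (|ξ 0| * |ξ 1|), fun h hh => ?_⟩
  set O : Set (Rd 2) := {ξ : Rd 2 | ξ 0 ≠ 0 ∧ ξ 1 ≠ 0}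
  set A := auxA O (dualAct h ξ)
  have hA0 : 0 ≤ A := auxA_nonneg _ _
  have hA1 : A ≤ 1 := auxA_le_one _ _
  obtain ⟨e0, e1⟩ := dualAct_diagonalGroup hh ξ
  have hl0 : A ≤ |dualAct h ξ 0| := auxA_le_abs_coord 0 (fun ξ h => h.1) _
  have hl1 : A ≤ |dualAct h ξ 1| := auxA_le_abs_coord 1 (fun ξ h => h.2) _
  have hu0 : A * |dualAct h ξ 0| ≤ 1 := abs_coord_mul_auxA_le _ _ _
  have hu1 : A * |dualAct h ξ 1| ≤ 1 := abs_coord_mul_auxA_le _ _ _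
  rw [e0, abs_mul] at hl0 hu0
  rw [e1, abs_mul] at hl1 hu1
  have hD := absDet_pos h
  constructor
  · refine le_trans ?_ (le_max_left _ _)
    have b := norm_le_sum_abs_entries (h : Matrix (Fin 2) (Fin 2) ℝ)
    obtain ⟨h1, h2⟩ := mem_diagonalGroup.1 hh
    rw [h1, h2, abs_zero, add_zero, add_zero] at b
    have h3 : A ^ 2 ≤ A := by nlinarith
    calc _ ≤ A * (|(h : Matrix (Fin 2) (Fin 2) ℝ) 0 0| +
          |(h : Matrix (Fin 2) (Fin 2) ℝ) 1 1|) := by gcongr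
      _ ≤ _ := by
        rw [mul_add]
        refine add_le_add ?_ ?_
        · rw [le_div_iff₀ hx, mul_assoc]
          exact hu0
        · rw [le_div_iff₀ hy, mul_assoc]
          exact hu1
  · refine le_trans ?_ (le_max_right _ _)
    rw [← div_eq_mul_inv, div_le_iff₀ hD, absDet_diagonalGroup hh, sq]
    calc A * A ≤ _ := mul_le_mul hl0 hl1 hA0 (by positivity)
      _ = _ := by ring

end DiagonalGroup

/-! ### The shearlet-type groups -/

section ShearletGroup

/-- This form avoids the sign function and is visibly continuous away from 0. -/
theorem signedPow_eq {a : ℝ} (ha : a ≠ 0) (c : ℝ) : signedPow a c = a * |a| ^ (c - 1) := by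
  rw [signedPow, Real.rpow_sub_one (abs_ne_zero.2 ha)]
  rcases lt_or_gt_of_ne ha with h | h
  · rw [Real.sign_of_neg h, abs_of_neg h]
    field_simp
  · rw [Real.sign_of_pos h, abs_of_pos h]
    field_simp

theorem abs_signedPow {a : ℝ} (ha : a ≠ 0) (c : ℝ) : |signedPow a c| = |a| ^ c := by
  have := abs_pos.2 ha
  rw [signedPow_eq ha, abs_mul, abs_of_nonneg (by positivity : (0 : ℝ) ≤ |a| ^ (c - 1)),
    Real.rpow_sub_one this.ne']
  field_simp

theorem signedPow_ne_zero {a : ℝ} (ha : a ≠ 0) (c : ℝ) : signedPow a c ≠ 0 := by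
  rw [← abs_pos, abs_signedPow ha]
  have := abs_pos.2 ha
  positivity

theorem corner_ne_zero {h : GL (Fin 2) ℝ} (h0 : (h : Matrix (Fin 2) (Fin 2) ℝ) 1 0 = 0) :
    (h : Matrix (Fin 2) (Fin 2) ℝ) 0 0 ≠ 0 := by
  intro h1
  have hd := absDet_pos h
  rw [absDet, Matrix.det_fin_two, h0, h1] at hd
  simp at hd

theorem mem_shearletGroup {c : ℝ} {h : GL (Fin 2) ℝ} : h ∈ shearletGroup c ↔
    (h : Matrix (Fin 2) (Fin 2) ℝ) 1 0 = 0 ∧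
    (h : Matrix (Fin 2) (Fin 2) ℝ) 1 1 =
      signedPow ((h : Matrix (Fin 2) (Fin 2) ℝ) 0 0) c := by
  constructor
  · rintro ⟨a, b, -, hh⟩
    simp [hh]
  · rintro ⟨h1, h2⟩
    refine ⟨(h : Matrix (Fin 2) (Fin 2) ℝ) 0 0, (h : Matrix (Fin 2) (Fin 2) ℝ) 0 1,
      corner_ne_zero h1, ?_⟩
    conv_lhs => rw [Matrix.eta_fin_two (h : Matrix (Fin 2) (Fin 2) ℝ), h1, h2]

theorem isClosed_shearletGroup (c : ℝ) : IsClosed (shearletGroup c : Set (GL (Fin 2) ℝ)) := by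
  let s : Set (GL (Fin 2) ℝ) := {h | (h : Matrix (Fin 2) (Fin 2) ℝ) 1 0 = 0}
  have hs : IsClosed s := isClosed_eq (continuous_GL_entry 1 0) continuous_const
  -- On the closed set `s` invertibility forces a nonzero corner, so `f` is continuous there
  -- although it need not be continuous elsewhere.
  let f : GL (Fin 2) ℝ → ℝ := fun h => (h : Matrix (Fin 2) (Fin 2) ℝ) 1 1 -
    (h : Matrix (Fin 2) (Fin 2) ℝ) 0 0 * |(h : Matrix (Fin 2) (Fin 2) ℝ) 0 0| ^ (c - 1)
  have hf : ContinuousOn f s := by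
    intro h hh
    refine ContinuousAt.continuousWithinAt ?_
    refine (continuous_GL_entry 1 1).continuousAt.sub
      ((continuous_GL_entry 0 0).continuousAt.mul
        ((continuous_GL_entry 0 0).abs.continuousAt.rpow_const (Or.inl ?_)))
    exact abs_ne_zero.2 (corner_ne_zero hh)
  have : (shearletGroup c : Set (GL (Fin 2) ℝ)) = s ∩ f ⁻¹' {0} := by
    ext h
    rw [SetLike.mem_coe, mem_shearletGroup]
    refine and_congr_right fun h1 => ?_
    rw [signedPow_eq (corner_ne_zero h1)]
    exact sub_eq_zero.symm
  rw [this]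
  exact hf.preimage_isClosed_of_isClosed hs isClosed_singleton

theorem isOpenDualOrbit_shearletGroup (c : ℝ) :
    IsOpenDualOrbit (shearletGroup c) {ξ : Rd 2 | ξ 0 ≠ 0} := by
  refine ⟨isOpen_coord_ne_zero 0, EuclideanSpace.single 0 1, ?_⟩
  ext ξ
  constructor
  · intro h0
    obtain ⟨h, hh⟩ := exists_GL_of_det_ne_zero (M := !![ξ 0, ξ 1; 0, signedPow (ξ 0) c]) (by
      rw [Matrix.det_fin_two_of, mul_zero, sub_zero]
      exact mul_ne_zero h0 (signedPow_ne_zero h0 c))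
    refine ⟨h, ⟨ξ 0, ξ 1, h0, hh⟩, ?_⟩
    ext i
    rw [dualAct_apply_fin_two, hh]
    fin_cases i <;> simp
  · rintro ⟨h, hh, rfl⟩
    have := corner_ne_zero (mem_shearletGroup.1 hh).1
    change dualAct h _ 0 ≠ 0
    rw [dualAct_apply_fin_two]
    simpa using this

/-- As A ≤ 1, replace A^k by A^|e|; the product is then the |e|-th power of A z or of A z⁻¹,
according to the sign of e. -/
theorem pow_mul_rpow_le {A z C e : ℝ} {k : ℕ} (hA0 : 0 ≤ A) (hA1 : A ≤ 1) (hz : 0 < z)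
    (h1 : A * z ≤ C) (h2 : A * z⁻¹ ≤ C) (hk : |e| ≤ k) : A ^ k * z ^ e ≤ C ^ |e| := by
  have hAk : A ^ k ≤ A ^ |e| := by
    rw [← Real.rpow_natCast]
    exact Real.rpow_le_rpow_of_exponent_ge' hA0 hA1 (abs_nonneg _) hk
  refine (mul_le_mul_of_nonneg_right hAk (by positivity)).trans ?_
  rcases le_total 0 e with he | he
  · rw [abs_of_nonneg he, ← Real.mul_rpow hA0 hz.le]
    exact Real.rpow_le_rpow (by positivity) h1 he
  · rw [abs_of_nonpos he]
    have hze : z ^ e = z⁻¹ ^ (-e) := by rw [Real.inv_rpow hz.le, Real.rpow_neg hz.le, inv_inv]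
    rw [hze, ← Real.mul_rpow hA0 (inv_nonneg.2 hz.le)]
    exact Real.rpow_le_rpow (by positivity) h2 (neg_nonneg.2 he)

/-- The first coordinate a ξ₁ of hᵀξ bounds |a| and 1/|a| by multiples of 1/A, hence also |a|^c and
the inverse determinant |a|^(-(1+c)), which is why k ≥ |c| + 1. The second coordinate b ξ₁ + a^c ξ₂
then bounds b. -/
theorem isSizeControlled_shearletGroup (c : ℝ) :
    IsSizeControlled (shearletGroup c) {ξ : Rd 2 | ξ 0 ≠ 0} := by
  obtain ⟨k, hk⟩ := exists_nat_ge (|c| + 1)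
  refine .of_bounds k fun ξ hξ => ?_
  have hx : 0 < |ξ 0| := abs_pos.2 hξ
  set x := |ξ 0|
  set y := |ξ 1|
  set C₀ : ℝ := max x⁻¹ x
  refine ⟨max (C₀ ^ |(1 : ℝ)| + (1 + C₀ ^ |c| * y) / x + C₀ ^ |c|) (C₀ ^ |-(1 + c)|),
    fun h hh => ?_⟩
  set A := auxA {ξ : Rd 2 | ξ 0 ≠ 0} (dualAct h ξ)
  have hA0 : 0 ≤ A := auxA_nonneg _ _
  have hA1 : A ≤ 1 := auxA_le_one _ _
  obtain ⟨h1, h2⟩ := mem_shearletGroup.1 hh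
  have ha := corner_ne_zero h1
  have hl : A ≤ |dualAct h ξ 0| := auxA_le_abs_coord 0 (fun ξ h => h) _
  have hu : A * |dualAct h ξ 0| ≤ 1 := abs_coord_mul_auxA_le _ _ _
  have hv : A * |dualAct h ξ 1| ≤ 1 := abs_coord_mul_auxA_le _ _ _
  have hnorm := norm_le_sum_abs_entries (h : Matrix (Fin 2) (Fin 2) ℝ)
  have hdet : absDet h = |(h : Matrix (Fin 2) (Fin 2) ℝ) 0 0| ^ (1 + c) := by
    rw [absDet, Matrix.det_fin_two, h1, mul_zero, sub_zero, abs_mul, h2, abs_signedPow ha,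
      Real.rpow_add (abs_pos.2 ha), Real.rpow_one]
  rw [dualAct_apply_fin_two] at hl hu hv
  rw [h1, h2, abs_signedPow ha, abs_zero, add_zero] at hnorm
  rw [h1, zero_mul, add_zero, abs_mul] at hl hu
  set a := (h : Matrix (Fin 2) (Fin 2) ℝ) 0 0
  set b := (h : Matrix (Fin 2) (Fin 2) ℝ) 0 1
  have hz : 0 < |a| := abs_pos.2 ha
  have c1 : A * |a| ≤ C₀ := by
    refine le_trans ?_ (le_max_left _ _)
    rw [← one_div, le_div_iff₀ hx, mul_assoc]
    exact hu
  have c2 : A * |a|⁻¹ ≤ C₀ := by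
    refine le_trans ?_ (le_max_right _ _)
    rw [← div_eq_mul_inv, div_le_iff₀ hz, mul_comm]
    exact hl
  have hP : ∀ e : ℝ, |e| ≤ |c| + 1 → A ^ k * |a| ^ e ≤ C₀ ^ |e| := fun e he =>
    pow_mul_rpow_le hA0 hA1 hz c1 c2 (he.trans hk)
  have p1 := hP 1 (by rw [abs_one]; linarith [abs_nonneg c])
  have p2 := hP c (by linarith)
  have p3 := hP (-(1 + c)) (by
    rw [abs_neg]
    refine (abs_add_le _ _).trans ?_
    rw [abs_one, add_comm])
  rw [Real.rpow_one] at p1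
  have hk1 : k ≠ 0 := by
    rintro rfl
    have := abs_nonneg c
    norm_num at hk
    linarith
  have hAk : A ^ k ≤ A := pow_le_of_le_one hA0 hA1 hk1
  have hAk0 : 0 ≤ A ^ k := by positivity
  have hb : A ^ k * |b| ≤ (1 + C₀ ^ |c| * y) / x := by
    rw [le_div_iff₀ hx]
    have e1 : |b| * x ≤ |b * ξ 0 + (h : Matrix (Fin 2) (Fin 2) ℝ) 1 1 * ξ 1| + |a| ^ c * y := by
      rw [← abs_mul, h2, ← abs_signedPow ha c, ← abs_mul]
      have := abs_sub (b * ξ 0 + signedPow a c * ξ 1) (signedPow a c * ξ 1)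
      simpa using this
    calc A ^ k * |b| * x = A ^ k * (|b| * x) := by ring
      _ ≤ A ^ k * (|b * ξ 0 + (h : Matrix (Fin 2) (Fin 2) ℝ) 1 1 * ξ 1| + |a| ^ c * y) := by
        gcongr
      _ = A ^ k * |b * ξ 0 + (h : Matrix (Fin 2) (Fin 2) ℝ) 1 1 * ξ 1| +
          A ^ k * |a| ^ c * y := by ring
      _ ≤ 1 + C₀ ^ |c| * y := by
        gcongr
        exact (mul_le_mul_of_nonneg_right hAk (abs_nonneg _)).trans hv
  constructor
  · refine le_trans ?_ (le_max_left _ _)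
    calc _ ≤ A ^ k * (|a| + |b| + |a| ^ c) := by gcongr
      _ = A ^ k * |a| + A ^ k * |b| + A ^ k * |a| ^ c := by ring
      _ ≤ _ := by gcongr
  · refine le_trans ?_ (le_max_right _ _)
    rw [hdet, ← Real.rpow_neg hz.le]
    exact p3

end ShearletGroup

/-! ### The explicit weights have polynomial growth -/

section Weights

theorem abs_entry_le_groupSize (h : GL (Fin 2) ℝ) (i j : Fin 2) :
    |(h : Matrix (Fin 2) (Fin 2) ℝ) i j| ≤ groupSize h := by
  have h1 := abs_entry_le_norm (h : Matrix (Fin 2) (Fin 2) ℝ) i j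
  have h2 := norm_le_groupSize h
  linarith

/-- For an upper triangular h the inverse of the corner is an entry of h⁻¹. -/
theorem inv_corner_zero_le_groupSize {h : GL (Fin 2) ℝ}
    (h0 : (h : Matrix (Fin 2) (Fin 2) ℝ) 1 0 = 0) :
    |(h : Matrix (Fin 2) (Fin 2) ℝ) 0 0|⁻¹ ≤ groupSize h := by
  have h1 : ((h⁻¹ : GL (Fin 2) ℝ) : Matrix (Fin 2) (Fin 2) ℝ) 0 0 *
      (h : Matrix (Fin 2) (Fin 2) ℝ) 0 0 = 1 := by
    have : ((h⁻¹ * h : GL (Fin 2) ℝ) : Matrix (Fin 2) (Fin 2) ℝ) 0 0 = 1 := by simp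
    rwa [Units.val_mul, Matrix.mul_apply, Fin.sum_univ_two, h0, mul_zero, add_zero] at this
  rw [← abs_inv, ← eq_inv_of_mul_eq_one_left h1, ← groupSize_inv]
  exact abs_entry_le_groupSize _ _ _

theorem inv_corner_one_le_groupSize {h : GL (Fin 2) ℝ}
    (h0 : (h : Matrix (Fin 2) (Fin 2) ℝ) 1 0 = 0) :
    |(h : Matrix (Fin 2) (Fin 2) ℝ) 1 1|⁻¹ ≤ groupSize h := by
  have h1 : (h : Matrix (Fin 2) (Fin 2) ℝ) 1 1 *
      ((h⁻¹ : GL (Fin 2) ℝ) : Matrix (Fin 2) (Fin 2) ℝ) 1 1 = 1 := by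
    have : ((h * h⁻¹ : GL (Fin 2) ℝ) : Matrix (Fin 2) (Fin 2) ℝ) 1 1 = 1 := by simp
    rwa [Units.val_mul, Matrix.mul_apply, Fin.sum_univ_two, h0, zero_mul, zero_add] at this
  rw [← abs_inv, ← eq_inv_of_mul_eq_one_right h1, ← groupSize_inv]
  exact abs_entry_le_groupSize _ _ _

theorem one_le_add_inv {x : ℝ} (hx : 0 < x) : 1 ≤ x + x⁻¹ := by
  rcases le_total 1 x with h | h
  · have := inv_pos.2 hx
    linarith
  · have := (one_le_inv₀ hx).2 h
    linarith

/-- The lower bound 1 ≤ B is what allows negative exponents t. -/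
theorem rpow_le_mul_groupSize_rpow {d : ℕ} (h : GL (Fin d) ℝ) {B c : ℝ} {n : ℕ} (hc : 1 ≤ c)
    (h1 : 1 ≤ B) (h2 : B ≤ c * groupSize h ^ n) (t : ℝ) :
    B ^ t ≤ c ^ |t| * groupSize h ^ (n * |t|) := by
  have hN := one_le_groupSize h
  have hM : 1 ≤ c * groupSize h ^ n := h1.trans h2
  refine (rpow_le_rpow_abs (by positivity) ((inv_le_one_of_one_le₀ hM).trans h1) h2 t).trans
    (le_of_eq ?_)
  have := groupSize_pos h
  rw [Real.mul_rpow (by positivity) (by positivity), ← Real.rpow_natCast, ← Real.rpow_mul this.le]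

theorem isTemperatelyEmbedded_similitudeGroup (u : ℝ) (w : similitudeGroup → ℝ)
    (hwc : Continuous w) (hw0 : ∀ h, 0 < w h)
    (hw : ∀ h, w h ≤ (entry h 0 0 ^ 2 + entry h 0 1 ^ 2) ^ u +
      (entry h 0 0 ^ 2 + entry h 0 1 ^ 2) ^ (-u)) :
    IsTemperatelyEmbedded similitudeGroup {ξ | ξ ≠ 0} w := by
  refine isSizeControlled_similitudeGroup.isTemperatelyEmbedded isClosed_similitudeGroup hwc hw0
    (C := 2 * (2 : ℝ) ^ |u|) (u := 2 * |u|) fun h => (hw h).trans ?_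
  have hd : entry h 0 0 ^ 2 + entry h 0 1 ^ 2 = absDet (h : GL (Fin 2) ℝ) :=
    (absDet_similitudeGroup h.2).symm
  have key : ∀ v : ℝ, absDet (h : GL (Fin 2) ℝ) ^ v ≤
      (2 : ℝ) ^ |v| * groupSize (h : GL (Fin 2) ℝ) ^ (2 * |v|) := by
    intro v
    have hN := groupSize_pos (h : GL (Fin 2) ℝ)
    refine (absDet_rpow_le _ v).trans (le_of_eq ?_)
    rw [Real.mul_rpow (by positivity) (by positivity), ← Real.rpow_natCast,
      ← Real.rpow_mul hN.le]
    simp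
  rw [hd]
  have h1 := key u
  have h2 := key (-u)
  rw [abs_neg] at h2
  linarith

theorem isTemperatelyEmbedded_diagonalGroup (t u : ℝ) (w : diagonalGroup → ℝ)
    (hwc : Continuous w) (hw0 : ∀ h, 0 < w h)
    (hw : ∀ h, w h ≤ (|entry h 0 0| + |entry h 0 0|⁻¹) ^ t *
      (|entry h 1 1| + |entry h 1 1|⁻¹) ^ u) :
    IsTemperatelyEmbedded diagonalGroup {ξ | ξ 0 ≠ 0 ∧ ξ 1 ≠ 0} w := by
  refine isSizeControlled_diagonalGroup.isTemperatelyEmbedded isClosed_diagonalGroup hwc hw0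
    (C := (2 : ℝ) ^ |t| * (2 : ℝ) ^ |u|) (u := (1 : ℕ) * |t| + (1 : ℕ) * |u|)
    fun h => (hw h).trans ?_
  have hN := groupSize_pos (h : GL (Fin 2) ℝ)
  obtain ⟨-, h0⟩ := mem_diagonalGroup.1 h.2
  have hd := absDet_pos (h : GL (Fin 2) ℝ)
  rw [absDet_diagonalGroup h.2] at hd
  have ha : 0 < |entry h 0 0| := pos_of_mul_pos_left hd (abs_nonneg _)
  have hb : 0 < |entry h 1 1| := pos_of_mul_pos_right hd (abs_nonneg _)
  have a1 : |entry h 0 0| ≤ _ := abs_entry_le_groupSize (h : GL (Fin 2) ℝ) 0 0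
  have a2 : |entry h 0 0|⁻¹ ≤ _ := inv_corner_zero_le_groupSize h0
  have b1 : |entry h 1 1| ≤ _ := abs_entry_le_groupSize (h : GL (Fin 2) ℝ) 1 1
  have b2 : |entry h 1 1|⁻¹ ≤ _ := inv_corner_one_le_groupSize h0
  rw [Real.rpow_add hN]
  have k1 := rpow_le_mul_groupSize_rpow (h : GL (Fin 2) ℝ) (c := 2) (n := 1) one_le_two
    (one_le_add_inv ha) (by rw [pow_one]; linarith) t
  have k2 := rpow_le_mul_groupSize_rpow (h : GL (Fin 2) ℝ) (c := 2) (n := 1) one_le_two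
    (one_le_add_inv hb) (by rw [pow_one]; linarith) u
  calc _ ≤ (2 ^ |t| * groupSize (h : GL (Fin 2) ℝ) ^ ((1 : ℕ) * |t|)) *
        (2 ^ |u| * groupSize (h : GL (Fin 2) ℝ) ^ ((1 : ℕ) * |u|)) := by gcongr
    _ = _ := by ring

theorem isTemperatelyEmbedded_shearletGroup (c u : ℝ) (w : shearletGroup c → ℝ)
    (hwc : Continuous w) (hw0 : ∀ h, 0 < w h)
    (hw : ∀ h, w h ≤ (|entry h 0 0| + |entry h 0 0|⁻¹ + |entry h 0 1|) ^ u) :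
    IsTemperatelyEmbedded (shearletGroup c) {ξ | ξ 0 ≠ 0} w := by
  refine (isSizeControlled_shearletGroup c).isTemperatelyEmbedded (isClosed_shearletGroup c) hwc
    hw0 (C := (3 : ℝ) ^ |u|) (u := (1 : ℕ) * |u|) fun h => (hw h).trans ?_
  obtain ⟨h0, -⟩ := mem_shearletGroup.1 h.2
  have ha : 0 < |entry h 0 0| := abs_pos.2 (corner_ne_zero h0)
  have a1 : |entry h 0 0| ≤ _ := abs_entry_le_groupSize (h : GL (Fin 2) ℝ) 0 0
  have a2 : |entry h 0 0|⁻¹ ≤ _ := inv_corner_zero_le_groupSize h0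
  have a3 : |entry h 0 1| ≤ _ := abs_entry_le_groupSize (h : GL (Fin 2) ℝ) 0 1
  have a4 := one_le_add_inv ha
  have a5 := abs_nonneg (entry h 0 1)
  exact rpow_le_mul_groupSize_rpow (h : GL (Fin 2) ℝ) (c := 3) (n := 1) (by norm_num)
    (by linarith) (by rw [pow_one]; linarith) u

theorem continuous_entry {H : Subgroup (GL (Fin 2) ℝ)} (i j : Fin 2) :
    Continuous fun h : H => entry h i j :=
  (continuous_GL_entry i j).comp continuous_subtype_val

theorem isTemperatelyEmbedded_shearletGroup_half (r₁ r₂ : ℝ) :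
    IsTemperatelyEmbedded (shearletGroup (1 / 2)) {ξ | ξ 0 ≠ 0}
      (fun h => |entry h 0 0| ^ r₁ *
        (|entry h 0 0| + |entry h 0 0|⁻¹ +
          |entry h 0 0| ^ (-(1 / 2) : ℝ) * |entry h 0 1|) ^ r₂) := by
  have ha : ∀ h : shearletGroup (1 / 2), 0 < |entry h 0 0| := fun h =>
    abs_pos.2 (corner_ne_zero (mem_shearletGroup.1 h.2).1)
  have hB : ∀ h : shearletGroup (1 / 2), 1 ≤ |entry h 0 0| + |entry h 0 0|⁻¹ +
      |entry h 0 0| ^ (-(1 / 2) : ℝ) * |entry h 0 1| := fun h => by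
    have := one_le_add_inv (ha h)
    have := ha h
    have : 0 ≤ |entry h 0 0| ^ (-(1 / 2) : ℝ) * |entry h 0 1| := by positivity
    linarith
  have hca : Continuous fun h : shearletGroup (1 / 2) => |entry h 0 0| :=
    (continuous_entry 0 0).abs
  have hca' : ∀ r : ℝ, Continuous fun h : shearletGroup (1 / 2) => |entry h 0 0| ^ r := fun r =>
    hca.rpow_const fun h => Or.inl (ha h).ne'
  refine (isSizeControlled_shearletGroup (1 / 2)).isTemperatelyEmbedded
    (isClosed_shearletGroup (1 / 2)) ?_ ?_
    (C := (3 : ℝ) ^ |r₂|) (u := |r₁| + (2 : ℕ) * |r₂|) fun h => ?_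
  · refine (hca' r₁).mul (Continuous.rpow_const ?_ fun h => Or.inl ?_)
    · exact (hca.add (hca.inv₀ fun h => (ha h).ne')).add ((hca' _).mul (continuous_entry 0 1).abs)
    · exact (one_pos.trans_le (hB h)).ne'
  · intro h
    have h1 := ha h
    have h2 := one_pos.trans_le (hB h)
    positivity
  · obtain ⟨h0, -⟩ := mem_shearletGroup.1 h.2
    have hN := groupSize_pos (h : GL (Fin 2) ℝ)
    have hN1 := one_le_groupSize (h : GL (Fin 2) ℝ)
    have a1 : |entry h 0 0| ≤ _ := abs_entry_le_groupSize (h : GL (Fin 2) ℝ) 0 0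
    have a2 : |entry h 0 0|⁻¹ ≤ _ := inv_corner_zero_le_groupSize h0
    have a3 : |entry h 0 1| ≤ _ := abs_entry_le_groupSize (h : GL (Fin 2) ℝ) 0 1
    have hr : ∀ r : ℝ, |entry h 0 0| ^ r ≤ groupSize (h : GL (Fin 2) ℝ) ^ |r| :=
      rpow_le_rpow_abs hN (inv_le_of_inv_le₀ (ha h) a2) a1
    have a4 : |entry h 0 0| ^ (-(1 / 2) : ℝ) ≤ groupSize (h : GL (Fin 2) ℝ) := by
      refine (hr _).trans ?_
      conv_rhs => rw [← Real.rpow_one (groupSize (h : GL (Fin 2) ℝ))]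
      refine Real.rpow_le_rpow_of_exponent_le hN1 ?_
      rw [abs_neg, abs_of_pos] <;> norm_num
    have a5 : |entry h 0 0| ^ (-(1 / 2) : ℝ) * |entry h 0 1| ≤
        groupSize (h : GL (Fin 2) ℝ) * groupSize (h : GL (Fin 2) ℝ) := by gcongr
    -- The term |a|^(-1/2) |b| is quadratic in the size, hence n = 2; the 3 counts the summands.
    have k := rpow_le_mul_groupSize_rpow (h : GL (Fin 2) ℝ) (c := 3) (n := 2) (by norm_num)
      (hB h) (by nlinarith) r₂
    have h2 := one_pos.trans_le (hB h)
    rw [Real.rpow_add hN]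
    calc _ ≤ groupSize (h : GL (Fin 2) ℝ) ^ |r₁| *
          (3 ^ |r₂| * groupSize (h : GL (Fin 2) ℝ) ^ ((2 : ℕ) * |r₂|)) := by
          gcongr
          exact hr _
      _ = _ := by ring

end Weights

/-! ### The L² Fourier transform tested against Schwartz functions -/

section FourierDuality

open scoped FourierTransform SchwartzMap ContDiff

variable {d : ℕ}

/-- The L² transform is compatible with that of tempered distributions, where duality with Schwartz
functions is the definition. -/
theorem integral_schwartz_smul_fourier_Lp (F : Lp ℂ 2 (volume : Measure (Rd d)))
    (g : 𝓢(Rd d, ℂ)) :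
    ∫ x, g x • (𝓕 F : Lp ℂ 2 (volume : Measure (Rd d))) x = ∫ x, (𝓕 g) x • F x := by
  have h := congrArg (fun T => T g) (Lp.fourier_toTemperedDistribution_eq F)
  simp only [TemperedDistribution.fourier_apply, Lp.toTemperedDistribution_apply] at h
  exact h.symm

theorem integral_fourier_schwartz_smul (f : Rd d → ℂ) (hf : Integrable f) (g : 𝓢(Rd d, ℂ)) :
    ∫ x, (𝓕 g) x • f x = ∫ x, g x • (𝓕 f) x := by
  have h := VectorFourier.integral_fourierIntegral_smul_eq_flip (L := innerₗ (Rd d))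
    (μ := volume) (ν := volume) Real.continuous_fourierChar continuous_inner g.integrable hf
  rw [flip_innerₗ] at h
  simp only [SchwartzMap.fourier_coe]
  exact h

theorem continuous_fourier_of_integrable {f : Rd d → ℂ} (hf : Integrable f) :
    Continuous (𝓕 f) :=
  VectorFourier.fourierIntegral_continuous (L := innerₗ (Rd d)) Real.continuous_fourierChar
    continuous_inner hf

/-- Smooth compactly supported functions are Schwartz, and they already separate locally integrable
functions. -/
theorem ae_eq_of_integral_schwartz_smul_eq {f g : Rd d → ℂ} (hf : LocallyIntegrable f)
    (hg : LocallyIntegrable g)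
    (h : ∀ φ : 𝓢(Rd d, ℂ), ∫ x, φ x • f x = ∫ x, φ x • g x) : f =ᵐ[volume] g := by
  refine ae_eq_of_integral_contDiff_smul_eq hf hg fun φ hφ hc => ?_
  have hc' : HasCompactSupport fun x => ((φ x : ℝ) : ℂ) := hc.comp_left Complex.ofReal_zero
  have hφ' : ContDiff ℝ ∞ fun x => ((φ x : ℝ) : ℂ) := Complex.ofRealCLM.contDiff.comp hφ
  simpa using h (hc'.toSchwartzMap hφ')

theorem locallyIntegrable_Lp_two (F : Lp ℂ 2 (volume : Measure (Rd d))) :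
    LocallyIntegrable F :=
  (Lp.memLp F).locallyIntegrable one_le_two

/-- On `L¹ ∩ L²` the two definitions of the Fourier transform agree. -/
theorem fourier_toLp_ae_eq {f : Rd d → ℂ} (hf : Integrable f) (hf2 : MemLp f 2) :
    (𝓕 hf2.toLp : Lp ℂ 2 (volume : Measure (Rd d))) =ᵐ[volume] 𝓕 f := by
  refine ae_eq_of_integral_schwartz_smul_eq (locallyIntegrable_Lp_two _)
    (continuous_fourier_of_integrable hf).locallyIntegrable fun φ => ?_
  rw [integral_schwartz_smul_fourier_Lp, ← integral_fourier_schwartz_smul f hf]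
  refine integral_congr_ae ?_
  filter_upwards [hf2.coeFn_toLp] with x hx
  rw [hx]

theorem lintegral_sq_enorm_eq_norm (F : Lp ℂ 2 (volume : Measure (Rd d))) :
    ∫⁻ x, ‖F x‖ₑ ^ 2 = ENNReal.ofReal (‖F‖ ^ 2) := by
  have h1 : eLpNorm F 2 volume = ENNReal.ofReal ‖F‖ := by
    rw [Lp.norm_def, ENNReal.ofReal_toReal (Lp.eLpNorm_ne_top F)]
  have h2 := eLpNorm_nnreal_pow_eq_lintegral (f := F) (μ := volume) (p := 2) two_ne_zero
  simp only [NNReal.coe_ofNat, ENNReal.coe_ofNat, ENNReal.rpow_ofNat] at h2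
  rw [← h2, h1, ENNReal.ofReal_pow (norm_nonneg _)]

/-- Plancherel's inequality for integrable functions, both sides possibly infinite. -/
theorem lintegral_sq_le_lintegral_sq_fourier {f : Rd d → ℂ} (hf : Integrable f) :
    ∫⁻ x, ‖f x‖ₑ ^ 2 ≤ ∫⁻ x, ‖(𝓕 f) x‖ₑ ^ 2 := by
  by_cases hfin : ∫⁻ x, ‖(𝓕 f) x‖ₑ ^ 2 < ⊤
  swap
  · rw [not_lt_top_iff.1 hfin]
    exact le_top
  have hm : MemLp (𝓕 f) 2 volume := by
    refine ⟨(continuous_fourier_of_integrable hf).aestronglyMeasurable, ?_⟩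
    rw [eLpNorm_lt_top_iff_lintegral_rpow_enorm_lt_top two_ne_zero ENNReal.ofNat_ne_top]
    simpa using hfin
  -- Inversion without assuming that f is in L²: both sides are tested against φ = 𝓕(𝓕⁻φ), and
  -- duality moves the transform onto f.
  have heq : (𝓕⁻ hm.toLp : Lp ℂ 2 (volume : Measure (Rd d))) =ᵐ[volume] f := by
    refine ae_eq_of_integral_schwartz_smul_eq (locallyIntegrable_Lp_two _)
      hf.locallyIntegrable fun φ => ?_
    have e : 𝓕 (𝓕⁻ φ) = φ := FourierTransform.fourier_fourierInv_eq φ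
    have h1 := integral_schwartz_smul_fourier_Lp (𝓕⁻ hm.toLp) (𝓕⁻ φ)
    have h2 := integral_fourier_schwartz_smul f hf (𝓕⁻ φ)
    rw [e, FourierTransform.fourier_fourierInv_eq] at h1
    rw [e] at h2
    rw [← h1, h2]
    refine integral_congr_ae ?_
    filter_upwards [hm.coeFn_toLp] with x hx
    rw [hx]
  have e1 : ∫⁻ x, ‖f x‖ₑ ^ 2 =
      ∫⁻ x, ‖(𝓕⁻ hm.toLp : Lp ℂ 2 (volume : Measure (Rd d))) x‖ₑ ^ 2 := by
    refine lintegral_congr_ae ?_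
    filter_upwards [heq] with x hx
    rw [hx]
  have e2 : ∫⁻ x, ‖(𝓕 f) x‖ₑ ^ 2 = ∫⁻ x, ‖(hm.toLp (𝓕 f) : Lp ℂ 2 (volume : Measure (Rd d))) x‖ₑ ^ 2 := by
    refine lintegral_congr_ae ?_
    filter_upwards [hm.coeFn_toLp] with x hx
    rw [hx]
  rw [e1, e2, lintegral_sq_enorm_eq_norm, lintegral_sq_enorm_eq_norm,
    ← Lp.norm_fourier_eq (𝓕⁻ hm.toLp), FourierTransform.fourier_fourierInv_eq]

end FourierDuality

/-! ### The quasi-regular representation on the Fourier side -/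

section QuasiRegularFourier

open scoped FourierTransform SchwartzMap

variable {d : ℕ}

theorem continuous_matAct_right (M : Matrix (Fin d) (Fin d) ℝ) : Continuous (matAct M) :=
  (Matrix.toEuclideanCLM (n := Fin d) (𝕜 := ℝ) M).continuous

theorem det_ne_zero_GL (h : GL (Fin d) ℝ) : (h : Matrix (Fin d) (Fin d) ℝ).det ≠ 0 :=
  abs_pos.1 (absDet_pos h)

theorem map_matAct_volume (h : GL (Fin d) ℝ) :
    Measure.map (matAct (h : Matrix (Fin d) (Fin d) ℝ)) (volume : Measure (Rd d)) =
      ENNReal.ofReal (absDet h)⁻¹ • (volume : Measure (Rd d)) := by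
  let T : Rd d →ₗ[ℝ] Rd d := Matrix.toLpLin 2 2 (h : Matrix (Fin d) (Fin d) ℝ)
  have h1 : LinearMap.det T = (h : Matrix (Fin d) (Fin d) ℝ).det := by
    simp only [T, Matrix.toLpLin_eq_toLin, LinearMap.det_toLin]
  have := Measure.map_linearMap_addHaar_eq_smul_addHaar (volume : Measure (Rd d))
    (f := T) (by rw [h1]; exact det_ne_zero_GL h)
  rwa [h1, abs_inv] at this

theorem lintegral_comp_matAct (h : GL (Fin d) ℝ) {f : Rd d → ℝ≥0∞} (hf : AEMeasurable f) :
    ∫⁻ x, f (matAct (h : Matrix (Fin d) (Fin d) ℝ) x) =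
      ENNReal.ofReal (absDet h)⁻¹ * ∫⁻ x, f x := by
  have hm := (continuous_matAct_right (h : Matrix (Fin d) (Fin d) ℝ)).measurable
  rw [← lintegral_map' (μ := volume) (g := matAct (h : Matrix (Fin d) (Fin d) ℝ)) _
    hm.aemeasurable, map_matAct_volume, lintegral_smul_measure, smul_eq_mul]
  rw [map_matAct_volume]
  exact hf.smul_measure _

theorem quasiMeasurePreserving_matAct (h : GL (Fin d) ℝ) :
    Measure.QuasiMeasurePreserving (matAct (h : Matrix (Fin d) (Fin d) ℝ))
      (volume : Measure (Rd d)) volume :=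
  ⟨(continuous_matAct_right _).measurable, by
    rw [map_matAct_volume]
    exact Measure.smul_absolutelyContinuous⟩

theorem quasiMeasurePreserving_matAct_sub (h : GL (Fin d) ℝ) (x : Rd d) :
    Measure.QuasiMeasurePreserving (fun y => matAct (h : Matrix (Fin d) (Fin d) ℝ) (y - x))
      (volume : Measure (Rd d)) volume :=
  (quasiMeasurePreserving_matAct h).comp
    (measurePreserving_sub_right (volume : Measure (Rd d)) x).quasiMeasurePreserving

theorem coeFn_quasiRegular (x : Rd d) (h : GL (Fin d) ℝ)
    (f : Lp ℂ 2 (volume : Measure (Rd d))) :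
    quasiRegular x h f =ᵐ[volume] quasiRegularFun x h f :=
  MemLp.coeFn_toLp _

theorem quasiRegularFun_congr_ae (x : Rd d) (h : GL (Fin d) ℝ) {f g : Rd d → ℂ}
    (hfg : f =ᵐ[volume] g) : quasiRegularFun x h f =ᵐ[volume] quasiRegularFun x h g := by
  filter_upwards [(quasiMeasurePreserving_matAct_sub h⁻¹ x).ae_eq_comp hfg] with y hy
  simp only [Function.comp_apply] at hy
  simp only [quasiRegularFun, hy]

theorem lintegral_sq_quasiRegularFun (x : Rd d) (h : GL (Fin d) ℝ) {f : Rd d → ℂ}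
    (hf : AEStronglyMeasurable f volume) :
    ∫⁻ y, ‖quasiRegularFun x h f y‖ₑ ^ 2 = ∫⁻ y, ‖f y‖ₑ ^ 2 := by
  have hD := absDet_pos h
  have e1 : ∀ y, ‖quasiRegularFun x h f y‖ₑ ^ 2 = ENNReal.ofReal (absDet h)⁻¹ *
      ‖f (matAct ((h⁻¹ : GL (Fin d) ℝ) : Matrix (Fin d) (Fin d) ℝ) (y - x))‖ₑ ^ 2 := by
    intro y
    rw [quasiRegularFun, enorm_mul, mul_pow]
    congr 1
    rw [← ofReal_norm, Complex.norm_real, Real.norm_of_nonneg (by positivity),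
      ← ENNReal.ofReal_pow (by positivity), ← Real.rpow_natCast, ← Real.rpow_mul hD.le]
    norm_num [Real.rpow_neg_one]
  simp_rw [e1]
  have hf2 : AEMeasurable (fun y => ‖f y‖ₑ ^ 2) volume := hf.enorm.pow_const _
  rw [lintegral_const_mul' _ _ ENNReal.ofReal_ne_top,
    lintegral_sub_right_eq_self (fun y => ‖f (matAct ((h⁻¹ : GL (Fin d) ℝ) :
      Matrix (Fin d) (Fin d) ℝ) y)‖ₑ ^ 2) x,
    lintegral_comp_matAct h⁻¹ (f := fun y => ‖f y‖ₑ ^ 2) hf2, ← mul_assoc, absDet_inv, inv_inv,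
    ← ENNReal.ofReal_mul (inv_nonneg.2 hD.le), inv_mul_cancel₀ hD.ne', ENNReal.ofReal_one,
    one_mul]

theorem memLp_unimodular_mul {m : Rd d → ℂ} (hm : Continuous m) (hm1 : ∀ y, ‖m y‖ = 1)
    {f : Rd d → ℂ} (hf : MemLp f 2 (volume : Measure (Rd d))) :
    MemLp (fun y => m y * f y) 2 (volume : Measure (Rd d)) :=
  hf.of_le_mul (c := 1) (hm.aestronglyMeasurable.mul hf.1)
    (Eventually.of_forall fun y => by rw [norm_mul, hm1])

theorem norm_eq_norm_of_lintegral_sq_eq {F G : Lp ℂ 2 (volume : Measure (Rd d))}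
    (h : ∫⁻ x, ‖F x‖ₑ ^ 2 = ∫⁻ x, ‖G x‖ₑ ^ 2) : ‖F‖ = ‖G‖ := by
  rw [lintegral_sq_enorm_eq_norm, lintegral_sq_enorm_eq_norm,
    ENNReal.ofReal_eq_ofReal_iff (by positivity) (by positivity)] at h
  exact (pow_left_inj₀ (norm_nonneg _) (norm_nonneg _) two_ne_zero).1 h

/-- The isometry of `L²` obtained by following the quasi-regular representation with the
multiplication by a unimodular function. -/
noncomputable def modulatedQuasiRegular {m : Rd d → ℂ} (hm : Continuous m)
    (hm1 : ∀ y, ‖m y‖ = 1) (x : Rd d) (h : GL (Fin d) ℝ) :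
    Lp ℂ 2 (volume : Measure (Rd d)) →ₗᵢ[ℂ] Lp ℂ 2 (volume : Measure (Rd d)) where
  toFun f := (memLp_unimodular_mul hm hm1 (memLp_quasiRegularFun x h (Lp.memLp f))).toLp _
  map_add' f g := by
    rw [← MemLp.toLp_add]
    refine MemLp.toLp_congr _ _ ?_
    filter_upwards [quasiRegularFun_congr_ae x h (Lp.coeFn_add f g)] with y hy
    rw [hy]
    simp only [quasiRegularFun, Pi.add_apply]
    ring
  map_smul' c f := by
    rw [RingHom.id_apply, ← MemLp.toLp_const_smul]
    refine MemLp.toLp_congr _ _ ?_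
    filter_upwards [quasiRegularFun_congr_ae x h (Lp.coeFn_smul c f)] with y hy
    rw [hy]
    simp only [quasiRegularFun, Pi.smul_apply, smul_eq_mul]
    ring
  norm_map' f := by
    apply norm_eq_norm_of_lintegral_sq_eq
    rw [← lintegral_sq_quasiRegularFun x h (Lp.aestronglyMeasurable f)]
    refine lintegral_congr_ae ?_
    filter_upwards [(memLp_unimodular_mul hm hm1
      (memLp_quasiRegularFun x h (Lp.memLp f))).coeFn_toLp] with y hy
    change ‖((memLp_unimodular_mul hm hm1 (memLp_quasiRegularFun x h (Lp.memLp f))).toLp _ :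
      Lp ℂ 2 (volume : Measure (Rd d))) y‖ₑ ^ 2 = _
    rw [hy, enorm_mul, ← ofReal_norm (m y), hm1]
    simp

theorem coeFn_modulatedQuasiRegular {m : Rd d → ℂ} (hm : Continuous m)
    (hm1 : ∀ y, ‖m y‖ = 1) (x : Rd d) (h : GL (Fin d) ℝ)
    (f : Lp ℂ 2 (volume : Measure (Rd d))) :
    modulatedQuasiRegular hm hm1 x h f =ᵐ[volume] fun y => m y * quasiRegularFun x h f y :=
  (memLp_unimodular_mul hm hm1 (memLp_quasiRegularFun x h (Lp.memLp f))).coeFn_toLp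

/-- The inverse transpose. -/
noncomputable def contragredient (h : GL (Fin d) ℝ) : GL (Fin d) ℝ where
  val := ((h⁻¹ : GL (Fin d) ℝ) : Matrix (Fin d) (Fin d) ℝ).transpose
  inv := (h : Matrix (Fin d) (Fin d) ℝ).transpose
  val_inv := by
    rw [← Matrix.transpose_mul, ← Units.val_mul, mul_inv_cancel, Units.val_one,
      Matrix.transpose_one]
  inv_val := by
    rw [← Matrix.transpose_mul, ← Units.val_mul, inv_mul_cancel, Units.val_one,
      Matrix.transpose_one]

theorem absDet_contragredient (h : GL (Fin d) ℝ) : absDet (contragredient h) = (absDet h)⁻¹ := by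
  rw [← absDet_inv]
  simp [absDet, contragredient, Matrix.det_transpose]

/-- The Fourier-side operator is itself of quasi-regular type, for h⁻ᵀ in place of h; the isometry
property already proved for that family applies to it. -/
theorem quasiRegularFun_contragredient (h : GL (Fin d) ℝ) (f : Rd d → ℂ) (ξ : Rd d) :
    quasiRegularFun 0 (contragredient h) f ξ =
      ((absDet h ^ (1 / 2 : ℝ) : ℝ) : ℂ) * f (dualAct h ξ) := by
  rw [quasiRegularFun, absDet_contragredient, Real.inv_rpow (absDet_pos h).le,
    Real.rpow_neg (absDet_pos h).le, inv_inv, sub_zero]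
  rfl

theorem inner_matAct (M : Matrix (Fin d) (Fin d) ℝ) (x y : Rd d) :
    inner ℝ (matAct M x) y = inner ℝ x (matAct M.transpose y) := by
  simp only [matAct, EuclideanSpace.inner_eq_star_dotProduct, star_trivial,
    Matrix.dotProduct_mulVec, Matrix.mulVec_transpose]

theorem measurableEmbedding_matAct (h : GL (Fin d) ℝ) :
    MeasurableEmbedding (matAct (d := d) (h : Matrix (Fin d) (Fin d) ℝ)) := by
  refine (continuous_matAct_right _).measurableEmbedding fun y z hyz => ?_
  have := congrArg (matAct ((h⁻¹ : GL (Fin d) ℝ) : Matrix (Fin d) (Fin d) ℝ)) hyz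
  simpa [← matAct_mul, ← Units.val_mul] using this

theorem integrable_comp_matAct (h : GL (Fin d) ℝ) {f : Rd d → ℂ} (hf : Integrable f) :
    Integrable fun y => f (matAct (h : Matrix (Fin d) (Fin d) ℝ) y) := by
  refine ((measurableEmbedding_matAct h).integrable_map_iff (μ := volume)).1 ?_
  rw [map_matAct_volume]
  exact hf.smul_measure ENNReal.ofReal_ne_top

theorem integral_comp_matAct_sub (h : GL (Fin d) ℝ) (x : Rd d) (f : Rd d → ℂ) :
    ∫ y, f (matAct ((h⁻¹ : GL (Fin d) ℝ) : Matrix (Fin d) (Fin d) ℝ) (y - x)) =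
      (absDet h : ℂ) * ∫ y, f y := by
  rw [integral_sub_right_eq_self
    (fun y => f (matAct ((h⁻¹ : GL (Fin d) ℝ) : Matrix (Fin d) (Fin d) ℝ) y)) x]
  rw [← (measurableEmbedding_matAct h⁻¹).integral_map (μ := volume) f, map_matAct_volume, integral_smul_measure, absDet_inv,
    inv_inv, ENNReal.toReal_ofReal (absDet_pos h).le, Complex.real_smul]

/-- Substitute z = h⁻¹(y - x): the Jacobian |det h| turns |det h|^(-1/2) into |det h|^(1/2), and the
translation produces the character. -/
theorem fourier_quasiRegularFun (x : Rd d) (h : GL (Fin d) ℝ) (f : Rd d → ℂ) (ξ : Rd d) :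
    𝓕 (quasiRegularFun x h f) ξ = (Real.fourierChar (-inner ℝ x ξ) : ℂ) *
      quasiRegularFun 0 (contragredient h) (𝓕 f) ξ := by
  rw [quasiRegularFun_contragredient, Real.fourier_eq, Real.fourier_eq]
  let F : Rd d → ℂ := fun z => (Real.fourierChar (-inner ℝ x ξ) : ℂ) *
    (((absDet h ^ (-(1 / 2) : ℝ) : ℝ) : ℂ) *
      ((Real.fourierChar (-inner ℝ z (dualAct h ξ)) : ℂ) * f z))
  have e1 : ∀ y, Real.fourierChar (-inner ℝ y ξ) • quasiRegularFun x h f y =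
      F (matAct ((h⁻¹ : GL (Fin d) ℝ) : Matrix (Fin d) (Fin d) ℝ) (y - x)) := by
    intro y
    have e2 : inner ℝ y ξ = inner ℝ x ξ + inner ℝ
        (matAct ((h⁻¹ : GL (Fin d) ℝ) : Matrix (Fin d) (Fin d) ℝ) (y - x)) (dualAct h ξ) := by
      rw [dualAct, ← inner_matAct, ← matAct_mul, ← Units.val_mul, mul_inv_cancel, Units.val_one,
        matAct_one, ← inner_add_left, add_sub_cancel]
    rw [e2, neg_add, AddChar.map_add_eq_mul, Circle.smul_def, Circle.coe_mul, quasiRegularFun]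
    simp only [F, smul_eq_mul]
    ring
  simp_rw [e1]
  rw [integral_comp_matAct_sub]
  simp only [F, integral_const_mul, Circle.smul_def, smul_eq_mul]
  have hD := absDet_pos h
  have e3 : absDet h * absDet h ^ (-(1 / 2) : ℝ) = absDet h ^ (1 / 2 : ℝ) := by
    conv_lhs => rw [← Real.rpow_one_add' hD.le (by norm_num)]
    norm_num
  rw [← e3]
  push_cast
  ring

theorem quasiRegular_toLp_schwartz (x : Rd d) (h : GL (Fin d) ℝ) (φ : 𝓢(Rd d, ℂ)) :
    quasiRegular x h (φ.toLp 2) = (memLp_quasiRegularFun x h (φ.memLp 2 volume)).toLp _ := by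
  refine Lp.ext ((coeFn_quasiRegular x h _).trans ?_)
  refine (quasiRegularFun_congr_ae x h (φ.coeFn_toLp 2 volume)).trans ?_
  exact (memLp_quasiRegularFun x h (φ.memLp 2 volume)).coeFn_toLp.symm

theorem fourier_quasiRegular_schwartz (x : Rd d) (h : GL (Fin d) ℝ) (φ : 𝓢(Rd d, ℂ)) :
    (𝓕 (quasiRegular x h (φ.toLp 2)) : Lp ℂ 2 (volume : Measure (Rd d))) =ᵐ[volume]
      fun ξ => (Real.fourierChar (-inner ℝ x ξ) : ℂ) *
        quasiRegularFun 0 (contragredient h) ((𝓕 φ).toLp 2 volume) ξ := by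
  have hint : Integrable (quasiRegularFun x h φ) :=
    ((integrable_comp_matAct h⁻¹ φ.integrable).comp_sub_right x).const_mul _
  have e2 := fourier_toLp_ae_eq hint (memLp_quasiRegularFun x h (φ.memLp 2 volume))
  have e3 : quasiRegularFun 0 (contragredient h) ((𝓕 φ).toLp 2 volume) =ᵐ[volume]
      quasiRegularFun 0 (contragredient h) (𝓕 φ : 𝓢(Rd d, ℂ)) :=
    quasiRegularFun_congr_ae 0 (contragredient h) ((𝓕 φ).coeFn_toLp 2 volume)
  rw [quasiRegular_toLp_schwartz]
  refine e2.trans ?_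
  filter_upwards [e3] with ξ h3
  rw [h3, fourier_quasiRegularFun, SchwartzMap.fourier_coe]

/-- The Fourier transform intertwines the quasi-regular representation with a modulated
contragredient action. -/
theorem fourier_quasiRegular (x : Rd d) (h : GL (Fin d) ℝ)
    (f : Lp ℂ 2 (volume : Measure (Rd d))) :
    (𝓕 (quasiRegular x h f) : Lp ℂ 2 (volume : Measure (Rd d))) =ᵐ[volume]
      fun ξ => (Real.fourierChar (-inner ℝ x ξ) : ℂ) *
        (((absDet h ^ (1 / 2 : ℝ) : ℝ) : ℂ) *
          (𝓕 f : Lp ℂ 2 (volume : Measure (Rd d))) (dualAct h ξ)) := by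
  let m : Rd d → ℂ := fun ξ => (Real.fourierChar (-inner ℝ x ξ) : ℂ)
  have hm : Continuous m :=
    continuous_subtype_val.comp (Real.continuous_fourierChar.comp (by fun_prop))
  have hm1 : ∀ ξ, ‖m ξ‖ = 1 := fun ξ => Circle.norm_coe _
  let Q₁ := modulatedQuasiRegular (d := d) (m := fun _ => 1) continuous_const
    (fun _ => norm_one) x h
  let Q₂ := modulatedQuasiRegular hm hm1 0 (contragredient h)
  have hQ₁ : ∀ f, Q₁ f = quasiRegular x h f := fun f => by
    refine Lp.ext ?_
    filter_upwards [coeFn_modulatedQuasiRegular (d := d) (m := fun _ => 1) continuous_const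
      (fun _ => norm_one) x h f, coeFn_quasiRegular x h f] with y h1 h2
    rw [h1, h2, one_mul]
  -- Both sides are continuous in f and agree on Schwartz functions, which are dense in L².
  have key : ∀ f, 𝓕 (Q₁ f) = Q₂ (𝓕 f) := by
    intro f
    refine DenseRange.induction_on (p := fun f => 𝓕 (Q₁ f) = Q₂ (𝓕 f))
      (SchwartzMap.denseRange_toLpCLM (p := 2) ENNReal.ofNat_ne_top) f ?_ ?_
    · exact isClosed_eq ((Lp.fourierTransformₗᵢ (Rd d) ℂ).continuous.comp Q₁.continuous)
        (Q₂.continuous.comp (Lp.fourierTransformₗᵢ (Rd d) ℂ).continuous)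
    · intro φ
      rw [SchwartzMap.toLpCLM_apply, SchwartzMap.toLp_fourier_eq, hQ₁]
      refine Lp.ext ?_
      have h1 := fourier_quasiRegular_schwartz x h φ
      have h2 := coeFn_modulatedQuasiRegular hm hm1 0 (contragredient h) ((𝓕 φ).toLp 2)
      exact h1.trans h2.symm
  rw [← hQ₁, key]
  filter_upwards [coeFn_modulatedQuasiRegular hm hm1 0 (contragredient h) (𝓕 f)] with ξ h1
  rw [h1, quasiRegularFun_contragredient]

end QuasiRegularFourier

/-! ### Ergodicity of the dual action and the density from square-integrability -/

section Ergodicity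

open scoped FourierTransform

variable {d : ℕ}

theorem contragredient_inv_val (h : GL (Fin d) ℝ) :
    ((contragredient h⁻¹ : GL (Fin d) ℝ) : Matrix (Fin d) (Fin d) ℝ) =
      (h : Matrix (Fin d) (Fin d) ℝ).transpose := by
  simp [contragredient]

theorem quasiMeasurePreserving_dualAct (h : GL (Fin d) ℝ) :
    Measure.QuasiMeasurePreserving (dualAct h) (volume : Measure (Rd d)) volume := by
  have := quasiMeasurePreserving_matAct (contragredient h⁻¹)
  rwa [contragredient_inv_val] at this

theorem lintegral_comp_dualAct (h : GL (Fin d) ℝ) {f : Rd d → ℝ≥0∞} (hf : AEMeasurable f) :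
    ∫⁻ x, f (dualAct h x) = ENNReal.ofReal (absDet h)⁻¹ * ∫⁻ x, f x := by
  have := lintegral_comp_matAct (contragredient h⁻¹) hf
  rw [contragredient_inv_val, absDet_contragredient, absDet_inv, inv_inv] at this
  exact this

/-- The space of all `f ∈ L²` whose Fourier transform vanishes almost everywhere off `U`. -/
noncomputable def fourierSupportedIn (U : Set (Rd d)) :
    Submodule ℂ (Lp ℂ 2 (volume : Measure (Rd d))) :=
  (LpToLpRestrictCLM (Rd d) ℂ ℂ volume 2 Uᶜ).toLinearMap.ker.comap
    (Lp.fourierTransformₗᵢ (Rd d) ℂ).toLinearEquiv.toLinearMap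

theorem isClosed_fourierSupportedIn (U : Set (Rd d)) :
    IsClosed (fourierSupportedIn U : Set (Lp ℂ 2 (volume : Measure (Rd d)))) :=
  isClosed_singleton.preimage ((LpToLpRestrictCLM (Rd d) ℂ ℂ volume 2 Uᶜ).continuous.comp
    (Lp.fourierTransformₗᵢ (Rd d) ℂ).continuous)

theorem mem_fourierSupportedIn {U : Set (Rd d)} (hU : MeasurableSet U)
    {f : Lp ℂ 2 (volume : Measure (Rd d))} :
    f ∈ fourierSupportedIn U ↔
      ∀ᵐ ξ, ξ ∉ U → (𝓕 f : Lp ℂ 2 (volume : Measure (Rd d))) ξ = 0 := by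
  have h1 : f ∈ fourierSupportedIn U ↔
      LpToLpRestrictCLM (Rd d) ℂ ℂ volume 2 Uᶜ (𝓕 f) = 0 := Iff.rfl
  have h2 : (∀ᵐ ξ, ξ ∉ U → (𝓕 f : Lp ℂ 2 (volume : Measure (Rd d))) ξ = 0) ↔
      ∀ᵐ ξ ∂(volume.restrict Uᶜ), (𝓕 f : Lp ℂ 2 (volume : Measure (Rd d))) ξ = 0 :=
    (ae_restrict_iff' hU.compl).symm
  rw [h1, h2, Lp.eq_zero_iff_ae_eq_zero]
  have h3 := LpToLpRestrictCLM_coeFn (F := ℂ) (μ := volume) (p := 2) ℂ Uᶜ (𝓕 f)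
  constructor
  · intro h
    exact h3.symm.trans h
  · intro h
    exact h3.trans h

/-- By `fourier_quasiRegular` the transform at ξ is a multiple of that of f at hᵀξ, a point outside
U whenever ξ is; exceptional null sets pull back to null sets. -/
theorem quasiRegular_mem_fourierSupportedIn {U : Set (Rd d)} (hU : MeasurableSet U)
    {h : GL (Fin d) ℝ} (hinv : ∀ ξ, dualAct h ξ ∈ U → ξ ∈ U) (x : Rd d)
    {f : Lp ℂ 2 (volume : Measure (Rd d))} (hf : f ∈ fourierSupportedIn U) :
    quasiRegular x h f ∈ fourierSupportedIn U := by
  rw [mem_fourierSupportedIn hU] at hf ⊢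
  filter_upwards [fourier_quasiRegular x h f, (quasiMeasurePreserving_dualAct h).ae hf]
    with ξ h1 h2 h3
  rw [h1, h2 fun h4 => h3 (hinv ξ h4), mul_zero, mul_zero]

theorem exists_Lp_indicator {U : Set (Rd d)} (hU : MeasurableSet U) (h0 : volume U ≠ 0) :
    ∃ g : Lp ℂ 2 (volume : Measure (Rd d)), g ≠ 0 ∧ ∀ᵐ ξ, ξ ∉ U → g ξ = 0 := by
  obtain ⟨S, hS, hSU, hS0, hSt⟩ :=
    Measure.exists_subset_measure_lt_top hU (pos_iff_ne_zero.2 h0)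
  refine ⟨indicatorConstLp 2 hS hSt.ne 1, fun hz => ?_, ?_⟩
  · have := congrArg norm hz
    rw [norm_indicatorConstLp two_ne_zero ENNReal.ofNat_ne_top, norm_zero, norm_one, one_mul,
      Real.rpow_eq_zero measureReal_nonneg (by norm_num), measureReal_eq_zero_iff hSt.ne] at this
    exact hS0.ne' this
  · filter_upwards [indicatorConstLp_coeFn (p := 2) (hs := hS) (hμs := hSt.ne) (c := (1 : ℂ))]
      with ξ h1 h2
    rw [h1, Set.indicator_of_notMem fun h => h2 (hSU h)]

/-- Irreducibility of the quasi-regular representation implies ergodicity of the dual action. -/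
theorem IsIrreducibleQuasiRegular.null_or_conull {H : Subgroup (GL (Fin d) ℝ)}
    (hirr : IsIrreducibleQuasiRegular H) {U : Set (Rd d)} (hU : MeasurableSet U)
    (hinv : ∀ h ∈ H, ∀ ξ, dualAct h ξ ∈ U → ξ ∈ U) : volume U = 0 ∨ volume Uᶜ = 0 := by
  rcases hirr (fourierSupportedIn U) (isClosed_fourierSupportedIn U)
    (fun x h f hf => quasiRegular_mem_fourierSupportedIn hU (hinv h h.2) x hf) with hV | hV
  · left
    by_contra h0
    obtain ⟨g, hg0, hg⟩ := exists_Lp_indicator hU h0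
    have h1 : (𝓕⁻ g : Lp ℂ 2 (volume : Measure (Rd d))) ∈ fourierSupportedIn U := by
      rw [mem_fourierSupportedIn hU, FourierTransform.fourier_fourierInv_eq]
      exact hg
    rw [hV, Submodule.mem_bot] at h1
    apply hg0
    have e : 𝓕 (𝓕⁻ g : Lp ℂ 2 (volume : Measure (Rd d))) = g :=
      FourierTransform.fourier_fourierInv_eq g
    rw [← e, h1]
    exact (Lp.fourierTransformₗᵢ (Rd d) ℂ).map_zero
  · right
    by_contra h0
    obtain ⟨g, hg0, hg⟩ := exists_Lp_indicator hU.compl h0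
    have h1 : (𝓕⁻ g : Lp ℂ 2 (volume : Measure (Rd d))) ∈ fourierSupportedIn U := by
      rw [hV]
      trivial
    rw [mem_fourierSupportedIn hU, FourierTransform.fourier_fourierInv_eq] at h1
    apply hg0
    rw [Lp.eq_zero_iff_ae_eq_zero]
    filter_upwards [hg, h1] with ξ h2 h3
    by_cases hξ : ξ ∈ U
    · exact h2 (fun h => h hξ)
    · exact h3 hξ

/-- By Plancherel, x ↦ ⟨ψ, π(x,h)ψ⟩ is the Fourier transform of the integrable function |det
h|^(1/2) Ψ(hᵀξ) times the conjugate of Ψ(ξ). Only one inequality of Plancherel is needed for this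
function, which need not be in L². -/
theorem lintegral_sq_inner_quasiRegular_ge (ψ : Lp ℂ 2 (volume : Measure (Rd d)))
    (h : GL (Fin d) ℝ) :
    ENNReal.ofReal (absDet h) * ∫⁻ ξ, ‖(𝓕 ψ : Lp ℂ 2 (volume : Measure (Rd d))) ξ‖ₑ ^ 2 *
      ‖(𝓕 ψ : Lp ℂ 2 (volume : Measure (Rd d))) (dualAct h ξ)‖ₑ ^ 2 ≤
    ∫⁻ x : Rd d, ‖inner ℂ ψ (quasiRegular x h ψ)‖ₑ ^ 2 := by
  set Ψ : Lp ℂ 2 (volume : Measure (Rd d)) := 𝓕 ψ with hΨ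
  let G : Rd d → ℂ := fun ξ => quasiRegularFun 0 (contragredient h) Ψ ξ * (starRingEnd ℂ) (Ψ ξ)
  have hG : Integrable G := by
    have h1 := memLp_quasiRegularFun 0 (contragredient h) (Lp.memLp Ψ)
    exact h1.integrable_mul (Lp.memLp Ψ).star
  have hin : ∀ x : Rd d, inner ℂ ψ (quasiRegular x h ψ) = 𝓕 G x := by
    intro x
    rw [← Lp.inner_fourier_eq, L2.inner_def, Real.fourier_eq]
    refine integral_congr_ae ?_
    filter_upwards [fourier_quasiRegular x h ψ] with ξ h1
    rw [h1, RCLike.inner_apply, Circle.smul_def, real_inner_comm, smul_eq_mul]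
    simp only [G, quasiRegularFun_contragredient]
    ring
  simp_rw [hin]
  refine le_trans (le_of_eq ?_) (lintegral_sq_le_lintegral_sq_fourier hG)
  rw [← lintegral_const_mul' _ _ ENNReal.ofReal_ne_top]
  refine lintegral_congr fun ξ => ?_
  have hD := absDet_pos h
  simp only [G]
  rw [quasiRegularFun_contragredient, enorm_mul, enorm_mul, RCLike.enorm_conj, mul_pow, mul_pow,
    ← ofReal_norm (((absDet h ^ (1 / 2 : ℝ) : ℝ) : ℂ)), Complex.norm_real,
    Real.norm_of_nonneg (by positivity), ← ENNReal.ofReal_pow (by positivity),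
    ← Real.rpow_natCast (absDet h ^ (1 / 2 : ℝ)), ← Real.rpow_mul hD.le]
  norm_num
  ring

/-- A square-integrable quasi-regular representation yields a density on the dual space that is
integrable along almost every orbit. -/
theorem IsSquareIntegrableQuasiRegular.exists_density {H : Subgroup (GL (Fin d) ℝ)}
    (hsq : IsSquareIntegrableQuasiRegular H) :
    ∃ P : Rd d → ℝ≥0∞, Measurable P ∧ ¬ P =ᵐ[volume] 0 ∧
      ∀ μ : Measure H, μ.IsHaarMeasure →
        ∫⁻ h : H, (∫⁻ ξ, P ξ * P (dualAct (h : GL (Fin d) ℝ) ξ)) ∂μ < ∞ := by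
  obtain ⟨ψ, hψ, hint⟩ := hsq
  refine ⟨fun ξ => ‖(𝓕 ψ : Lp ℂ 2 (volume : Measure (Rd d))) ξ‖ₑ ^ 2,
    ((Lp.stronglyMeasurable _).enorm).pow_const 2, fun h0 => ?_, fun μ hμ => ?_⟩
  · apply hψ
    have : (𝓕 ψ : Lp ℂ 2 (volume : Measure (Rd d))) = 0 := by
      rw [Lp.eq_zero_iff_ae_eq_zero]
      filter_upwards [h0] with ξ hξ
      simpa using hξ
    rw [← norm_eq_zero, ← Lp.norm_fourier_eq, this, norm_zero]
  · refine lt_of_le_of_lt (lintegral_mono fun h => ?_) (hint μ hμ)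
    have hD := absDet_pos (h : GL (Fin d) ℝ)
    refine le_trans (le_of_eq ?_)
      (mul_le_mul_left (lintegral_sq_inner_quasiRegular_ge ψ (h : GL (Fin d) ℝ)) _)
    -- The Jacobian |det h| cancels the density |det h|⁻¹ of the Haar measure of the semidirect
    -- product.
    rw [mul_right_comm, ← ENNReal.ofReal_mul hD.le, mul_inv_cancel₀ hD.ne', ENNReal.ofReal_one,
      one_mul]

end Ergodicity

/-! ### A conull orbit with bounded stabilizers -/

section ConullOrbit

variable {d : ℕ}

/-- The dual orbit of `ξ`. -/
def dualOrbit (H : Subgroup (GL (Fin d) ℝ)) (ξ : Rd d) : Set (Rd d) :=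
  {η | ∃ h ∈ H, η = dualAct h ξ}

theorem dualAct_mem_dualOrbit {H : Subgroup (GL (Fin d) ℝ)} {ξ η : Rd d} {h : GL (Fin d) ℝ}
    (hh : h ∈ H) (hη : η ∈ dualOrbit H ξ) : dualAct h η ∈ dualOrbit H ξ := by
  obtain ⟨g, hg, rfl⟩ := hη
  exact ⟨g * h, H.mul_mem hg hh, by rw [dualAct_mul]⟩

theorem dualAct_mem_dualOrbit_iff {H : Subgroup (GL (Fin d) ℝ)} {ξ η : Rd d} {h : GL (Fin d) ℝ}
    (hh : h ∈ H) : dualAct h η ∈ dualOrbit H ξ ↔ η ∈ dualOrbit H ξ := by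
  refine ⟨fun h1 => ?_, dualAct_mem_dualOrbit hh⟩
  have := dualAct_mem_dualOrbit (H.inv_mem hh) h1
  rwa [dualAct_inv_dualAct] at this

theorem mem_dualOrbit_self (H : Subgroup (GL (Fin d) ℝ)) (ξ : Rd d) : ξ ∈ dualOrbit H ξ :=
  ⟨1, H.one_mem, (dualAct_one ξ).symm⟩

theorem dualOrbit_eq_of_mem {H : Subgroup (GL (Fin d) ℝ)} {ξ η : Rd d}
    (h : η ∈ dualOrbit H ξ) : dualOrbit H η = dualOrbit H ξ := by
  obtain ⟨g, hg, rfl⟩ := h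
  ext ζ
  constructor
  · rintro ⟨x, hx, rfl⟩
    exact ⟨g * x, H.mul_mem hg hx, by rw [dualAct_mul]⟩
  · rintro ⟨x, hx, rfl⟩
    exact ⟨g⁻¹ * x, H.mul_mem (H.inv_mem hg) hx, by rw [dualAct_mul, dualAct_inv_dualAct]⟩

theorem continuous_dualAct_subgroup (H : Subgroup (GL (Fin d) ℝ)) :
    Continuous fun p : H × Rd d => dualAct (p.1 : GL (Fin d) ℝ) p.2 :=
  continuous_dualAct.comp ((continuous_subtype_val.comp continuous_fst).prodMk continuous_snd)

theorem continuous_dualAct_left (H : Subgroup (GL (Fin d) ℝ)) (ξ : Rd d) :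
    Continuous fun h : H => dualAct (h : GL (Fin d) ℝ) ξ :=
  continuous_dualAct.comp (continuous_subtype_val.prodMk continuous_const)

theorem dualOrbit_eq_iUnion (H : Subgroup (GL (Fin d) ℝ)) [LocallyCompactSpace H] (ξ : Rd d) :
    dualOrbit H ξ =
      ⋃ n, (fun h : H => dualAct (h : GL (Fin d) ℝ) ξ) '' compactCovering H n := by
  rw [← Set.image_iUnion, iUnion_compactCovering, Set.image_univ]
  ext η
  constructor
  · rintro ⟨h, hh, rfl⟩
    exact ⟨⟨h, hh⟩, rfl⟩
  · rintro ⟨h, rfl⟩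
    exact ⟨h, h.2, rfl⟩

/-- The group is σ-compact, so an orbit is a countable union of compact sets. -/
theorem measurableSet_dualOrbit (H : Subgroup (GL (Fin d) ℝ)) [LocallyCompactSpace H]
    (ξ : Rd d) : MeasurableSet (dualOrbit H ξ) := by
  rw [dualOrbit_eq_iUnion]
  exact MeasurableSet.iUnion fun n =>
    ((isCompact_compactCovering H n).image (continuous_dualAct_left H ξ)).measurableSet

/-- The integral of `f` along the orbit of `ξ`. -/
noncomputable def orbitIntegral {H : Subgroup (GL (Fin d) ℝ)} (μ : Measure H)
    (f : Rd d → ℝ≥0∞) (ξ : Rd d) : ℝ≥0∞ :=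
  ∫⁻ h : H, f (dualAct (h : GL (Fin d) ℝ) ξ) ∂μ

theorem measurable_comp_dualAct {H : Subgroup (GL (Fin d) ℝ)} {f : Rd d → ℝ≥0∞}
    (hf : Measurable f) :
    Measurable fun p : H × Rd d => f (dualAct (p.1 : GL (Fin d) ℝ) p.2) :=
  hf.comp (continuous_dualAct_subgroup H).measurable

theorem measurable_orbitIntegral {H : Subgroup (GL (Fin d) ℝ)} {μ : Measure H} [SFinite μ]
    {f : Rd d → ℝ≥0∞} (hf : Measurable f) : Measurable (orbitIntegral μ f) :=
  (measurable_comp_dualAct hf).lintegral_prod_left'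

/-- The dual action is a right action, so moving ξ by g is a left translation in H. -/
theorem orbitIntegral_dualAct {H : Subgroup (GL (Fin d) ℝ)} {μ : Measure H}
    [μ.IsMulLeftInvariant] (f : Rd d → ℝ≥0∞) {g : GL (Fin d) ℝ} (hg : g ∈ H) (ξ : Rd d) :
    orbitIntegral μ f (dualAct g ξ) = orbitIntegral μ f ξ := by
  unfold orbitIntegral
  rw [← lintegral_mul_left_eq_self (μ := μ)
    (fun h : H => f (dualAct (h : GL (Fin d) ℝ) ξ)) ⟨g, hg⟩]
  simp [dualAct_mul]

/-- Preimages of measurable sets under an invariant function are invariant, hence null or conull;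
countably many separating sets in the values single out a constant. -/
theorem IsIrreducibleQuasiRegular.exists_orbitIntegral_eq_const
    {H : Subgroup (GL (Fin d) ℝ)} (hirr : IsIrreducibleQuasiRegular H) {μ : Measure H}
    [SFinite μ] [μ.IsMulLeftInvariant] {f : Rd d → ℝ≥0∞} (hf : Measurable f) :
    ∃ c, ∀ᵐ ξ, orbitIntegral μ f ξ = c := by
  have hm : Measurable (orbitIntegral μ f) := measurable_orbitIntegral hf
  refine exists_eventuallyEq_const_of_forall_separating (l := ae volume) MeasurableSet
    fun U hU => ?_
  rcases hirr.null_or_conull (hm hU) fun h hh ξ hξ => by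
    simpa only [Set.mem_preimage, orbitIntegral_dualAct f hh ξ] using hξ with h0 | h0
  · right
    exact measure_eq_zero_iff_ae_notMem.1 h0
  · left
    simpa using measure_eq_zero_iff_ae_notMem.1 h0

/-- Finite intersections of a countable generating family, indexed by finite sets of naturals:
almost everywhere statements about all members can be combined, and finite measures are determined
on it. -/
theorem exists_countable_piSystem : ∃ S : Finset ℕ → Set (Rd d), (∀ F, MeasurableSet (S F)) ∧
    IsPiSystem (Set.range S) ∧
      (inferInstance : MeasurableSpace (Rd d)) = MeasurableSpace.generateFrom (Set.range S) := by
  let B := MeasurableSpace.natGeneratingSequence (Rd d)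
  have hB : ∀ n, MeasurableSet (B n) := MeasurableSpace.measurableSet_natGeneratingSequence
  have hm : ∀ F : Finset ℕ, MeasurableSet (⋂ i ∈ F, B i) := fun F =>
    F.measurableSet_biInter fun i _ => hB i
  refine ⟨fun F => ⋂ i ∈ F, B i, hm, ?_, le_antisymm ?_ ?_⟩
  · rintro _ ⟨F, rfl⟩ _ ⟨G, rfl⟩ -
    exact ⟨F ∪ G, Finset.set_biInter_inter F G B⟩
  · rw [← MeasurableSpace.generateFrom_natGeneratingSequence (Rd d)]
    refine MeasurableSpace.generateFrom_le ?_
    rintro _ ⟨n, rfl⟩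
    exact MeasurableSpace.measurableSet_generateFrom ⟨{n}, by simp [B]⟩
  · refine MeasurableSpace.generateFrom_le ?_
    rintro _ ⟨F, rfl⟩
    exact hm F

/-- Weighting each orbit by P and pushing forward gives a finite measure on the dual space carried
by that orbit. Ergodicity makes almost all these measures equal, and nonzero measures carried by
disjoint orbits cannot be equal. -/
theorem exists_conull_dualOrbit {H : Subgroup (GL (Fin d) ℝ)}
    (hH : IsClosed (H : Set (GL (Fin d) ℝ))) (hirr : IsIrreducibleQuasiRegular H)
    {μ : Measure H} [μ.IsHaarMeasure] {P : Rd d → ℝ≥0∞} (hP : Measurable P)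
    (hP0 : ¬ P =ᵐ[volume] 0)
    (hint : ∫⁻ h : H, (∫⁻ ξ, P ξ * P (dualAct (h : GL (Fin d) ℝ) ξ)) ∂μ < ∞) :
    ∃ ξ₀ : Rd d, volume (dualOrbit H ξ₀)ᶜ = 0 ∧ orbitIntegral μ P ξ₀ ≠ 0 ∧
      orbitIntegral μ P ξ₀ ≠ ∞ := by
  have : LocallyCompactSpace H := locallyCompactSpace_of_isClosed hH
  have hP1 : ∫⁻ ξ, P ξ ≠ 0 := fun h => hP0 ((lintegral_eq_zero_iff hP).1 h)
  obtain ⟨c, hc⟩ := hirr.exists_orbitIntegral_eq_const (μ := μ) hP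
  have hmeas := measurable_comp_dualAct (H := H) hP
  -- If c were infinite, exchanging the integrals in `hint` would give ∫ P · ∞ = ∞.
  have hctop : c ≠ ∞ := by
    rintro rfl
    rw [lintegral_lintegral_swap ((hP.comp measurable_snd).mul hmeas).aemeasurable] at hint
    have h1 : ∫⁻ ξ, ∫⁻ h : H, P ξ * P (dualAct (h : GL (Fin d) ℝ) ξ) ∂μ =
        ∫⁻ ξ, P ξ * ∞ := by
      refine lintegral_congr_ae ?_
      filter_upwards [hc] with ξ hξ
      have hm : Measurable fun h : H => P (dualAct (h : GL (Fin d) ℝ) ξ) :=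
        hmeas.comp measurable_prodMk_right
      rw [lintegral_const_mul _ hm]
      exact congrArg _ hξ
    rw [h1, lintegral_mul_const _ hP, ENNReal.mul_top hP1] at hint
    exact hint.ne rfl
  -- If c were 0, then ∫ P(hᵀξ) dξ = |det h|⁻¹ ∫ P would vanish for almost every h.
  have hc0 : c ≠ 0 := by
    rintro rfl
    have h1 : ∫⁻ ξ, ∫⁻ h : H, P (dualAct (h : GL (Fin d) ℝ) ξ) ∂μ = 0 :=
      (lintegral_congr_ae hc).trans lintegral_zero
    rw [lintegral_lintegral_swap (f := fun ξ (h : H) => P (dualAct (h : GL (Fin d) ℝ) ξ))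
      (hmeas.comp measurable_swap).aemeasurable,
      lintegral_eq_zero_iff hmeas.lintegral_prod_right'] at h1
    have h2 : ∀ᵐ _ : H ∂μ, False := by
      filter_upwards [h1] with h hh
      rw [lintegral_comp_dualAct _ hP.aemeasurable] at hh
      refine mul_ne_zero ?_ hP1 hh
      simpa using absDet_pos (h : GL (Fin d) ℝ)
    rw [ae_iff] at h2
    simp only [not_false_eq_true, Set.ofPred_true] at h2
    exact (NeZero.ne μ) (Measure.measure_univ_eq_zero.1 h2)
  obtain ⟨S, hS, hpi, hgen⟩ := exists_countable_piSystem (d := d)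
  have hSc : ∀ F, ∃ c, ∀ᵐ ξ, orbitIntegral μ ((S F).indicator P) ξ = c := fun F =>
    hirr.exists_orbitIntegral_eq_const (hP.indicator (hS F))
  choose cS hcS using hSc
  have hgood : ∀ᵐ ξ, orbitIntegral μ P ξ = c ∧
      ∀ F, orbitIntegral μ ((S F).indicator P) ξ = cS F := hc.and (ae_all_iff.2 hcS)
  have hne : (ae (volume : Measure (Rd d))).NeBot := by
    rw [ae_neBot]
    rintro h
    apply hP1
    rw [h, lintegral_zero_measure]
  obtain ⟨ξ₀, hξ₀, hξ₀S⟩ := hgood.exists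
  refine ⟨ξ₀, ?_, hξ₀ ▸ hc0, hξ₀ ▸ hctop⟩
  let ν : Rd d → Measure (Rd d) := fun ξ => (μ.withDensity
    fun h : H => P (dualAct (h : GL (Fin d) ℝ) ξ)).map fun h : H => dualAct (h : GL (Fin d) ℝ) ξ
  have hν : ∀ ξ B, MeasurableSet B → ν ξ B = orbitIntegral μ (B.indicator P) ξ := by
    intro ξ B hB
    have hd := (continuous_dualAct_left H ξ).measurable
    rw [Measure.map_apply hd hB, withDensity_apply _ (hd hB), ← lintegral_indicator (hd hB)]
    rfl
  have key : ∀ ξ, (orbitIntegral μ P ξ = c ∧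
      ∀ F, orbitIntegral μ ((S F).indicator P) ξ = cS F) → ν ξ = ν ξ₀ := by
    rintro ξ ⟨h1, h2⟩
    have hu : ν ξ Set.univ = c := by rw [hν _ _ MeasurableSet.univ, Set.indicator_univ, h1]
    have hu0 : ν ξ₀ Set.univ = c := by rw [hν _ _ MeasurableSet.univ, Set.indicator_univ, hξ₀]
    have : IsFiniteMeasure (ν ξ) := ⟨by rw [hu]; exact hctop.lt_top⟩
    refine ext_of_generate_finite (Set.range S) hgen hpi ?_ (by rw [hu, hu0])
    rintro _ ⟨F, rfl⟩
    rw [hν _ _ (hS F), hν _ _ (hS F), h2, hξ₀S]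
  have hOm := measurableSet_dualOrbit H ξ₀
  rw [measure_eq_zero_iff_ae_notMem]
  filter_upwards [hgood] with ξ hξ
  rw [Set.notMem_compl_iff]
  by_contra hnot
  have h1 : ν ξ (dualOrbit H ξ₀) = 0 := by
    rw [hν _ _ hOm]
    refine (lintegral_congr fun h : H => ?_).trans lintegral_zero
    exact Set.indicator_of_notMem (fun hh => hnot ((dualAct_mem_dualOrbit_iff h.2).1 hh)) _
  have h2 : ν ξ₀ (dualOrbit H ξ₀) = c := by
    rw [hν _ _ hOm, ← hξ₀]
    refine lintegral_congr fun h : H => ?_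
    exact Set.indicator_of_mem (dualAct_mem_dualOrbit h.2 (mem_dualOrbit_self H ξ₀)) _
  rw [key ξ hξ, h2] at h1
  exact hc0 h1

theorem exists_groupSize_le_on_compact {H : Subgroup (GL (Fin d) ℝ)} {K : Set H}
    (hK : IsCompact K) : ∃ M, ∀ h ∈ K, groupSize (h : GL (Fin d) ℝ) ≤ M := by
  obtain ⟨M, hM⟩ := hK.bddAbove_image
    (continuous_groupSize.comp continuous_subtype_val).continuousOn
  exact ⟨M, fun h hh => hM ⟨h, hh, rfl⟩⟩

/-- If a function has a positive and finite integral along an orbit, then the stabilizers are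
bounded. -/
theorem exists_groupSize_le_of_orbitIntegral {H : Subgroup (GL (Fin d) ℝ)}
    (hH : IsClosed (H : Set (GL (Fin d) ℝ))) {μ : Measure H} [μ.IsHaarMeasure]
    {P : Rd d → ℝ≥0∞} {ξ : Rd d} (h0 : orbitIntegral μ P ξ ≠ 0)
    (hfin : orbitIntegral μ P ξ ≠ ∞) :
    ∃ M, ∀ g ∈ H, dualAct g ξ = ξ → groupSize g ≤ M := by
  have : LocallyCompactSpace H := locallyCompactSpace_of_isClosed hH
  let F : H → ℝ≥0∞ := fun h => P (dualAct (h : GL (Fin d) ℝ) ξ)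
  let ρ := μ.withDensity F
  have hρ : ρ Set.univ = orbitIntegral μ P ξ := by
    rw [withDensity_apply _ MeasurableSet.univ, Measure.restrict_univ]
    rfl
  have hlim : Tendsto (fun n => ρ (compactCovering H n)) atTop (𝓝 (ρ Set.univ)) := by
    rw [← iUnion_compactCovering H]
    exact tendsto_measure_iUnion_atTop fun _ _ h => compactCovering_subset H h
  -- Positivity and finiteness enter here: some compact K carries more than half of the total mass,
  -- so every translate of equal mass must meet K.
  have hhalf : ρ Set.univ / 2 < ρ Set.univ := by
    rw [hρ]
    exact ENNReal.half_lt_self h0 hfin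
  obtain ⟨n, hn⟩ := (hlim.eventually (lt_mem_nhds hhalf)).exists
  set K := compactCovering H n
  have hK : IsCompact K := isCompact_compactCovering H n
  obtain ⟨M, hM⟩ := exists_groupSize_le_on_compact hK
  refine ⟨M * M, fun g hg hgξ => ?_⟩
  let γ : H := ⟨g, hg⟩
  -- As γ fixes ξ, the density `F` is invariant under left translation by γ⁻¹, and so is `ρ`.
  have hpre : ρ ((fun h => γ⁻¹ * h) ⁻¹' K) = ρ K := by
    have hKm := hK.measurableSet
    have hKm' : MeasurableSet ((fun h => γ⁻¹ * h) ⁻¹' K) := measurable_const_mul γ⁻¹ hKm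
    rw [withDensity_apply _ hKm, withDensity_apply _ hKm', ← lintegral_indicator hKm,
      ← lintegral_indicator hKm', ← lintegral_mul_left_eq_self (μ := μ) (K.indicator F) γ⁻¹]
    refine lintegral_congr fun h => ?_
    have hF : F (γ⁻¹ * h) = F h := by
      have : dualAct g⁻¹ ξ = ξ := by
        conv_lhs => rw [← hgξ]
        exact dualAct_inv_dualAct g ξ
      simp only [F, γ, Subgroup.coe_mul, Subgroup.coe_inv]
      rw [dualAct_mul, this]
    by_cases hh : γ⁻¹ * h ∈ K
    · have hh' : h ∈ (fun h => γ⁻¹ * h) ⁻¹' K := hh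
      rw [Set.indicator_of_mem hh, Set.indicator_of_mem hh', hF]
    · have hh' : h ∉ (fun h => γ⁻¹ * h) ⁻¹' K := hh
      rw [Set.indicator_of_notMem hh, Set.indicator_of_notMem hh']
  have hmeet : ∃ h, h ∈ K ∧ γ⁻¹ * h ∈ K := by
    by_contra hno
    push Not at hno
    have hdisj : Disjoint K ((fun h => γ⁻¹ * h) ⁻¹' K) := Set.disjoint_left.2 hno
    have h1 : ρ K + ρ K ≤ ρ Set.univ := by
      calc ρ K + ρ K = ρ K + ρ ((fun h => γ⁻¹ * h) ⁻¹' K) := by rw [hpre]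
        _ = ρ (K ∪ (fun h => γ⁻¹ * h) ⁻¹' K) := (measure_union' hdisj hK.measurableSet).symm
        _ ≤ ρ Set.univ := measure_mono (Set.subset_univ _)
    have h2 : ρ Set.univ < ρ K + ρ K := by
      calc ρ Set.univ = ρ Set.univ / 2 + ρ Set.univ / 2 := (ENNReal.add_halves _).symm
        _ < ρ K + ρ K := ENNReal.add_lt_add hn hn
    exact absurd h1 h2.not_ge
  obtain ⟨h, h1, h2⟩ := hmeet
  have e : g = (h : GL (Fin d) ℝ) * ((γ⁻¹ * h : H) : GL (Fin d) ℝ)⁻¹ := by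
    simp [γ]
  rw [e]
  refine (groupSize_mul_le _ _).trans ?_
  rw [groupSize_inv]
  exact mul_le_mul (hM _ h1) (hM _ h2) (groupSize_pos _).le
    ((groupSize_pos _).le.trans (hM _ h1))

end ConullOrbit

/-! ### The Lie algebra of a closed matrix group -/

section TangentAlgebra

open NormedSpace

variable {d : ℕ}

/-- Telescoping: powers of noncommuting matrices are compared one factor at a time. -/
theorem norm_pow_sub_pow_le {a b : Matrix (Fin d) (Fin d) ℝ} {M : ℝ} (ha : ‖a‖ ≤ M)
    (hb : ‖b‖ ≤ M) (hM : 1 ≤ M) (n : ℕ) : ‖a ^ n - b ^ n‖ ≤ n * M ^ n * ‖a - b‖ := by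
  have hbn : ∀ n : ℕ, ‖b ^ n‖ ≤ M ^ n := by
    intro n
    induction n with
    | zero => simpa using norm_one_matrix_le
    | succ n ih =>
      rw [pow_succ, pow_succ]
      exact (norm_mul_le _ _).trans (mul_le_mul ih hb (norm_nonneg _) (by positivity))
  induction n with
  | zero => simp
  | succ n ih =>
    have e : a ^ (n + 1) - b ^ (n + 1) = a * (a ^ n - b ^ n) + (a - b) * b ^ n := by
      rw [pow_succ', pow_succ', mul_sub, sub_mul]
      abel
    have hM0 : 0 ≤ M := zero_le_one.trans hM
    have h1 : ‖a * (a ^ n - b ^ n)‖ ≤ M * (n * M ^ n * ‖a - b‖) :=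
      (norm_mul_le _ _).trans (mul_le_mul ha ih (norm_nonneg _) hM0)
    have h2 : ‖(a - b) * b ^ n‖ ≤ ‖a - b‖ * M ^ (n + 1) := by
      refine (norm_mul_le _ _).trans (mul_le_mul_of_nonneg_left ?_ (norm_nonneg _))
      exact (hbn n).trans (pow_le_pow_right₀ hM n.le_succ)
    rw [e]
    refine (norm_add_le _ _).trans ((add_le_add h1 h2).trans (le_of_eq ?_))
    push_cast
    ring

/-- The exponential of a matrix as an element of the general linear group. -/
noncomputable def expUnit (X : Matrix (Fin d) (Fin d) ℝ) : GL (Fin d) ℝ :=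
  (Matrix.isUnit_exp X).unit

@[simp] theorem coe_expUnit (X : Matrix (Fin d) (Fin d) ℝ) :
    (expUnit X : Matrix (Fin d) (Fin d) ℝ) = exp X := rfl

theorem expUnit_neg (X : Matrix (Fin d) (Fin d) ℝ) : expUnit (-X) = (expUnit X)⁻¹ := by
  refine Units.ext ?_
  rw [Matrix.coe_units_inv, coe_expUnit, coe_expUnit, Matrix.exp_neg]

theorem hasDerivAt_exp_smul_zero (X : Matrix (Fin d) (Fin d) ℝ) :
    HasDerivAt (fun t : ℝ => exp (t • X)) X 0 := by
  have := hasDerivAt_exp_smul_const (𝕂 := ℝ) X 0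
  simpa using this

theorem tendsto_mul_floor_div {ε : ℕ → ℝ} (hε0 : ∀ k, 0 < ε k) (hε : Tendsto ε atTop (𝓝 0))
    {t : ℝ} (ht : 0 ≤ t) : Tendsto (fun k => (⌊t / ε k⌋₊ : ℝ) * ε k) atTop (𝓝 t) := by
  have h1 : ∀ k, (⌊t / ε k⌋₊ : ℝ) * ε k ≤ t := fun k => by
    have := Nat.floor_le (div_nonneg ht (hε0 k).le)
    rwa [le_div_iff₀ (hε0 k)] at this
  have h2 : ∀ k, t - ε k ≤ (⌊t / ε k⌋₊ : ℝ) * ε k := fun k => by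
    have := Nat.lt_floor_add_one (t / ε k)
    rw [div_lt_iff₀ (hε0 k)] at this
    linarith
  refine tendsto_of_tendsto_of_tendsto_of_le_of_le ?_ tendsto_const_nhds h2 h1
  simpa using tendsto_const_nhds.sub hε

theorem tendsto_GL_of_tendsto_coe {u : ℕ → GL (Fin d) ℝ} {v : GL (Fin d) ℝ}
    (h : Tendsto (fun k => (u k : Matrix (Fin d) (Fin d) ℝ)) atTop
      (𝓝 (v : Matrix (Fin d) (Fin d) ℝ))) : Tendsto u atTop (𝓝 v) :=
  (Units.isOpenEmbedding_val (R := Matrix (Fin d) (Fin d) ℝ)).isEmbedding.tendsto_nhds_iff.2 h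

/-- A limit of difference quotients of elements of a closed matrix group generates a one-parameter
subgroup. -/
theorem expUnit_mem_of_tendsto {H : Subgroup (GL (Fin d) ℝ)}
    (hH : IsClosed (H : Set (GL (Fin d) ℝ))) {h : ℕ → GL (Fin d) ℝ} (hmem : ∀ k, h k ∈ H)
    {ε : ℕ → ℝ} (hε0 : ∀ k, 0 < ε k) (hε : Tendsto ε atTop (𝓝 0))
    {Z : Matrix (Fin d) (Fin d) ℝ}
    (hZ : Tendsto (fun k => (ε k)⁻¹ • ((h k : Matrix (Fin d) (Fin d) ℝ) - 1)) atTop (𝓝 Z))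
    (t : ℝ) : expUnit (t • Z) ∈ H := by
  wlog ht : 0 ≤ t generalizing t with hw
  · have h1 := H.inv_mem (hw (-t) (by linarith))
    rwa [← expUnit_neg, neg_smul, neg_neg] at h1
  -- Compare h_k with exp(ε_k Z): they differ by o(ε_k), so their ⌊t/ε_k⌋-th powers differ by o(1),
  -- and the powers of the exponential tend to exp(tZ).
  let b : ℕ → Matrix (Fin d) (Fin d) ℝ := fun k => exp (ε k • Z)
  have hεp : Tendsto ε atTop (𝓝[≠] 0) := tendsto_nhdsWithin_iff.2
    ⟨hε, Eventually.of_forall fun k => (hε0 k).ne'⟩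
  have hb : Tendsto (fun k => (ε k)⁻¹ • (b k - 1)) atTop (𝓝 Z) := by
    have := (hasDerivAt_iff_tendsto_slope_zero.1 (hasDerivAt_exp_smul_zero Z)).comp hεp
    simpa [Function.comp_def, b] using this
  have hδ : Tendsto (fun k => ‖(ε k)⁻¹ • ((h k : Matrix (Fin d) (Fin d) ℝ) - b k)‖)
      atTop (𝓝 0) := by
    have := (hZ.sub hb).norm
    rw [sub_self, norm_zero] at this
    refine this.congr fun k => ?_
    rw [← smul_sub, sub_sub_sub_cancel_right]
  set C : ℝ := ‖Z‖ + 1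
  have hC0 : 0 ≤ C := by positivity
  have hCa := hZ.norm.eventually (gt_mem_nhds (lt_add_one ‖Z‖))
  have hCb := hb.norm.eventually (gt_mem_nhds (lt_add_one ‖Z‖))
  have hnb : ∀ (k : ℕ) (x : Matrix (Fin d) (Fin d) ℝ), ‖(ε k)⁻¹ • (x - 1)‖ < C →
      ‖x‖ ≤ Real.exp (ε k * C) := by
    intro k x hx
    rw [norm_smul, norm_inv, Real.norm_of_nonneg (hε0 k).le, inv_mul_lt_iff₀ (hε0 k)] at hx
    have h1 : ‖x‖ ≤ ‖x - 1‖ + ‖(1 : Matrix (Fin d) (Fin d) ℝ)‖ := by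
      simpa using norm_add_le (x - 1) (1 : Matrix (Fin d) (Fin d) ℝ)
    have h2 := norm_one_matrix_le (d := d)
    have h3 := Real.add_one_le_exp (ε k * C)
    linarith
  let n : ℕ → ℕ := fun k => ⌊t / ε k⌋₊
  have hn : Tendsto (fun k => (n k : ℝ) * ε k) atTop (𝓝 t) := tendsto_mul_floor_div hε0 hε ht
  have hnt : ∀ k, (n k : ℝ) * ε k ≤ t := fun k => by
    have := Nat.floor_le (div_nonneg ht (hε0 k).le)
    rwa [le_div_iff₀ (hε0 k)] at this
  have hdiff : Tendsto (fun k => (h k : Matrix (Fin d) (Fin d) ℝ) ^ n k - b k ^ n k) atTop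
      (𝓝 0) := by
    refine squeeze_zero_norm' (a := fun k => t * Real.exp (t * C) *
      ‖(ε k)⁻¹ • ((h k : Matrix (Fin d) (Fin d) ℝ) - b k)‖) ?_ ?_
    · filter_upwards [hCa, hCb] with k hka hkb
      have h1 := norm_pow_sub_pow_le (hnb k _ hka) (hnb k _ hkb)
        (Real.one_le_exp (mul_nonneg (hε0 k).le hC0)) (n k)
      refine h1.trans ?_
      have h2 : Real.exp (ε k * C) ^ n k ≤ Real.exp (t * C) := by
        rw [← Real.exp_nat_mul]
        apply Real.exp_le_exp.2
        calc (n k : ℝ) * (ε k * C) = n k * ε k * C := by ring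
          _ ≤ t * C := by gcongr; exact hnt k
      have h3 : ‖(h k : Matrix (Fin d) (Fin d) ℝ) - b k‖ =
          ε k * ‖(ε k)⁻¹ • ((h k : Matrix (Fin d) (Fin d) ℝ) - b k)‖ := by
        rw [norm_smul, norm_inv, Real.norm_of_nonneg (hε0 k).le,
          mul_inv_cancel_left₀ (hε0 k).ne']
      rw [h3]
      set δ := ‖(ε k)⁻¹ • ((h k : Matrix (Fin d) (Fin d) ℝ) - b k)‖
      have hδ0 : 0 ≤ δ := norm_nonneg _
      have hεk := (hε0 k).le
      calc (n k : ℝ) * Real.exp (ε k * C) ^ n k * (ε k * δ)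
          = (n k * ε k) * Real.exp (ε k * C) ^ n k * δ := by ring
        _ ≤ t * Real.exp (t * C) * δ := by
          gcongr
          exact hnt k
    · simpa using hδ.const_mul (t * Real.exp (t * C))
  have hbn : Tendsto (fun k => b k ^ n k) atTop (𝓝 (exp (t • Z))) := by
    have hcont : Continuous fun s : ℝ => exp (s • Z) := by
      refine continuous_iff_continuousAt.2 fun s => ?_
      exact (hasDerivAt_exp_smul_const (𝕂 := ℝ) Z s).continuousAt
    refine ((hcont.tendsto t).comp hn).congr fun k => ?_
    simp only [b, Function.comp_apply]
    rw [← Matrix.exp_nsmul, ← Nat.cast_smul_eq_nsmul ℝ, smul_smul]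
  have hlim : Tendsto (fun k => ((h k ^ n k : GL (Fin d) ℝ) : Matrix (Fin d) (Fin d) ℝ)) atTop
      (𝓝 (expUnit (t • Z) : Matrix (Fin d) (Fin d) ℝ)) := by
    have := hdiff.add hbn
    rw [zero_add] at this
    refine this.congr fun k => ?_
    rw [sub_add_cancel, Units.val_pow_eq_pow_val]
  exact hH.mem_of_tendsto (tendsto_GL_of_tendsto_coe hlim)
    (Eventually.of_forall fun k => H.pow_mem (hmem k) _)

theorem expUnit_mem_of_hasDerivAt {H : Subgroup (GL (Fin d) ℝ)}
    (hH : IsClosed (H : Set (GL (Fin d) ℝ))) {γ : ℝ → GL (Fin d) ℝ} (hmem : ∀ t, γ t ∈ H)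
    (h0 : γ 0 = 1) {Z : Matrix (Fin d) (Fin d) ℝ}
    (hγ : HasDerivAt (fun t => (γ t : Matrix (Fin d) (Fin d) ℝ)) Z 0) (t : ℝ) :
    expUnit (t • Z) ∈ H := by
  have hε0 : ∀ k : ℕ, (0 : ℝ) < 1 / ((k : ℝ) + 1) := fun k => by positivity
  have hε : Tendsto (fun k : ℕ => 1 / ((k : ℝ) + 1)) atTop (𝓝 0) :=
    tendsto_one_div_add_atTop_nhds_zero_nat
  refine expUnit_mem_of_tendsto hH (h := fun k : ℕ => γ (1 / ((k : ℝ) + 1)))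
    (fun k => hmem _) hε0 hε ?_ t
  have := (hasDerivAt_iff_tendsto_slope_zero.1 hγ).comp (tendsto_nhdsWithin_iff.2
    ⟨hε, Eventually.of_forall fun k => (hε0 k).ne'⟩)
  simpa [Function.comp_def, h0] using this

/-- The Lie algebra of a closed matrix group. -/
noncomputable def tangentAlgebra (H : Subgroup (GL (Fin d) ℝ))
    (hH : IsClosed (H : Set (GL (Fin d) ℝ))) : Submodule ℝ (Matrix (Fin d) (Fin d) ℝ) where
  carrier := {X | ∀ t : ℝ, expUnit (t • X) ∈ H}
  zero_mem' t := by
    have : expUnit (t • (0 : Matrix (Fin d) (Fin d) ℝ)) = 1 := Units.ext (by simp)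
    rw [this]
    exact H.one_mem
  add_mem' {X Y} hX hY := by
    -- The product curve exp(tX) exp(tY) stays in H and has derivative X + Y at 0.
    refine expUnit_mem_of_hasDerivAt hH (γ := fun t => expUnit (t • X) * expUnit (t • Y))
      (fun t => H.mul_mem (hX t) (hY t)) (Units.ext (by simp)) ?_
    exact ((hasDerivAt_exp_smul_zero X).mul (hasDerivAt_exp_smul_zero Y)).congr_deriv (by simp)
  smul_mem' c X hX t := by
    rw [smul_smul]
    exact hX _

variable {H : Subgroup (GL (Fin d) ℝ)} {hH : IsClosed (H : Set (GL (Fin d) ℝ))}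

theorem conj_mem_tangentAlgebra {X : Matrix (Fin d) (Fin d) ℝ} (hX : X ∈ tangentAlgebra H hH)
    {h : GL (Fin d) ℝ} (hh : h ∈ H) :
    (h : Matrix (Fin d) (Fin d) ℝ) * X * ((h⁻¹ : GL (Fin d) ℝ) : Matrix (Fin d) (Fin d) ℝ) ∈
      tangentAlgebra H hH := by
  intro t
  have : expUnit (t • ((h : Matrix (Fin d) (Fin d) ℝ) * X *
      ((h⁻¹ : GL (Fin d) ℝ) : Matrix (Fin d) (Fin d) ℝ))) = h * expUnit (t • X) * h⁻¹ := by
    refine Units.ext ?_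
    rw [Units.val_mul, Units.val_mul, coe_expUnit, coe_expUnit, ← Matrix.exp_units_conj,
      Matrix.mul_smul, Matrix.smul_mul]
  rw [this]
  exact H.mul_mem (H.mul_mem hh (hX t)) (H.inv_mem hh)

/-- The commutator is the derivative at 0 of exp(tX) Y exp(-tX), a curve in a finite-dimensional and
hence closed subspace. -/
theorem commutator_mem_tangentAlgebra {X Y : Matrix (Fin d) (Fin d) ℝ}
    (hX : X ∈ tangentAlgebra H hH) (hY : Y ∈ tangentAlgebra H hH) :
    X * Y - Y * X ∈ tangentAlgebra H hH := by
  have hclosed : IsClosed (tangentAlgebra H hH : Set (Matrix (Fin d) (Fin d) ℝ)) :=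
    Submodule.closed_of_finiteDimensional _
  let f : ℝ → Matrix (Fin d) (Fin d) ℝ := fun t => exp (t • X) * Y * exp (t • (-X))
  have hf : ∀ t, f t ∈ tangentAlgebra H hH := by
    intro t
    have := conj_mem_tangentAlgebra hY (hX t)
    rwa [← expUnit_neg, ← smul_neg] at this
  have hd : HasDerivAt f (X * Y - Y * X) 0 := by
    exact (((hasDerivAt_exp_smul_zero X).mul_const Y).mul
      (hasDerivAt_exp_smul_zero (-X))).congr_deriv (by simp [← sub_eq_add_neg])
  refine hclosed.mem_of_tendsto (hasDerivAt_iff_tendsto_slope_zero.1 hd) ?_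
  exact Eventually.of_forall fun t =>
    Submodule.smul_mem _ _ (Submodule.sub_mem _ (hf _) (hf _))

end TangentAlgebra

/-! ### Infinitesimal action and triviality of infinitesimal stabilizers -/

section Infinitesimal

open NormedSpace

variable {d : ℕ}

/-- The infinitesimal dual action `X ↦ Xᵀ ξ` as a linear map. -/
noncomputable def infAct (ξ : Rd d) : Matrix (Fin d) (Fin d) ℝ →ₗ[ℝ] Rd d where
  toFun X := matAct X.transpose ξ
  map_add' X Y := by rw [Matrix.transpose_add, matAct_add_left]
  map_smul' c X := by rw [Matrix.transpose_smul, matAct_smul_left, RingHom.id_apply]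

theorem infAct_apply (ξ : Rd d) (X : Matrix (Fin d) (Fin d) ℝ) :
    infAct ξ X = matAct X.transpose ξ := rfl

theorem infAct_mul (ξ : Rd d) (X Y : Matrix (Fin d) (Fin d) ℝ) :
    infAct ξ (X * Y) = infAct (infAct ξ X) Y := by
  simp only [infAct_apply, Matrix.transpose_mul, matAct_mul]

theorem dualAct_eq_infAct (h : GL (Fin d) ℝ) (ξ : Rd d) :
    dualAct h ξ = infAct ξ (h : Matrix (Fin d) (Fin d) ℝ) := rfl

theorem continuous_infAct (ξ : Rd d) : Continuous (infAct ξ) :=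
  LinearMap.continuous_of_finiteDimensional _

theorem infAct_one (ξ : Rd d) : infAct ξ 1 = ξ := by
  simp [infAct_apply]

theorem infAct_smul_vec (c : ℝ) (ξ : Rd d) (X : Matrix (Fin d) (Fin d) ℝ) :
    infAct (c • ξ) X = c • infAct ξ X := matAct_smul _ _ _

theorem infAct_add_vec (ξ η : Rd d) (X : Matrix (Fin d) (Fin d) ℝ) :
    infAct (ξ + η) X = infAct ξ X + infAct η X := matAct_add _ _ _

@[simp] theorem infAct_zero_vec (X : Matrix (Fin d) (Fin d) ℝ) : infAct (0 : Rd d) X = 0 :=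
  matAct_zero _

theorem eq_zero_of_infAct_eq_zero {X : Matrix (Fin d) (Fin d) ℝ} (h : ∀ ξ, infAct ξ X = 0) :
    X = 0 := by
  rw [← Matrix.transpose_eq_zero]
  refine Matrix.ext_of_mulVec_single fun i => ?_
  have := congrArg WithLp.ofLp (h (WithLp.toLp 2 (Pi.single i 1)))
  simp only [infAct_apply, matAct] at this
  rw [Matrix.zero_mulVec]
  exact this

theorem hasSum_infAct_exp (X : Matrix (Fin d) (Fin d) ℝ) (ξ : Rd d) :
    HasSum (fun n => ((n.factorial : ℝ)⁻¹) • infAct ξ (X ^ n)) (infAct ξ (exp X)) := by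
  have h := (exp_series_hasSum_exp' (𝕂 := ℝ) X).mapL (infAct ξ).toContinuousLinearMap
  simpa using h

theorem infAct_pow_of_eigen {X : Matrix (Fin d) (Fin d) ℝ} {ξ : Rd d} {a : ℝ}
    (h : infAct ξ X = a • ξ) (n : ℕ) : infAct ξ (X ^ n) = a ^ n • ξ := by
  induction n with
  | zero => simp [infAct_one]
  | succ n ih => rw [pow_succ, infAct_mul, ih, infAct_smul_vec, h, smul_smul, pow_succ]

theorem dualAct_expUnit_of_eigen {X : Matrix (Fin d) (Fin d) ℝ} {ξ : Rd d} {a : ℝ}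
    (h : infAct ξ X = a • ξ) (t : ℝ) :
    dualAct (expUnit (t • X)) ξ = Real.exp (t * a) • ξ := by
  have h' : infAct ξ (t • X) = (t * a) • ξ := by rw [map_smul, h, smul_smul]
  have h1 := hasSum_infAct_exp (t • X) ξ
  have h2 := (exp_series_hasSum_exp' (𝕂 := ℝ) (t * a)).smul_const ξ
  rw [← Real.exp_eq_exp_ℝ] at h2
  refine h1.unique (h2.congr_fun fun n => ?_)
  rw [infAct_pow_of_eigen h', smul_eq_mul, smul_smul]

theorem dualAct_expUnit_of_nilpotent {X : Matrix (Fin d) (Fin d) ℝ} {ξ : Rd d}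
    (h : infAct (infAct ξ X) X = 0) (t : ℝ) :
    dualAct (expUnit (t • X)) ξ = ξ + t • infAct ξ X := by
  have h1 := hasSum_infAct_exp (t • X) ξ
  have h2 : ∀ n, n ∉ Finset.range 2 →
      ((n.factorial : ℝ)⁻¹) • infAct ξ ((t • X) ^ n) = 0 := by
    intro n hn
    obtain ⟨m, rfl⟩ := Nat.exists_eq_add_of_le (not_lt.1 (mt Finset.mem_range.2 hn))
    simp [pow_add, sq, infAct_mul, h]
  have h3 := h1.unique (hasSum_sum_of_ne_finset_zero h2)
  rw [dualAct_eq_infAct, coe_expUnit, h3]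
  simp [Finset.sum_range_succ, infAct_one]

/-- The Cayley–Hamilton relation with vanishing constant term. -/
theorem mul_self_of_det_eq_zero {B : Matrix (Fin 2) (Fin 2) ℝ} (hB : B.det = 0) :
    B * B = B.trace • B := by
  rw [Matrix.det_fin_two] at hB
  ext i j
  fin_cases i <;> fin_cases j <;>
    simp [Matrix.mul_apply, Fin.sum_univ_two, Matrix.trace_fin_two] <;> linarith

theorem det_eq_zero_of_infAct_eq_zero {X : Matrix (Fin 2) (Fin 2) ℝ} {ξ : Rd 2} (hξ : ξ ≠ 0)
    (h : infAct ξ X = 0) : X.det = 0 := by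
  rw [← Matrix.det_transpose]
  refine Matrix.exists_mulVec_eq_zero_iff.1 ⟨WithLp.ofLp ξ, fun h0 => hξ ?_, ?_⟩
  · ext i
    exact congrFun h0 i
  · exact congrArg WithLp.ofLp h

theorem eq_zero_of_norm_smul_le {w : Rd d} {C : ℝ} (h : ∀ t : ℝ, ‖t • w‖ ≤ C) : w = 0 := by
  by_contra hw
  have hw' : 0 < ‖w‖ := norm_pos_iff.2 hw
  have := h ((C + 1) / ‖w‖)
  have h0 : 0 ≤ C := (norm_nonneg _).trans (h 0)
  rw [norm_smul, Real.norm_of_nonneg (by positivity), div_mul_cancel₀ _ hw'.ne'] at this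
  linarith

/-- A generator of a one-parameter subgroup in a bounded stabilizer vanishes. -/
theorem eq_zero_of_stabilizer_bounded {H : Subgroup (GL (Fin 2) ℝ)}
    {hH : IsClosed (H : Set (GL (Fin 2) ℝ))} {ξ : Rd 2} (hξ : ξ ≠ 0) {M : ℝ}
    (hM : ∀ g ∈ H, dualAct g ξ = ξ → groupSize g ≤ M) {Z : Matrix (Fin 2) (Fin 2) ℝ}
    (hZ : Z ∈ tangentAlgebra H hH) (h0 : infAct ξ Z = 0) : Z = 0 := by
  have hfix : ∀ t : ℝ, dualAct (expUnit (t • Z)) ξ = ξ := fun t => by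
    rw [dualAct_expUnit_of_eigen (a := 0) (by rw [h0, zero_smul]), mul_zero, Real.exp_zero,
      one_smul]
  have hb : ∀ (t : ℝ) (v : Rd 2), ‖dualAct (expUnit (t • Z)) v‖ ≤ M * ‖v‖ := fun t v =>
    (dualAct_le_groupSize _ v).trans
      (mul_le_mul_of_nonneg_right (hM _ (hZ t) (hfix t)) (norm_nonneg v))
  -- Since Z is singular, each vector Zᵀv is an eigenvector with eigenvalue tr Z, so the flow of Z
  -- would grow exponentially, or linearly if tr Z = 0. The bound on the stabilizer excludes both.
  have hZZ := mul_self_of_det_eq_zero (det_eq_zero_of_infAct_eq_zero hξ h0)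
  refine eq_zero_of_infAct_eq_zero fun v => ?_
  by_contra hw
  have hw' : 0 < ‖infAct v Z‖ := norm_pos_iff.2 hw
  have heig : infAct (infAct v Z) Z = Z.trace • infAct v Z := by
    rw [← infAct_mul, hZZ, map_smul]
  have htr : Z.trace = 0 := by
    by_contra hτ
    -- At this time the eigenvector is stretched by M + 1, more than the bound M permits.
    have h1 := hb (Real.log (M + 1) / Z.trace) (infAct v Z)
    have hM1 : 1 ≤ M := (one_le_groupSize _).trans (hM 1 H.one_mem (dualAct_one ξ))
    rw [dualAct_expUnit_of_eigen heig, div_mul_cancel₀ _ hτ, Real.exp_log (by linarith), norm_smul,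
      Real.norm_of_nonneg (by linarith)] at h1
    nlinarith
  rw [htr, zero_smul] at heig
  refine hw (eq_zero_of_norm_smul_le (C := M * ‖v‖ + ‖v‖) fun t => ?_)
  have h1 := hb t v
  rw [dualAct_expUnit_of_nilpotent heig] at h1
  have h2 := norm_sub_le (v + t • infAct v Z) v
  rw [add_sub_cancel_left] at h2
  linarith

end Infinitesimal

/-! ### Openness of an orbit of positive measure -/

section OpenOrbit

open NormedSpace

variable {d : ℕ}

/-- Stabilizers along an orbit are conjugate. -/
theorem stabilizer_bounded_of_mem_dualOrbit {H : Subgroup (GL (Fin d) ℝ)} {ξ η : Rd d}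
    (hM : ∃ M, ∀ g ∈ H, dualAct g ξ = ξ → groupSize g ≤ M) (hη : η ∈ dualOrbit H ξ) :
    ∃ M, ∀ g ∈ H, dualAct g η = η → groupSize g ≤ M := by
  obtain ⟨M, hM⟩ := hM
  obtain ⟨k, hk, rfl⟩ := hη
  refine ⟨groupSize k * M * groupSize k, fun g hg hgη => ?_⟩
  have h1 : groupSize (k * g * k⁻¹) ≤ M := by
    refine hM _ (H.mul_mem (H.mul_mem hk hg) (H.inv_mem hk)) ?_
    rw [dualAct_mul, dualAct_mul, hgη, dualAct_inv_dualAct]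
  have e : g = k⁻¹ * (k * g * k⁻¹) * k := by group
  have h0 := (groupSize_pos k).le
  rw [e]
  refine (groupSize_mul_le _ _).trans (mul_le_mul_of_nonneg_right ?_ h0)
  refine (groupSize_mul_le _ _).trans ?_
  rw [groupSize_inv]
  exact mul_le_mul_of_nonneg_left h1 h0

/-- If a compact piece of an orbit has positive measure and the stabilizers are bounded, then the
tangent algebra acts transitively on tangent vectors at some point of this piece. -/
theorem exists_infAct_surjective {H : Subgroup (GL (Fin 2) ℝ)}
    (hH : IsClosed (H : Set (GL (Fin 2) ℝ))) {ξ₀ : Rd 2} {K : Set H} (hK : IsCompact K)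
    (hpos : volume ((fun h : H => dualAct (h : GL (Fin 2) ℝ) ξ₀) '' K) ≠ 0)
    (hstab : ∃ M, ∀ g ∈ H, dualAct g ξ₀ = ξ₀ → groupSize g ≤ M) (hξ₀ : ξ₀ ≠ 0) :
    ∃ ξ ∈ dualOrbit H ξ₀, ∀ v, ∃ Z ∈ tangentAlgebra H hH, infAct ξ Z = v := by
  set E := (fun h : H => dualAct (h : GL (Fin 2) ℝ) ξ₀) '' K with hE
  have hEm : MeasurableSet E := (hK.image (continuous_dualAct_left H ξ₀)).measurableSet
  -- A Lebesgue density point: at small scales the orbit piece meets every set of positive measure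
  -- placed at ξ.
  obtain ⟨ξ, hdens, hξE⟩ : ∃ ξ, Tendsto (fun r => volume (E ∩ Metric.closedBall ξ r) /
      volume (Metric.closedBall ξ r)) (𝓝[>] 0) (𝓝 1) ∧ ξ ∈ E := by
    have : (ae (volume.restrict E)).NeBot := by
      rwa [ae_neBot, Ne, Measure.restrict_eq_zero]
    exact ((Besicovitch.ae_tendsto_measure_inter_div volume E).and (ae_restrict_mem hEm)).exists
  have hEO : E ⊆ dualOrbit H ξ₀ := by
    rintro _ ⟨h, -, rfl⟩
    exact ⟨h, h.2, rfl⟩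
  refine ⟨ξ, hEO hξE, ?_⟩
  have hξ0 : ξ ≠ 0 := by
    rintro rfl
    obtain ⟨h, -, hh⟩ := hEO hξE
    have := dualAct_inv_dualAct h ξ₀
    rw [← hh] at this
    exact hξ₀ (by rw [← this]; simp [dualAct])
  obtain ⟨M, hM⟩ := stabilizer_bounded_of_mem_dualOrbit hstab (hEO hξE)
  let W : Submodule ℝ (Rd 2) := (tangentAlgebra H hH).map (infAct ξ)
  suffices hW : W = ⊤ by
    intro v
    have : v ∈ W := hW ▸ Submodule.mem_top
    exact this
  by_contra hW
  obtain ⟨v, hvW, hv0⟩ : ∃ v ∈ Wᗮ, v ≠ 0 := Submodule.exists_mem_ne_zero_of_ne_bot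
    fun h => hW ((Submodule.orthogonal_eq_bot_iff).1 h)
  have hvn : 0 < ‖v‖ := norm_pos_iff.2 hv0
  -- A truncated open cone around a direction v orthogonal to the supposed proper tangent space. The
  -- strict inequality keeps 0 out, and its closed form survives limits.
  let T : Set (Rd 2) := {y | ‖y‖ * ‖v‖ < 2 * inner ℝ v y} ∩ Metric.ball 0 1
  have hTo : IsOpen T := (isOpen_lt (by fun_prop) (by fun_prop)).inter Metric.isOpen_ball
  have hTne : T.Nonempty := by
    refine ⟨(1 / (2 * ‖v‖)) • v, ?_, ?_⟩
    · change ‖(1 / (2 * ‖v‖)) • v‖ * ‖v‖ < 2 * inner ℝ v ((1 / (2 * ‖v‖)) • v)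
      rw [norm_smul, inner_smul_right, real_inner_self_eq_norm_sq, Real.norm_of_nonneg
        (by positivity)]
      field_simp
      norm_num
    · rw [mem_ball_zero_iff, norm_smul, Real.norm_of_nonneg (by positivity)]
      field_simp
      norm_num
  have hTpos : volume T ≠ 0 := (hTo.measure_pos _ hTne).ne'
  have hev := Measure.eventually_nonempty_inter_smul_of_density_one volume E ξ hdens T
    hTo.measurableSet hTpos
  have hseq : ∀ k : ℕ, ∃ r : ℝ, 0 < r ∧ r < 1 / ((k : ℝ) + 1) ∧ ∃ y ∈ T, ∃ h ∈ K,
      dualAct ((h : H) : GL (Fin 2) ℝ) ξ₀ = ξ + r • y := by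
    intro k
    obtain ⟨r, ⟨z, ⟨h, hh, hz⟩, hz'⟩, hr0, hr1⟩ := (hev.and (Ioo_mem_nhdsGT
      (show (0 : ℝ) < 1 / ((k : ℝ) + 1) by positivity))).exists
    rw [Set.singleton_add, Set.mem_image] at hz'
    obtain ⟨_, ⟨y, hy, rfl⟩, hy'⟩ := hz'
    exact ⟨r, hr0, hr1, y, hy, h, hh, hz.trans hy'.symm⟩
  choose r hr0 hr1 y hyT h hhK hh using hseq
  obtain ⟨a, haK, φ, hφ, hlim⟩ := hK.tendsto_subseq hhK
  have hr : Tendsto r atTop (𝓝 0) := squeeze_zero (fun k => (hr0 k).le) (fun k => (hr1 k).le)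
    tendsto_one_div_add_atTop_nhds_zero_nat
  have hry : Tendsto (fun k => r k • y k) atTop (𝓝 0) := by
    refine squeeze_zero_norm (fun k => ?_) hr
    rw [norm_smul, Real.norm_of_nonneg (hr0 k).le]
    have := mem_ball_zero_iff.1 (hyT k).2
    nlinarith [hr0 k]
  have haξ : dualAct (a : GL (Fin 2) ℝ) ξ₀ = ξ := by
    have h1 := ((continuous_dualAct_left H ξ₀).tendsto a).comp hlim
    have h2 : Tendsto (fun k => ξ + r (φ k) • y (φ k)) atTop (𝓝 ξ) := by
      simpa using (hry.comp hφ.tendsto_atTop).const_add ξ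
    refine tendsto_nhds_unique (h1.congr fun k => ?_) h2
    exact hh (φ k)
  -- Group elements tending to 1 that move ξ by vectors in the cone.
  let x : ℕ → H := fun k => a⁻¹ * h (φ k)
  have hx : ∀ k, dualAct (x k : GL (Fin 2) ℝ) ξ = ξ + r (φ k) • y (φ k) := by
    intro k
    rw [← hh, ← haξ]
    simp only [x, Subgroup.coe_mul, Subgroup.coe_inv]
    rw [dualAct_mul, dualAct_inv_dualAct]
  have hxlim : Tendsto x atTop (𝓝 1) := by
    have := hlim.const_mul a⁻¹
    rwa [inv_mul_cancel] at this
  -- A limit of the normalized D_k is a unit vector Z of the Lie algebra, even if D_k is much longer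
  -- than the displacement r_k y_k; that case is what the bounded stabilizer rules out.
  let D : ℕ → Matrix (Fin 2) (Fin 2) ℝ := fun k =>
    ((x k : GL (Fin 2) ℝ) : Matrix (Fin 2) (Fin 2) ℝ) - 1
  have hDξ : ∀ k, infAct ξ (D k) = r (φ k) • y (φ k) := by
    intro k
    rw [map_sub, infAct_one, ← dualAct_eq_infAct, hx, add_sub_cancel_left]
  have hy0 : ∀ k, y k ≠ 0 := by
    intro k h0
    have := (hyT k).1
    rw [h0] at this
    simp at this
  have hD0 : ∀ k, 0 < ‖D k‖ := by
    intro k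
    rw [norm_pos_iff]
    intro h0
    have := hDξ k
    rw [h0, map_zero] at this
    exact (smul_ne_zero (hr0 _).ne' (hy0 _)) this.symm
  have hDlim : Tendsto D atTop (𝓝 0) := by
    have h1 : Tendsto (fun k => ((x k : GL (Fin 2) ℝ) : Matrix (Fin 2) (Fin 2) ℝ)) atTop
        (𝓝 (((1 : H) : GL (Fin 2) ℝ) : Matrix (Fin 2) (Fin 2) ℝ)) :=
      ((Units.continuous_val.comp continuous_subtype_val).tendsto (1 : H)).comp hxlim
    simpa [D] using h1.sub_const 1
  have hunit : ∀ k, ‖D k‖⁻¹ • D k ∈ Metric.sphere (0 : Matrix (Fin 2) (Fin 2) ℝ) 1 := by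
    intro k
    rw [mem_sphere_zero_iff_norm, norm_smul, norm_inv, norm_norm, inv_mul_cancel₀ (hD0 k).ne']
  obtain ⟨Z, hZ1, θ, hθ, hZlim⟩ :=
    (isCompact_sphere (0 : Matrix (Fin 2) (Fin 2) ℝ) 1).tendsto_subseq hunit
  have hZmem : Z ∈ tangentAlgebra H hH := fun t =>
    expUnit_mem_of_tendsto hH (h := fun k => (x (θ k) : GL (Fin 2) ℝ)) (fun k => (x (θ k)).2)
      (ε := fun k => ‖D (θ k)‖) (fun k => hD0 _)
      (by simpa using (hDlim.comp hθ.tendsto_atTop).norm) hZlim t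
  have hcone : ∀ k, ‖infAct ξ (‖D k‖⁻¹ • D k)‖ * ‖v‖ ≤
      2 * inner ℝ v (infAct ξ (‖D k‖⁻¹ • D k)) := by
    intro k
    have h1 : ‖y (φ k)‖ * ‖v‖ ≤ 2 * inner ℝ v (y (φ k)) := le_of_lt (hyT (φ k)).1
    have h2 := inv_nonneg.2 (norm_nonneg (D k))
    have h3 := (hr0 (φ k)).le
    rw [map_smul, hDξ, smul_smul, norm_smul, inner_smul_right,
      Real.norm_of_nonneg (mul_nonneg h2 h3)]
    nlinarith [mul_nonneg h2 h3]
  have hlimcone : ‖infAct ξ Z‖ * ‖v‖ ≤ 2 * inner ℝ v (infAct ξ Z) := by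
    have hc := ((continuous_infAct ξ).tendsto Z).comp hZlim
    refine le_of_tendsto_of_tendsto (hc.norm.mul_const ‖v‖)
      ((tendsto_const_nhds.inner hc).const_mul 2) (Eventually.of_forall fun k => hcone (θ k))
  -- The vector Zᵀξ is in the closed cone around v and also orthogonal to v, hence zero; then Z = 0,
  -- against ‖Z‖ = 1.
  have horth : inner ℝ v (infAct ξ Z) = 0 :=
    (Submodule.mem_orthogonal' W v).1 hvW _ ⟨Z, hZmem, rfl⟩
  rw [horth, mul_zero] at hlimcone
  have hZξ : infAct ξ Z = 0 := by
    have := norm_nonneg (infAct ξ Z)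
    rw [← norm_eq_zero]
    nlinarith
  have := eq_zero_of_stabilizer_bounded hξ0 hM hZmem hZξ
  rw [this] at hZ1
  simp at hZ1

/-- For a linear section L of Z ↦ Zᵀξ with values in the Lie algebra, the map y ↦ exp(Ly)ᵀξ has
derivative the identity at 0, so it covers a neighbourhood of ξ. The group carries this
neighbourhood along the orbit. -/
theorem isOpen_dualOrbit {H : Subgroup (GL (Fin 2) ℝ)}
    {hH : IsClosed (H : Set (GL (Fin 2) ℝ))} {ξ : Rd 2}
    (hsurj : ∀ v, ∃ Z ∈ tangentAlgebra H hH, infAct ξ Z = v) : IsOpen (dualOrbit H ξ) := by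
  obtain ⟨X₀, hX₀, e₀⟩ := hsurj (EuclideanSpace.single 0 1)
  obtain ⟨X₁, hX₁, e₁⟩ := hsurj (EuclideanSpace.single 1 1)
  let L : Rd 2 →ₗ[ℝ] Matrix (Fin 2) (Fin 2) ℝ :=
    (EuclideanSpace.proj 0 : Rd 2 →L[ℝ] ℝ).toLinearMap.smulRight X₀ +
      (EuclideanSpace.proj 1 : Rd 2 →L[ℝ] ℝ).toLinearMap.smulRight X₁
  have hL : ∀ y, L y = y 0 • X₀ + y 1 • X₁ := fun y => rfl
  let L' := L.toContinuousLinearMap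
  let A := (infAct ξ).toContinuousLinearMap
  have hcomp : (A ∘L (1 : Matrix (Fin 2) (Fin 2) ℝ →L[ℝ] Matrix (Fin 2) (Fin 2) ℝ)) ∘L L' =
      ContinuousLinearMap.id ℝ (Rd 2) := by
    ext y i
    change infAct ξ (L y) i = y i
    rw [hL, map_add, map_smul, map_smul, e₀, e₁]
    fin_cases i <;> simp
  have hexp : HasStrictFDerivAt (exp : Matrix (Fin 2) (Fin 2) ℝ → Matrix (Fin 2) (Fin 2) ℝ)
      (1 : Matrix (Fin 2) (Fin 2) ℝ →L[ℝ] Matrix (Fin 2) (Fin 2) ℝ) (L' 0) := by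
    rw [map_zero]
    exact hasStrictFDerivAt_exp_zero
  have hF : HasStrictFDerivAt (fun y => A (exp (L' y))) (ContinuousLinearMap.id ℝ (Rd 2)) 0 := by
    rw [← hcomp]
    exact (A.hasStrictFDerivAt.comp _ hexp).comp 0 L'.hasStrictFDerivAt
  have hmap := hF.map_nhds_eq_of_surj (by
    exact LinearMap.range_eq_top.2 fun y => ⟨y, rfl⟩)
  have h0 : A (exp (L' 0)) = ξ := by
    rw [map_zero, exp_zero]
    exact infAct_one ξ
  rw [h0] at hmap
  have hnhds : dualOrbit H ξ ∈ 𝓝 ξ := by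
    rw [← hmap]
    refine Filter.mem_map.2 (Filter.univ_mem' fun y => ?_)
    have hm : L y ∈ tangentAlgebra H hH :=
      Submodule.add_mem _ (Submodule.smul_mem _ _ hX₀) (Submodule.smul_mem _ _ hX₁)
    refine ⟨expUnit (L y), ?_, rfl⟩
    simpa using hm 1
  rw [isOpen_iff_mem_nhds]
  rintro _ ⟨h, hh, rfl⟩
  have hc : ContinuousAt (dualAct h⁻¹) (dualAct h ξ) := (continuous_matAct_right _).continuousAt
  have := hc.preimage_mem_nhds (by rwa [dualAct_inv_dualAct])
  refine mem_of_superset this fun η hη => ?_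
  exact (dualAct_mem_dualOrbit_iff (H.inv_mem hh)).1 hη

end OpenOrbit

/-! ### The dense orbit of an admissible group -/

section AdmissibleOrbit

theorem ne_zero_of_mem_dualOrbit {d : ℕ} {H : Subgroup (GL (Fin d) ℝ)} {ξ η : Rd d} (hξ : ξ ≠ 0)
    (hη : η ∈ dualOrbit H ξ) : η ≠ 0 := by
  rintro rfl
  obtain ⟨h, -, hh⟩ := hη
  have := dualAct_inv_dualAct h ξ
  rw [← hh] at this
  exact hξ (by rw [← this]; simp [dualAct])

theorem dualOrbit_zero {d : ℕ} (H : Subgroup (GL (Fin d) ℝ)) : dualOrbit H (0 : Rd d) = {0} := by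
  ext η
  constructor
  · rintro ⟨h, -, rfl⟩
    simp [dualAct]
  · rintro rfl
    exact mem_dualOrbit_self H 0

/-- The dual action of an admissible group in dimension two has a dense orbit with bounded
stabilizers, on which the tangent algebra acts transitively. -/
theorem IsAdmissible.exists_dense_dualOrbit {H : Subgroup (GL (Fin 2) ℝ)} (hH : IsAdmissible H) :
    ∃ ξ : Rd 2, ξ ≠ 0 ∧ Dense (dualOrbit H ξ) ∧
      (∃ M, ∀ g ∈ H, dualAct g ξ = ξ → groupSize g ≤ M) ∧
      ∀ v, ∃ Z ∈ tangentAlgebra H hH.isClosed, infAct ξ Z = v := by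
  have : LocallyCompactSpace H := locallyCompactSpace_of_isClosed hH.isClosed
  obtain ⟨P, hP, hP0, hint⟩ := hH.squareIntegrable.exists_density
  obtain ⟨ξ₀, hnull, h0, hfin⟩ := exists_conull_dualOrbit hH.isClosed hH.irreducible hP hP0
    (hint Measure.haar inferInstance)
  have hstab := exists_groupSize_le_of_orbitIntegral hH.isClosed h0 hfin
  have hvol : volume (dualOrbit H ξ₀) ≠ 0 := fun h =>
    (NeZero.ne (volume (Set.univ : Set (Rd 2)))) (by
      rw [← Set.union_compl_self (dualOrbit H ξ₀)]
      exact measure_union_null h hnull)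
  have hξ₀ : ξ₀ ≠ 0 := by
    rintro rfl
    rw [dualOrbit_zero] at hvol
    exact hvol (measure_singleton _)
  obtain ⟨n, hn⟩ : ∃ n, volume ((fun h : H => dualAct (h : GL (Fin 2) ℝ) ξ₀) ''
      compactCovering H n) ≠ 0 := by
    by_contra! hcon
    rw [dualOrbit_eq_iUnion] at hvol
    exact hvol (measure_iUnion_null hcon)
  obtain ⟨ξ, hξ, hsurj⟩ := exists_infAct_surjective hH.isClosed (isCompact_compactCovering H n) hn
    hstab hξ₀
  refine ⟨ξ, ne_zero_of_mem_dualOrbit hξ₀ hξ, ?_, stabilizer_bounded_of_mem_dualOrbit hstab hξ,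
    hsurj⟩
  rw [dualOrbit_eq_of_mem hξ]
  exact Measure.dense_of_ae (μ := volume) hnull

/-- It suffices to control the size of the group elements at one base point of an orbit. -/
theorem isSizeControlled_dualOrbit {d : ℕ} {H : Subgroup (GL (Fin d) ℝ)} {ξ : Rd d} {k : ℕ} {C : ℝ}
    (h : ∀ h ∈ H, auxA (dualOrbit H ξ) (dualAct h ξ) ^ k * groupSize h ≤ C) :
    IsSizeControlled H (dualOrbit H ξ) := by
  refine ⟨k, ?_⟩
  rintro _ ⟨g, hg, rfl⟩
  refine ⟨groupSize g * C, fun x hx => ?_⟩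
  rw [← dualAct_mul]
  have h1 := h _ (H.mul_mem hg hx)
  -- Moving the base point by g changes only the constant, which keeps the exponent uniform over the
  -- orbit.
  have h2 : groupSize x ≤ groupSize g * groupSize (g * x) := by
    have := groupSize_mul_le g⁻¹ (g * x)
    rwa [inv_mul_cancel_left, groupSize_inv] at this
  calc _ ≤ auxA (dualOrbit H ξ) (dualAct (g * x) ξ) ^ k * (groupSize g * groupSize (g * x)) :=
        mul_le_mul_of_nonneg_left h2 (pow_nonneg (auxA_nonneg _ _) _)
    _ = groupSize g * (auxA (dualOrbit H ξ) (dualAct (g * x) ξ) ^ k * groupSize (g * x)) := by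
        ring
    _ ≤ _ := mul_le_mul_of_nonneg_left h1 (groupSize_pos g).le

theorem auxA_le_norm_sub {d : ℕ} {O : Set (Rd d)} {ξ η : Rd d} (h : η ∉ O) :
    auxA O ξ ≤ ‖ξ - η‖ := by
  rw [← dist_eq_norm]
  exact (auxA_le_infDist O ξ).trans (Metric.infDist_le_dist_of_mem h)

end AdmissibleOrbit

/-! ### Planar linear algebra with the determinant of two vectors -/

section Plane

/-- The determinant of two vectors of the plane. -/
def cross (v w : Rd 2) : ℝ := v 0 * w 1 - v 1 * w 0

theorem abs_cross_le (v w : Rd 2) : |cross v w| ≤ 2 * ‖v‖ * ‖w‖ := by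
  have hv0 : |v 0| ≤ ‖v‖ := PiLp.norm_apply_le v 0
  have hv1 : |v 1| ≤ ‖v‖ := PiLp.norm_apply_le v 1
  have hw0 : |w 0| ≤ ‖w‖ := PiLp.norm_apply_le w 0
  have hw1 : |w 1| ≤ ‖w‖ := PiLp.norm_apply_le w 1
  have h1 := abs_sub (v 0 * w 1) (v 1 * w 0)
  rw [abs_mul, abs_mul] at h1
  have h2 := mul_le_mul hv0 hw1 (abs_nonneg _) (norm_nonneg v)
  have h3 := mul_le_mul hv1 hw0 (abs_nonneg _) (norm_nonneg v)
  unfold cross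
  linarith

/-- Cramer's rule, stated without division. -/
theorem cross_smul_eq (ξ η x : Rd 2) :
    cross ξ η • x = cross x η • ξ + cross ξ x • η := by
  ext i
  fin_cases i <;> simp [cross] <;> ring

theorem infAct_apply_zero (v : Rd 2) (X : Matrix (Fin 2) (Fin 2) ℝ) :
    infAct v X 0 = X 0 0 * v 0 + X 1 0 * v 1 := by
  simp [infAct_apply, matAct]

theorem infAct_apply_one (v : Rd 2) (X : Matrix (Fin 2) (Fin 2) ℝ) :
    infAct v X 1 = X 0 1 * v 0 + X 1 1 * v 1 := by
  simp [infAct_apply, matAct]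

theorem cross_infAct (v w : Rd 2) (X : Matrix (Fin 2) (Fin 2) ℝ) :
    cross (infAct v X) (infAct w X) = X.det * cross v w := by
  simp only [cross, infAct_apply_zero, infAct_apply_one, Matrix.det_fin_two]
  ring

theorem exists_smul_eq_of_cross_eq_zero {v w : Rd 2} (hv : v ≠ 0) (h : cross v w = 0) :
    ∃ c : ℝ, w = c • v := by
  have h' : v 0 * w 1 - v 1 * w 0 = 0 := h
  by_cases h0 : v 0 = 0
  · have h1 : v 1 ≠ 0 := fun h1 => hv (by ext i; fin_cases i <;> simp [h0, h1])
    refine ⟨w 1 / v 1, ?_⟩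
    have hw : w 0 = 0 := by
      rw [h0] at h'
      simpa [h1] using h'
    ext i
    fin_cases i <;> simp [h0, hw, h1]
  · refine ⟨w 0 / v 0, ?_⟩
    ext i
    fin_cases i
    · simp [h0]
    · simp only [Fin.mk_one, PiLp.smul_apply, smul_eq_mul]
      field_simp
      linarith

/-- A matrix is determined, with a quantitative bound, by its action on a basis. -/
theorem exists_norm_le_of_cross_ne_zero {ξ η : Rd 2} (h : cross ξ η ≠ 0) :
    ∃ K : ℝ, 0 ≤ K ∧ ∀ X : Matrix (Fin 2) (Fin 2) ℝ,
      ‖X‖ ≤ K * (‖infAct ξ X‖ + ‖infAct η X‖) := by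
  have hD : 0 < |cross ξ η| := abs_pos.2 h
  refine ⟨2 * (‖ξ‖ + ‖η‖) / |cross ξ η|, by positivity, fun X => ?_⟩
  rw [← norm_transpose]
  refine ContinuousLinearMap.opNorm_le_bound _ (by positivity) fun x => ?_
  change ‖infAct x X‖ ≤ _
  have e : cross ξ η • infAct x X = cross x η • infAct ξ X + cross ξ x • infAct η X := by
    rw [← infAct_smul_vec, cross_smul_eq, infAct_add_vec, infAct_smul_vec, infAct_smul_vec]
  have h1 := norm_add_le (cross x η • infAct ξ X) (cross ξ x • infAct η X)
  rw [← e, norm_smul, norm_smul, norm_smul, Real.norm_eq_abs, Real.norm_eq_abs,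
    Real.norm_eq_abs] at h1
  have h2 := mul_le_mul_of_nonneg_right (abs_cross_le x η) (norm_nonneg (infAct ξ X))
  have h3 := mul_le_mul_of_nonneg_right (abs_cross_le ξ x) (norm_nonneg (infAct η X))
  rw [div_mul_eq_mul_div, div_mul_eq_mul_div, le_div_iff₀ hD]
  have p1 := mul_nonneg (mul_nonneg (norm_nonneg ξ) (norm_nonneg x)) (norm_nonneg (infAct ξ X))
  have p2 := mul_nonneg (mul_nonneg (norm_nonneg η) (norm_nonneg x)) (norm_nonneg (infAct η X))
  nlinarith

/-- The product of the two roots is c/a, so the smaller one satisfies t² ≤ |c/a|. -/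
theorem exists_root_sq_le {a b c : ℝ} (ha : a ≠ 0) (h : 0 ≤ b ^ 2 - a * c) :
    ∃ t : ℝ, a * t ^ 2 + 2 * b * t + c = 0 ∧ |a| * t ^ 2 ≤ |c| := by
  set s := Real.sqrt (b ^ 2 - a * c) with hs
  have hss : s ^ 2 = b ^ 2 - a * c := Real.sq_sqrt h
  have key : ∀ s' : ℝ, s' ^ 2 = b ^ 2 - a * c →
      a * ((-b + s') / a) ^ 2 + 2 * b * ((-b + s') / a) + c = 0 := by
    intro s' hs'
    field_simp
    linarith
  have hp : |a| * (|(-b + s) / a| * |(-b + -s) / a|) = |c| := by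
    rw [← abs_mul, ← abs_mul]
    congr 1
    field_simp
    linarith
  rcases le_total |(-b + s) / a| |(-b + -s) / a| with hle | hle
  · refine ⟨_, key s hss, ?_⟩
    rw [← hp, ← sq_abs, sq]
    exact mul_le_mul_of_nonneg_left (mul_le_mul_of_nonneg_left hle (abs_nonneg _)) (abs_nonneg a)
  · refine ⟨_, key (-s) (by rw [neg_sq, hss]), ?_⟩
    rw [← hp, ← sq_abs, sq]
    exact mul_le_mul_of_nonneg_left (mul_le_mul_of_nonneg_right hle (abs_nonneg _)) (abs_nonneg a)

/-- The distance of a vector to the set of eigenvectors of an invertible traceless matrix, in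
terms of the associated quadratic form. -/
theorem exists_cross_infAct_eq_zero {X : Matrix (Fin 2) (Fin 2) ℝ} (htr : X.trace = 0)
    (hdet : X.det ≠ 0) {u : Rd 2} (hu : cross u (infAct u X) ≠ 0) :
    ∃ C : ℝ, ∀ v : Rd 2, ∃ w : Rd 2, cross w (infAct w X) = 0 ∧
      ‖v - w‖ ^ 2 ≤ C * |cross v (infAct v X)| := by
  have h11 : X 1 1 = -X 0 0 := by
    rw [Matrix.trace_fin_two] at htr
    linarith
  -- If det X < 0, the form is indefinite: move v along u to a zero of the form, using that a
  -- quarter of the discriminant is -det X · cross(u,v)².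
  rcases lt_or_gt_of_ne hdet with hneg | hpos
  · refine ⟨‖u‖ ^ 2 / |cross u (infAct u X)|, fun v => ?_⟩
    have hdisc : 0 ≤ (-(cross v (infAct u X) + cross u (infAct v X)) / 2) ^ 2 -
        cross u (infAct u X) * cross v (infAct v X) := by
      have : (-(cross v (infAct u X) + cross u (infAct v X)) / 2) ^ 2 -
          cross u (infAct u X) * cross v (infAct v X) = -X.det * (cross u v) ^ 2 := by
        simp only [cross, infAct_apply_zero, infAct_apply_one, Matrix.det_fin_two, h11]
        ring
      rw [this]
      exact mul_nonneg (neg_nonneg.2 hneg.le) (sq_nonneg _)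
    obtain ⟨t, ht, hle⟩ := exists_root_sq_le hu hdisc
    refine ⟨v - t • u, ?_, ?_⟩
    · rw [← ht]
      simp only [cross, infAct_apply_zero, infAct_apply_one, PiLp.sub_apply, PiLp.smul_apply,
        smul_eq_mul]
      ring
    · rw [sub_sub_cancel, norm_smul, mul_pow, Real.norm_eq_abs, sq_abs, div_mul_eq_mul_div,
        le_div_iff₀ (abs_pos.2 hu)]
      nlinarith [sq_nonneg ‖u‖]
  -- If det X > 0, the form is definite, so w = 0 works; completing the square in `e1` and `e2`
  -- bounds both coordinates.
  · refine ⟨(|X 0 1| + |X 1 0|) / X.det, fun v => ⟨0, by simp [cross], ?_⟩⟩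
    rw [sub_zero, div_mul_eq_mul_div, le_div_iff₀ hpos, sq_norm_fin_two]
    have e1 : X 0 1 * cross v (infAct v X) =
        (X 0 1 * v 0 - X 0 0 * v 1) ^ 2 + X.det * v 1 ^ 2 := by
      simp only [cross, infAct_apply_zero, infAct_apply_one, Matrix.det_fin_two, h11]
      ring
    have e2 : -X 1 0 * cross v (infAct v X) =
        (X 1 0 * v 1 + X 0 0 * v 0) ^ 2 + X.det * v 0 ^ 2 := by
      simp only [cross, infAct_apply_zero, infAct_apply_one, Matrix.det_fin_two, h11]
      ring
    have l1 := le_abs_self (X 0 1 * cross v (infAct v X))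
    have l2 := le_abs_self (-X 1 0 * cross v (infAct v X))
    rw [abs_mul] at l1 l2
    rw [abs_neg] at l2
    nlinarith [sq_nonneg (X 0 1 * v 0 - X 0 0 * v 1), sq_nonneg (X 1 0 * v 1 + X 0 0 * v 0)]

theorem cross_infAct_add (v w : Rd 2) (X : Matrix (Fin 2) (Fin 2) ℝ) :
    cross (infAct v X) w + cross v (infAct w X) = X.trace * cross v w := by
  simp only [cross, infAct_apply_zero, infAct_apply_one, Matrix.trace_fin_two]
  ring

theorem eq_zero_of_smul_add_smul_eq_zero {v w : Rd 2} (h : cross v w ≠ 0) {a b : ℝ}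
    (hab : a • v + b • w = 0) : a = 0 ∧ b = 0 := by
  have h0 := congrArg (fun x : Rd 2 => x 0) hab
  have h1 := congrArg (fun x : Rd 2 => x 1) hab
  simp only [PiLp.add_apply, PiLp.smul_apply, smul_eq_mul, PiLp.zero_apply] at h0 h1
  have e1 : a * cross v w = 0 := by
    unfold cross
    linear_combination w 1 * h0 - w 0 * h1
  have e2 : b * cross v w = 0 := by
    unfold cross
    linear_combination v 0 * h1 - v 1 * h0
  exact ⟨(mul_eq_zero.1 e1).resolve_right h, (mul_eq_zero.1 e2).resolve_right h⟩

theorem exists_eq_smul_add_smul {v w : Rd 2} (h : cross v w ≠ 0) (x : Rd 2) :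
    ∃ a b : ℝ, x = a • v + b • w := by
  refine ⟨cross x w / cross v w, cross v x / cross v w, ?_⟩
  rw [div_eq_inv_mul, div_eq_inv_mul, mul_smul, mul_smul, ← smul_add, ← cross_smul_eq,
    smul_smul, inv_mul_cancel₀ h, one_smul]

end Plane

/-! ### Size control from the structure of the Lie algebra -/

section OrbitControl

variable {H : Subgroup (GL (Fin 2) ℝ)} {hH : IsClosed (H : Set (GL (Fin 2) ℝ))} {ξ₁ : Rd 2}

theorem eq_zero_of_mem_dualOrbit (hξ₁ : ξ₁ ≠ 0)
    (hM : ∃ M, ∀ g ∈ H, dualAct g ξ₁ = ξ₁ → groupSize g ≤ M) {η : Rd 2}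
    (hη : η ∈ dualOrbit H ξ₁) {Z : Matrix (Fin 2) (Fin 2) ℝ} (hZ : Z ∈ tangentAlgebra H hH)
    (h0 : infAct η Z = 0) : Z = 0 := by
  obtain ⟨M, hM'⟩ := stabilizer_bounded_of_mem_dualOrbit hM hη
  exact eq_zero_of_stabilizer_bounded (ne_zero_of_mem_dualOrbit hξ₁ hη) hM' hZ h0

/-- An element of the Lie algebra is determined by its tangent vector at any one orbit point; matrix
identities below are proved by evaluating there. -/
theorem eq_of_infAct_eq (hξ₁ : ξ₁ ≠ 0)
    (hM : ∃ M, ∀ g ∈ H, dualAct g ξ₁ = ξ₁ → groupSize g ≤ M) {η : Rd 2}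
    (hη : η ∈ dualOrbit H ξ₁) {Y Z : Matrix (Fin 2) (Fin 2) ℝ} (hY : Y ∈ tangentAlgebra H hH)
    (hZ : Z ∈ tangentAlgebra H hH) (h : infAct η Y = infAct η Z) : Y = Z := by
  rw [← sub_eq_zero]
  refine eq_zero_of_mem_dualOrbit hξ₁ hM hη (Submodule.sub_mem _ hY hZ) ?_
  rw [map_sub, h, sub_self]

/-- Orbits of groups whose tangent algebra is spanned by the identity and an invertible traceless
matrix. -/
theorem isSizeControlled_of_one_mem (hξ₁ : ξ₁ ≠ 0)
    (hM : ∃ M, ∀ g ∈ H, dualAct g ξ₁ = ξ₁ → groupSize g ≤ M)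
    (h1 : (1 : Matrix (Fin 2) (Fin 2) ℝ) ∈ tangentAlgebra H hH)
    {X : Matrix (Fin 2) (Fin 2) ℝ} (hX : X ∈ tangentAlgebra H hH) (htr : X.trace = 0)
    (hdet : X.det ≠ 0) : IsSizeControlled H (dualOrbit H ξ₁) := by
  have hX0 : X ≠ 0 := by
    rintro rfl
    simp at hdet
  -- If ξ were an eigenvector of Xᵀ, then X would be a multiple of 1, impossible for a nonzero
  -- traceless matrix. So zeros of the quadratic form lie outside the orbit.
  have hcross : ∀ ξ ∈ dualOrbit H ξ₁, cross ξ (infAct ξ X) ≠ 0 := by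
    intro ξ hξ h0
    obtain ⟨c, hc⟩ := exists_smul_eq_of_cross_eq_zero (ne_zero_of_mem_dualOrbit hξ₁ hξ) h0
    have hXc : X = c • (1 : Matrix (Fin 2) (Fin 2) ℝ) :=
      eq_of_infAct_eq hξ₁ hM hξ hX (Submodule.smul_mem _ _ h1) (by
        rw [hc, map_smul, infAct_one])
    rw [hXc, Matrix.trace_smul, Matrix.trace_one] at htr
    have : c = 0 := by simpa using htr
    exact hX0 (by rw [hXc, this, zero_smul])
  have hself := mem_dualOrbit_self H ξ₁
  -- Conjugation by h preserves the span of 1 and X. Trace removes the component along 1, and the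
  -- determinant forces hXh⁻¹ = ±X.
  have hcomm : ∀ h ∈ H, ∃ b : ℝ, |b| = 1 ∧ ∀ v : Rd 2,
      infAct (dualAct h v) X = b • dualAct h (infAct v X) := by
    intro h hh
    have hinv : ((h⁻¹ : GL (Fin 2) ℝ) : Matrix (Fin 2) (Fin 2) ℝ) * h = 1 := by
      rw [← Units.val_mul, inv_mul_cancel, Units.val_one]
    set Y := (h : Matrix (Fin 2) (Fin 2) ℝ) * X *
      ((h⁻¹ : GL (Fin 2) ℝ) : Matrix (Fin 2) (Fin 2) ℝ) with hY
    have hYm : Y ∈ tangentAlgebra H hH := conj_mem_tangentAlgebra hX hh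
    set D := cross ξ₁ (infAct ξ₁ X) with hD
    have hD0 : D ≠ 0 := hcross _ hself
    set a := cross (infAct ξ₁ Y) (infAct ξ₁ X) / D with ha
    set b := cross ξ₁ (infAct ξ₁ Y) / D with hb
    have hYab : Y = a • (1 : Matrix (Fin 2) (Fin 2) ℝ) + b • X := by
      refine eq_of_infAct_eq hξ₁ hM hself hYm
        (Submodule.add_mem _ (Submodule.smul_mem _ _ h1) (Submodule.smul_mem _ _ hX)) ?_
      rw [map_add, map_smul, map_smul, infAct_one, ha, hb, div_eq_inv_mul, div_eq_inv_mul,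
        mul_smul, mul_smul, ← smul_add, ← cross_smul_eq, ← hD, smul_smul, inv_mul_cancel₀ hD0,
        one_smul]
    have htrY : Y.trace = 0 := by
      rw [hY, Matrix.trace_mul_comm, ← mul_assoc, hinv, one_mul, htr]
    have hdetY : Y.det = X.det := by
      rw [hY, Matrix.det_mul, Matrix.det_mul, mul_right_comm, ← Matrix.det_mul, ← Units.val_mul,
        mul_inv_cancel, Units.val_one, Matrix.det_one, one_mul]
    have ha0 : a = 0 := by
      rw [hYab, Matrix.trace_add, Matrix.trace_smul, Matrix.trace_smul, htr] at htrY
      simpa using htrY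
    rw [ha0, zero_smul, zero_add] at hYab
    have hb1 : |b| = 1 := by
      rw [hYab, Matrix.det_smul] at hdetY
      have : b ^ 2 = 1 := by
        refine mul_right_cancel₀ hdet ?_
        simpa using hdetY
      rcases sq_eq_sq_iff_eq_or_eq_neg.1 (this.trans (one_pow 2).symm) with h | h <;> simp [h]
    have hbb : b * b = 1 := by rw [← abs_mul_abs_self, hb1, one_mul]
    have hhX : (h : Matrix (Fin 2) (Fin 2) ℝ) * X = b • (X * (h : Matrix (Fin 2) (Fin 2) ℝ)) := by
      rw [← Matrix.smul_mul, ← hYab, hY, mul_assoc, hinv, mul_one]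
    refine ⟨b, hb1, fun v => ?_⟩
    rw [dualAct_eq_infAct, dualAct_eq_infAct, ← infAct_mul, ← infAct_mul, hhX, map_smul]
  obtain ⟨C, hC⟩ := exists_cross_infAct_eq_zero htr hdet (hcross _ hself)
  refine IsSizeControlled.of_bounds 2 fun ξ hξ => ?_
  obtain ⟨K, hK0, hK⟩ := exists_norm_le_of_cross_ne_zero (hcross ξ hξ)
  refine ⟨max (K * (1 + ‖X‖)) (C * |cross ξ (infAct ξ X)|), fun h hh => ?_⟩
  obtain ⟨b, hb, hbX⟩ := hcomm h hh
  have hA0 := auxA_nonneg (dualOrbit H ξ₁) (dualAct h ξ)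
  have hA1 := auxA_le_one (dualOrbit H ξ₁) (dualAct h ξ)
  have hAn := auxA_mul_le_one (dualOrbit H ξ₁) (dualAct h ξ)
  set A := auxA (dualOrbit H ξ₁) (dualAct h ξ) with hA
  constructor
  · refine le_trans ?_ (le_max_left _ _)
    -- As X commutes with h up to sign, the size of hᵀξ also bounds the image of the second basis
    -- vector Xᵀξ.
    have hn : ‖dualAct h (infAct ξ X)‖ ≤ ‖X‖ * ‖dualAct h ξ‖ := by
      have := norm_matAct_le X.transpose (dualAct h ξ)
      rw [norm_transpose, ← infAct_apply, hbX, norm_smul, Real.norm_eq_abs, hb, one_mul] at this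
      exact this
    have h2 : ‖(h : Matrix (Fin 2) (Fin 2) ℝ)‖ ≤ K * ((1 + ‖X‖) * ‖dualAct h ξ‖) := by
      refine (hK _).trans (mul_le_mul_of_nonneg_left ?_ hK0)
      rw [← dualAct_eq_infAct, ← dualAct_eq_infAct]
      linarith
    have h3 : A ^ 2 * ‖dualAct h ξ‖ ≤ 1 := by
      nlinarith [mul_nonneg hA0 (norm_nonneg (dualAct h ξ))]
    calc _ ≤ A ^ 2 * (K * ((1 + ‖X‖) * ‖dualAct h ξ‖)) :=
          mul_le_mul_of_nonneg_left h2 (sq_nonneg A)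
      _ = K * (1 + ‖X‖) * (A ^ 2 * ‖dualAct h ξ‖) := by ring
      _ ≤ K * (1 + ‖X‖) * 1 := mul_le_mul_of_nonneg_left h3 (by positivity)
      _ = _ := mul_one _
  · refine le_trans ?_ (le_max_right _ _)
    -- The form at hᵀξ is ±det h times its value at ξ, and it bounds the squared distance to its
    -- zero set; hence A² is at most a constant times |det h|.
    obtain ⟨w, hw, hvw⟩ := hC (dualAct h ξ)
    have hwO : w ∉ dualOrbit H ξ₁ := fun hwO => hcross w hwO hw
    have hAw : A ≤ ‖dualAct h ξ - w‖ := auxA_le_norm_sub hwO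
    have e : |cross (dualAct h ξ) (infAct (dualAct h ξ) X)| =
        absDet h * |cross ξ (infAct ξ X)| := by
      rw [absDet, ← abs_mul, ← cross_infAct, ← dualAct_eq_infAct, ← dualAct_eq_infAct, hbX]
      have : cross (dualAct h ξ) (b • dualAct h (infAct ξ X)) =
          b * cross (dualAct h ξ) (dualAct h (infAct ξ X)) := by
        simp only [cross, PiLp.smul_apply, smul_eq_mul]
        ring
      rw [this, abs_mul, hb, one_mul]
    rw [e] at hvw
    rw [← div_eq_mul_inv, div_le_iff₀ (absDet_pos h)]
    calc A ^ 2 ≤ ‖dualAct h ξ - w‖ ^ 2 := by gcongr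
      _ ≤ _ := hvw
      _ = _ := by ring

theorem pow_mul_rpow_le_pow {A z C e : ℝ} {m : ℕ} (hA0 : 0 ≤ A) (hA1 : A ≤ 1) (hz : 0 < z)
    (h1 : A * z ≤ C) (h2 : A * z⁻¹ ≤ C) (hC : 1 ≤ C) (hk : |e| ≤ m) : A ^ m * z ^ e ≤ C ^ m :=
  (pow_mul_rpow_le hA0 hA1 hz h1 h2 hk).trans (by
    rw [← Real.rpow_natCast]
    exact Real.rpow_le_rpow_of_exponent_le hC hk)

/-- Elements sending ξ to -ξ form at most one coset of the stabilizer. -/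
theorem exists_bound_of_dualAct_eq_or_neg {d : ℕ} {H : Subgroup (GL (Fin d) ℝ)} {ξ : Rd d}
    (hM : ∃ M, ∀ g ∈ H, dualAct g ξ = ξ → groupSize g ≤ M) :
    ∃ M, ∀ g ∈ H, dualAct g ξ = ξ ∨ dualAct g ξ = -ξ → groupSize g ≤ M := by
  obtain ⟨M, hM⟩ := hM
  by_cases h : ∃ y ∈ H, dualAct y ξ = -ξ
  · obtain ⟨y, hy, hyξ⟩ := h
    refine ⟨max M (M * groupSize y), fun g hg => ?_⟩
    rintro (hgξ | hgξ)
    · exact (hM g hg hgξ).trans (le_max_left _ _)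
    · refine le_trans ?_ (le_max_right _ _)
      have h1 : groupSize (g * y⁻¹) ≤ M := by
        refine hM _ (H.mul_mem hg (H.inv_mem hy)) ?_
        rw [dualAct_mul, hgξ, ← hyξ, dualAct_inv_dualAct]
      have h2 := groupSize_mul_le (g * y⁻¹) y
      rw [inv_mul_cancel_right] at h2
      exact h2.trans (mul_le_mul_of_nonneg_right h1 (groupSize_pos y).le)
  · refine ⟨M, fun g hg hgξ => ?_⟩
    rcases hgξ with hgξ | hgξ
    · exact hM g hg hgξ
    · exact absurd ⟨g, hg, hgξ⟩ h

/-- Orbits of groups whose tangent algebra contains a nilpotent matrix. -/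
theorem isSizeControlled_of_nilpotent (hξ₁ : ξ₁ ≠ 0)
    (hM : ∃ M, ∀ g ∈ H, dualAct g ξ₁ = ξ₁ → groupSize g ≤ M)
    {E N : Matrix (Fin 2) (Fin 2) ℝ} (hE : E ∈ tangentAlgebra H hH) (hN : N ∈ tangentAlgebra H hH)
    {η : Rd 2} (hη : η ≠ 0) {τ : ℝ} (hEξ : infAct ξ₁ E = ξ₁) (hEη : infAct η E = τ • η)
    (hNξ : infAct ξ₁ N = η) (hNη : infAct η N = 0) : IsSizeControlled H (dualOrbit H ξ₁) := by
  have hself := mem_dualOrbit_self H ξ₁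
  have hN0 : N ≠ 0 := by
    rintro rfl
    exact hη (by rw [← hNξ, map_zero])
  -- If η were a multiple of ξ₁, then N would act on ξ₁ by a scalar; Nᵀη = 0 then forces η = 0.
  have hD : cross ξ₁ η ≠ 0 := by
    intro h0
    obtain ⟨c, hc⟩ := exists_smul_eq_of_cross_eq_zero hξ₁ h0
    have hc0 : c • η = 0 := by
      rw [← hNη, hc, infAct_smul_vec, hNξ, hc]
    rcases smul_eq_zero.1 hc0 with h | h
    · exact hη (by rw [hc, h, zero_smul])
    · exact hη h
  obtain ⟨K, hK0, hK⟩ := exists_norm_le_of_cross_ne_zero hD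
  obtain ⟨M, hM'⟩ := exists_bound_of_dualAct_eq_or_neg hM
  have hM1 : 0 ≤ M := (groupSize_pos 1).le.trans (hM' 1 H.one_mem (Or.inl (dualAct_one _)))
  set L : ℝ := |cross ξ₁ η| with hL
  have hL0 : 0 < L := abs_pos.2 hD
  have hnil : ∀ s : ℝ, groupSize (expUnit (s • N)) ≤
      (1 + 2 * (K * (‖ξ₁‖ + ‖η‖))) * (1 + |s|) := by
    have hb : ∀ s : ℝ, ‖(expUnit (s • N) : Matrix (Fin 2) (Fin 2) ℝ)‖ ≤
        K * (‖ξ₁‖ + ‖η‖) * (1 + |s|) := by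
      intro s
      have e1 := dualAct_expUnit_of_nilpotent (X := N) (ξ := ξ₁) (by rw [hNξ, hNη]) s
      have e2 := dualAct_expUnit_of_eigen (X := N) (ξ := η) (a := 0) (by rw [hNη, zero_smul]) s
      rw [mul_zero, Real.exp_zero, one_smul] at e2
      refine (hK _).trans ?_
      rw [← dualAct_eq_infAct, ← dualAct_eq_infAct, e1, e2, hNξ, mul_assoc]
      refine mul_le_mul_of_nonneg_left ?_ hK0
      have := norm_add_le ξ₁ (s • η)
      rw [norm_smul, Real.norm_eq_abs] at this
      nlinarith [mul_nonneg (norm_nonneg ξ₁) (abs_nonneg s)]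
    intro s
    have h1 := hb s
    have h2 := hb (-s)
    rw [abs_neg, neg_smul, expUnit_neg] at h2
    unfold groupSize
    rw [matNorm_eq_norm, matNorm_eq_norm]
    nlinarith [abs_nonneg s]
  have hdiag : ∀ t : ℝ, groupSize (expUnit (t • E)) ≤ (1 + K * (‖ξ₁‖ + ‖η‖)) *
      (1 + Real.exp t + Real.exp t ^ (-1 : ℝ) + Real.exp t ^ τ + Real.exp t ^ (-τ)) := by
    have hb : ∀ t : ℝ, ‖(expUnit (t • E) : Matrix (Fin 2) (Fin 2) ℝ)‖ ≤
        K * (‖ξ₁‖ + ‖η‖) * (Real.exp t + Real.exp (t * τ)) := by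
      intro t
      have e1 := dualAct_expUnit_of_eigen (X := E) (ξ := ξ₁) (a := 1) (by rw [hEξ, one_smul]) t
      have e2 := dualAct_expUnit_of_eigen hEη t
      rw [mul_one] at e1
      refine (hK _).trans ?_
      rw [← dualAct_eq_infAct, ← dualAct_eq_infAct, e1, e2, norm_smul, norm_smul,
        Real.norm_of_nonneg (Real.exp_pos _).le, Real.norm_of_nonneg (Real.exp_pos _).le, mul_assoc]
      refine mul_le_mul_of_nonneg_left ?_ hK0
      nlinarith [mul_nonneg (norm_nonneg ξ₁) (Real.exp_pos (t * τ)).le,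
        mul_nonneg (norm_nonneg η) (Real.exp_pos t).le]
    intro t
    have h1 := hb t
    have h2 := hb (-t)
    rw [neg_smul, expUnit_neg] at h2
    rw [← Real.exp_mul, ← Real.exp_mul, ← Real.exp_mul]
    have e1 : t * -1 = -t := by ring
    have e2 : t * -τ = -t * τ := by ring
    rw [e1, e2]
    unfold groupSize
    rw [matNorm_eq_norm, matNorm_eq_norm]
    have := mul_nonneg hK0 (add_nonneg (norm_nonneg ξ₁) (norm_nonneg η))
    nlinarith [Real.exp_pos t, Real.exp_pos (-t), Real.exp_pos (t * τ), Real.exp_pos (-t * τ)]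
  obtain ⟨m', hm'⟩ := exists_nat_ge |τ|
  set m := m' + 1 with hm
  have hmτ : |τ| ≤ m := by
    rw [hm]
    push_cast
    linarith
  have hm1 : |(-1 : ℝ)| ≤ m := by
    rw [hm]
    push_cast
    rw [abs_neg, abs_one]
    linarith [(Nat.cast_nonneg m' : (0 : ℝ) ≤ m')]
  -- The summands bound, in order: 1 itself, A|l| and A|r| by Cramer's rule, and A/|l| by the
  -- distance to the line ℝη.
  set C : ℝ := 1 + 2 * (‖ξ₁‖ + ‖η‖) / L + ‖ξ₁‖ with hC
  have hC1 : 1 ≤ C := by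
    have : 0 ≤ 2 * (‖ξ₁‖ + ‖η‖) / L := by positivity
    linarith [norm_nonneg ξ₁]
  have hC0 : 0 ≤ C := zero_le_one.trans hC1
  set B₁ := 1 + 2 * (K * (‖ξ₁‖ + ‖η‖)) with hB₁
  set B₂ := 1 + K * (‖ξ₁‖ + ‖η‖) with hB₂
  have hB₁0 : 0 ≤ B₁ := by positivity
  have hB₂0 : 0 ≤ B₂ := by positivity
  -- The factor A^(m+1) controls the shear parameter s = ±r|l|^(-τ), and A^m the diagonal part.
  refine isSizeControlled_dualOrbit (k := (m + 1) + m)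
    (C := M * ((B₁ * (1 + C * C ^ m)) * (B₂ * (1 + 4 * C ^ m)))) fun h hh => ?_
  set v := dualAct h ξ₁ with hv
  have hA0 := auxA_nonneg (dualOrbit H ξ₁) v
  have hA1 := auxA_le_one (dualOrbit H ξ₁) v
  have hAn := auxA_mul_le_one (dualOrbit H ξ₁) v
  set A := auxA (dualOrbit H ξ₁) v with hA
  have hvO : v ∈ dualOrbit H ξ₁ := ⟨h, hh, rfl⟩
  set l := cross v η / cross ξ₁ η with hl
  set r := cross ξ₁ v / cross ξ₁ η with hr
  have hdec : v = l • ξ₁ + r • η := by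
    rw [hl, hr, div_eq_inv_mul, div_eq_inv_mul, mul_smul, mul_smul, ← smul_add, ← cross_smul_eq,
      smul_smul, inv_mul_cancel₀ hD, one_smul]
  -- N annihilates the line ℝη, while no nonzero Lie algebra element annihilates an orbit point. So
  -- l ≠ 0 and A is at most |l| ‖ξ₁‖.
  have hrη : ∀ x : ℝ, x • η ∉ dualOrbit H ξ₁ := by
    intro x hx
    exact hN0 (eq_zero_of_mem_dualOrbit hξ₁ hM hx hN (by
      rw [infAct_smul_vec, hNη, smul_zero]))
  have hl0 : l ≠ 0 := by
    intro h0
    rw [h0, zero_smul, zero_add] at hdec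
    exact hrη r (hdec ▸ hvO)
  have hlpos : 0 < |l| := abs_pos.2 hl0
  have hAv : A * ‖v‖ ≤ 1 := by nlinarith
  have hAl : A * |l| ≤ C := by
    have h1 := abs_cross_le v η
    have h2 : A * (2 * ‖v‖ * ‖η‖) ≤ 2 * (‖ξ₁‖ + ‖η‖) := by
      nlinarith [norm_nonneg η, norm_nonneg ξ₁]
    have h3 : A * |l| ≤ 2 * (‖ξ₁‖ + ‖η‖) / L := by
      rw [hl, abs_div, ← hL, ← mul_div_assoc]
      exact div_le_div_of_nonneg_right ((mul_le_mul_of_nonneg_left h1 hA0).trans h2) hL0.le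
    linarith [norm_nonneg ξ₁]
  have hAr : A * |r| ≤ C := by
    have h1 := abs_cross_le ξ₁ v
    have h2 : A * (2 * ‖ξ₁‖ * ‖v‖) ≤ 2 * (‖ξ₁‖ + ‖η‖) := by
      nlinarith [norm_nonneg η, norm_nonneg ξ₁]
    have h3 : A * |r| ≤ 2 * (‖ξ₁‖ + ‖η‖) / L := by
      rw [hr, abs_div, ← hL, ← mul_div_assoc]
      exact div_le_div_of_nonneg_right ((mul_le_mul_of_nonneg_left h1 hA0).trans h2) hL0.le
    linarith [norm_nonneg ξ₁]
  have hAl' : A * |l|⁻¹ ≤ C := by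
    have h1 : A ≤ ‖v - r • η‖ := auxA_le_norm_sub (hrη r)
    have h2 : v - r • η = l • ξ₁ := by
      conv_lhs => rw [hdec]
      rw [add_sub_cancel_right]
    rw [h2, norm_smul, Real.norm_eq_abs] at h1
    rw [← div_eq_mul_inv, div_le_iff₀ hlpos]
    have : 0 ≤ 2 * (‖ξ₁‖ + ‖η‖) / L := by positivity
    nlinarith
  -- The connected part of the group reaches only the half-plane l > 0; the sign ε moves hᵀξ₁ into
  -- it.
  set ε : ℝ := l / |l| with hε
  have hεl : ε * |l| = l := div_mul_cancel₀ _ hlpos.ne'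
  have hε1 : ε = 1 ∨ ε = -1 := by
    rcases abs_choice l with h | h
    · left
      rw [hε, h, div_self hl0]
    · right
      rw [hε, h, div_neg, div_self hl0]
  have hεε : ε * ε = 1 := by rcases hε1 with h | h <;> rw [h] <;> norm_num
  have hεabs : |ε| = 1 := by rcases hε1 with h | h <;> rw [h] <;> simp
  set t := Real.log |l| with ht
  have hexp : Real.exp t = |l| := Real.exp_log hlpos
  set s := ε * r * |l| ^ (-τ) with hs
  -- By the right action, ξ₁ goes to ξ₁ + sη and then to |l|ξ₁ + s|l|^τ η, which equals εv for this
  -- s.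
  set g := expUnit (s • N) * expUnit (t • E) with hg
  have hgH : g ∈ H := H.mul_mem (hN s) (hE t)
  have hgξ : dualAct g ξ₁ = ε • v := by
    have e1 := dualAct_expUnit_of_nilpotent (X := N) (ξ := ξ₁) (by rw [hNξ, hNη]) s
    have e2 := dualAct_expUnit_of_eigen (X := E) (ξ := ξ₁) (a := 1) (by rw [hEξ, one_smul]) t
    have e3 := dualAct_expUnit_of_eigen hEη t
    rw [mul_one, hexp] at e2
    rw [Real.exp_mul, hexp] at e3
    rw [hg, dualAct_mul, e1, hNξ, dualAct_eq_infAct, infAct_add_vec, infAct_smul_vec,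
      ← dualAct_eq_infAct, ← dualAct_eq_infAct, e2, e3, hdec, smul_add, smul_smul, smul_smul,
      smul_smul]
    have c1 : ε * l = |l| := by
      conv_lhs => rw [← hεl]
      rw [← mul_assoc, hεε, one_mul]
    have c2 : s * |l| ^ τ = ε * r := by
      rw [hs, mul_assoc, ← Real.rpow_add hlpos, neg_add_cancel, Real.rpow_zero, mul_one]
    rw [c1, c2]
  -- The quotient hg⁻¹ sends ξ₁ to ±ξ₁, so h is a bounded element times the explicit g.
  have hy : groupSize (h * g⁻¹) ≤ M := by
    refine hM' _ (H.mul_mem hh (H.inv_mem hgH)) ?_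
    have e : dualAct (h * g⁻¹) ξ₁ = ε • ξ₁ := by
      have e1 : v = ε • dualAct g ξ₁ := by rw [hgξ, smul_smul, hεε, one_smul]
      rw [dualAct_mul, ← hv, e1, dualAct_eq_infAct, infAct_smul_vec, ← dualAct_eq_infAct,
        dualAct_inv_dualAct]
    rw [e]
    rcases hε1 with h | h
    · left
      rw [h, one_smul]
    · right
      rw [h, neg_smul, one_smul]
  have hsize : groupSize h ≤ M * ((B₁ * (1 + |s|)) *
      (B₂ * (1 + |l| + |l| ^ (-1 : ℝ) + |l| ^ τ + |l| ^ (-τ)))) := by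
    have h1 := groupSize_mul_le (h * g⁻¹) g
    rw [inv_mul_cancel_right] at h1
    refine h1.trans (mul_le_mul hy ?_ (groupSize_pos g).le hM1)
    have h2 := hdiag t
    rw [hexp] at h2
    refine (groupSize_mul_le _ _).trans (mul_le_mul (hnil s) h2 (groupSize_pos _).le ?_)
    positivity
  have hAm0 : 0 ≤ A ^ m := pow_nonneg hA0 m
  have hAm1 : A ^ m ≤ 1 := pow_le_one₀ hA0 hA1
  have b1 : A ^ m * |l| ^ τ ≤ C ^ m := pow_mul_rpow_le_pow hA0 hA1 hlpos hAl hAl' hC1 hmτ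
  have b2 : A ^ m * |l| ^ (-τ) ≤ C ^ m :=
    pow_mul_rpow_le_pow hA0 hA1 hlpos hAl hAl' hC1 (by rwa [abs_neg])
  have b3 : A ^ m * |l| ^ (-1 : ℝ) ≤ C ^ m := pow_mul_rpow_le_pow hA0 hA1 hlpos hAl hAl' hC1 hm1
  have b4 : A ^ m * |l| ≤ C ^ m := by
    have := pow_mul_rpow_le_pow (e := 1) hA0 hA1 hlpos hAl hAl' hC1 (by rwa [abs_neg] at hm1)
    rwa [Real.rpow_one] at this
  have f2 : A ^ m * (1 + |l| + |l| ^ (-1 : ℝ) + |l| ^ τ + |l| ^ (-τ)) ≤ 1 + 4 * C ^ m := by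
    linarith
  have f1 : A ^ (m + 1) * (1 + |s|) ≤ 1 + C * C ^ m := by
    have hsabs : |s| = |r| * |l| ^ (-τ) := by
      rw [hs, abs_mul, abs_mul, hεabs, one_mul, abs_of_pos (Real.rpow_pos_of_pos hlpos _)]
    have h1 : A ^ (m + 1) ≤ 1 := pow_le_one₀ hA0 hA1
    have h2 : (A * |r|) * (A ^ m * |l| ^ (-τ)) ≤ C * C ^ m :=
      mul_le_mul hAr b2 (mul_nonneg hAm0 (Real.rpow_nonneg hlpos.le _)) hC0
    calc _ = A ^ (m + 1) + (A * |r|) * (A ^ m * |l| ^ (-τ)) := by rw [hsabs]; ring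
      _ ≤ _ := add_le_add h1 h2
  calc A ^ (m + 1 + m) * groupSize h ≤ A ^ (m + 1 + m) * (M * ((B₁ * (1 + |s|)) *
      (B₂ * (1 + |l| + |l| ^ (-1 : ℝ) + |l| ^ τ + |l| ^ (-τ))))) :=
        mul_le_mul_of_nonneg_left hsize (pow_nonneg hA0 _)
    _ = M * ((B₁ * (A ^ (m + 1) * (1 + |s|))) *
      (B₂ * (A ^ m * (1 + |l| + |l| ^ (-1 : ℝ) + |l| ^ τ + |l| ^ (-τ))))) := by ring
    _ ≤ _ := by
      have g1 := mul_le_mul_of_nonneg_left f1 hB₁0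
      have g2 := mul_le_mul_of_nonneg_left f2 hB₂0
      have g3 : 0 ≤ B₁ * (1 + C * C ^ m) :=
        mul_nonneg hB₁0 (add_nonneg zero_le_one (mul_nonneg hC0 (pow_nonneg hC0 m)))
      have g4 : 0 ≤ 1 + |l| + |l| ^ (-1 : ℝ) + |l| ^ τ + |l| ^ (-τ) := by positivity
      exact mul_le_mul_of_nonneg_left
        (mul_le_mul g1 g2 (mul_nonneg hB₂0 (mul_nonneg hAm0 g4)) g3) hM1

/-- Evaluation at ξ₁ identifies the Lie algebra with the plane. Either it contains 1, and then a
second traceless generator is invertible or nilpotent; or the element E with Eᵀξ₁ = ξ₁ has a second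
eigenvalue τ ≠ 1, and commutators produce a nilpotent generator. -/
theorem isSizeControlled_of_infAct_surjective (hξ₁ : ξ₁ ≠ 0)
    (hM : ∃ M, ∀ g ∈ H, dualAct g ξ₁ = ξ₁ → groupSize g ≤ M)
    (hsurj : ∀ v, ∃ Z ∈ tangentAlgebra H hH, infAct ξ₁ Z = v) :
    IsSizeControlled H (dualOrbit H ξ₁) := by
  have hself := mem_dualOrbit_self H ξ₁
  obtain ⟨E, hE, hEξ⟩ := hsurj ξ₁
  obtain ⟨η₀, hη₀⟩ : ∃ η₀ : Rd 2, cross ξ₁ η₀ ≠ 0 := by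
    refine ⟨WithLp.toLp 2 ![-ξ₁ 1, ξ₁ 0], ?_⟩
    have := norm_pos_iff.2 hξ₁
    have h2 := sq_norm_fin_two ξ₁
    simp only [cross, Matrix.cons_val_zero, Matrix.cons_val_one]
    nlinarith [pow_pos this 2]
  by_cases h1 : (1 : Matrix (Fin 2) (Fin 2) ℝ) ∈ tangentAlgebra H hH
  · obtain ⟨Y, hY, hYξ⟩ := hsurj η₀
    set X := Y - (Y.trace / 2) • (1 : Matrix (Fin 2) (Fin 2) ℝ) with hX
    have hXm : X ∈ tangentAlgebra H hH := Submodule.sub_mem _ hY (Submodule.smul_mem _ _ h1)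
    have htr : X.trace = 0 := by
      rw [hX, Matrix.trace_sub, Matrix.trace_smul, Matrix.trace_one]
      simp
    by_cases hdet : X.det = 0
    · refine isSizeControlled_of_nilpotent hξ₁ hM h1 hXm (η := infAct ξ₁ X) (τ := 1) ?_
        (infAct_one _) (by rw [infAct_one, one_smul]) rfl ?_
      · rw [hX, map_sub, map_smul, infAct_one, hYξ, sub_ne_zero]
        intro h
        apply hη₀
        rw [h]
        simp only [cross, PiLp.smul_apply, smul_eq_mul]
        ring
      · rw [← infAct_mul, mul_self_of_det_eq_zero hdet, htr, zero_smul, map_zero]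
    · exact isSizeControlled_of_one_mem hξ₁ hM h1 hXm htr hdet
  · obtain ⟨β, τ, hdec⟩ := exists_eq_smul_add_smul hη₀ (infAct η₀ E)
    -- A repeated eigenvalue is impossible: [E,N] = -βE has trace 0 while tr E = 2, so β = 0 and E =
    -- 1, which was excluded.
    by_cases hτ1 : τ = 1
    · exfalso
      rw [hτ1, one_smul] at hdec
      obtain ⟨N, hN, hNξ⟩ := hsurj η₀
      have hcomm : E * N - N * E = (-β) • E := by
        refine eq_of_infAct_eq hξ₁ hM hself (commutator_mem_tangentAlgebra hE hN)
          (Submodule.smul_mem _ _ hE) ?_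
        rw [map_sub, infAct_mul, infAct_mul, hEξ, hNξ, hdec, map_smul, hEξ, neg_smul]
        abel
      have htr := congrArg Matrix.trace hcomm
      rw [Matrix.trace_sub, Matrix.trace_mul_comm, sub_self, Matrix.trace_smul, smul_eq_mul] at htr
      have htrE : E.trace = 2 := by
        have h2 := cross_infAct_add ξ₁ η₀ E
        rw [hEξ, hdec] at h2
        refine mul_right_cancel₀ hη₀ (h2.symm.trans ?_)
        simp only [cross, PiLp.add_apply, PiLp.smul_apply, smul_eq_mul]
        ring
      have hβ : β = 0 := by
        rw [htrE] at htr
        linarith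
      rw [hβ, zero_smul, zero_add] at hdec
      obtain ⟨K, -, hK⟩ := exists_norm_le_of_cross_ne_zero hη₀
      have h3 := hK (E - 1)
      rw [map_sub, map_sub, infAct_one, infAct_one, hEξ, hdec, sub_self, sub_self, norm_zero,
        add_zero, mul_zero] at h3
      rw [← sub_eq_zero.1 (norm_le_zero_iff.1 h3)] at h1
      exact h1 hE
    · have hτ0 : τ - 1 ≠ 0 := sub_ne_zero.2 hτ1
      -- Chosen so that η₀ + cξ₁ is an eigenvector of Eᵀ for the eigenvalue τ.
      set c := β / (τ - 1) with hc
      have hcβ : c * τ = β + c := by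
        rw [hc]
        field_simp
        ring
      set η := η₀ + c • ξ₁ with hη
      have hD : cross ξ₁ η ≠ 0 := by
        have : cross ξ₁ η = cross ξ₁ η₀ := by
          simp only [hη, cross, PiLp.add_apply, PiLp.smul_apply, smul_eq_mul]
          ring
        rwa [this]
      have hη0 : η ≠ 0 := by
        intro h
        rw [h] at hD
        simp [cross] at hD
      have hEη : infAct η E = τ • η := by
        rw [hη, infAct_add_vec, infAct_smul_vec, hEξ, hdec, smul_add, smul_smul, mul_comm τ c, hcβ,
          add_smul]
        abel
      obtain ⟨N, hN, hNξ⟩ := hsurj η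
      have hcomm : E * N - N * E = (1 - τ) • N := by
        refine eq_of_infAct_eq hξ₁ hM hself (commutator_mem_tangentAlgebra hE hN)
          (Submodule.smul_mem _ _ hN) ?_
        rw [map_sub, infAct_mul, infAct_mul, hEξ, hNξ, hEη, map_smul, hNξ, sub_smul, one_smul]
      refine isSizeControlled_of_nilpotent hξ₁ hM hE hN hη0 hEξ hEη hNξ ?_
      -- Evaluating [E,N] = (1 - τ)N at η, with Nᵀη = aξ₁ + bη, gives 2a(τ - 1) = 0 and b(τ - 1) =
      -- 0, so Nᵀη = 0.
      obtain ⟨a, b, hab⟩ := exists_eq_smul_add_smul hD (infAct η N)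
      have h2 := congrArg (infAct η) hcomm
      rw [map_sub, infAct_mul, infAct_mul, hEη, infAct_smul_vec, map_smul, hab, infAct_add_vec,
        infAct_smul_vec, infAct_smul_vec, hEξ, hEη] at h2
      have h3 : (a * (τ - 1) * 2) • ξ₁ + (b * (τ - 1)) • η = 0 := by
        rw [← sub_eq_zero] at h2
        rw [← h2]
        module
      obtain ⟨ha, hb⟩ := eq_zero_of_smul_add_smul_eq_zero hD h3
      have ha' : a = 0 := by simpa [hτ0] using ha
      have hb' : b = 0 := by simpa [hτ0] using hb
      rw [hab, ha', hb', zero_smul, zero_smul, add_zero]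

end OrbitControl

/-! ### Assembly: admissible groups and the main theorem -/

theorem IsAdmissible.existsUnique_isOpenDualOrbit {H : Subgroup (GL (Fin 2) ℝ)}
    (hH : IsAdmissible H) : (∃! O : Set (Rd 2), IsOpenDualOrbit H O) ∧
      ∀ O : Set (Rd 2), IsOpenDualOrbit H O → IsSizeControlled H O := by
  obtain ⟨ξ, hξ, hdense, hM, hsurj⟩ := hH.exists_dense_dualOrbit
  have hO : IsOpenDualOrbit H (dualOrbit H ξ) := ⟨isOpen_dualOrbit hsurj, ξ, rfl⟩
  refine ⟨⟨_, hO, fun O h => hO.eq_of_dense hdense h⟩, fun O h => ?_⟩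
  rw [hO.eq_of_dense hdense h]
  exact isSizeControlled_of_infAct_surjective hξ hM hsurj

end

theorem mainTheorem10 :
    (∀ H : Subgroup (GL (Fin 2) ℝ), IsAdmissible H →
      (∃! O : Set (Rd 2), IsOpenDualOrbit H O) ∧
      ∀ O : Set (Rd 2), IsOpenDualOrbit H O →
        ∀ w : H → ℝ, Continuous w → (∀ h, 0 < w h) →
          (∃ C u : ℝ, ∀ h : H, w h ≤
            C * (1 + matNorm ((h : GL (Fin 2) ℝ) : Matrix (Fin 2) (Fin 2) ℝ) +
              matNorm (((h : GL (Fin 2) ℝ)⁻¹ : GL (Fin 2) ℝ) : Matrix (Fin 2) (Fin 2) ℝ)) ^ u) →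
          IsTemperatelyEmbedded H O w) ∧
    ((∀ O : Set (Rd 2), IsOpenDualOrbit similitudeGroup O ↔ O = {ξ | ξ ≠ 0}) ∧
      ∀ (u : ℝ) (w : similitudeGroup → ℝ), Continuous w → (∀ h, 0 < w h) →
        (∀ h, w h ≤ (entry h 0 0 ^ 2 + entry h 0 1 ^ 2) ^ u +
          (entry h 0 0 ^ 2 + entry h 0 1 ^ 2) ^ (-u)) →
        IsTemperatelyEmbedded similitudeGroup {ξ | ξ ≠ 0} w) ∧
    ((∀ O : Set (Rd 2), IsOpenDualOrbit diagonalGroup O ↔ O = {ξ | ξ 0 ≠ 0 ∧ ξ 1 ≠ 0}) ∧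
      ∀ (t u : ℝ) (w : diagonalGroup → ℝ), Continuous w → (∀ h, 0 < w h) →
        (∀ h, w h ≤ (|entry h 0 0| + |entry h 0 0|⁻¹) ^ t *
          (|entry h 1 1| + |entry h 1 1|⁻¹) ^ u) →
        IsTemperatelyEmbedded diagonalGroup {ξ | ξ 0 ≠ 0 ∧ ξ 1 ≠ 0} w) ∧
    (∀ c : ℝ,
      (∀ O : Set (Rd 2), IsOpenDualOrbit (shearletGroup c) O ↔ O = {ξ | ξ 0 ≠ 0}) ∧
      ∀ (u : ℝ) (w : shearletGroup c → ℝ), Continuous w → (∀ h, 0 < w h) →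
        (∀ h, w h ≤ (|entry h 0 0| + |entry h 0 0|⁻¹ + |entry h 0 1|) ^ u) →
        IsTemperatelyEmbedded (shearletGroup c) {ξ | ξ 0 ≠ 0} w) ∧
    (∀ r₁ r₂ : ℝ, IsTemperatelyEmbedded (shearletGroup (1 / 2)) {ξ | ξ 0 ≠ 0}
      (fun h => |entry h 0 0| ^ r₁ *
        (|entry h 0 0| + |entry h 0 0|⁻¹ +
          |entry h 0 0| ^ (-(1 / 2) : ℝ) * |entry h 0 1|) ^ r₂)) := by
  refine ⟨fun H hH => ⟨hH.existsUnique_isOpenDualOrbit.1, fun O hO w hwc hw0 hw => ?_⟩, ?_, ?_, ?_,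
    fun r₁ r₂ => isTemperatelyEmbedded_shearletGroup_half r₁ r₂⟩
  · obtain ⟨C, u, hw⟩ := hw
    exact (hH.existsUnique_isOpenDualOrbit.2 O hO).isTemperatelyEmbedded hH.isClosed hwc hw0 hw
  · exact ⟨isOpenDualOrbit_similitudeGroup.iff_of_dense (dense_compl_singleton 0),
      fun u w hwc hw0 hw => isTemperatelyEmbedded_similitudeGroup u w hwc hw0 hw⟩
  · exact ⟨isOpenDualOrbit_diagonalGroup.iff_of_dense dense_two_coord_ne_zero,
      fun t u w hwc hw0 hw => isTemperatelyEmbedded_diagonalGroup t u w hwc hw0 hw⟩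
  · exact fun c => ⟨(isOpenDualOrbit_shearletGroup c).iff_of_dense (dense_coord_ne_zero 0),
      fun u w hwc hw0 hw => isTemperatelyEmbedded_shearletGroup c u w hwc hw0 hw⟩
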